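/- Let $p>1$, $q>p-1$, and put $\beta_q=\frac{p}{q+1-p}$, $\lambda_q=\beta_q(q\beta_q-2)$ and $c_q=\beta_q^{p-2}\lambda_q$. Consider the equation $$\frac{d}{d\sigma}\Big[\big(\beta_q^2\omega^2+\omega'^2\big)^{\frac{p-2}{2}}\omega'\Big]+\lambda_q\big(\beta_q^2\omega^2+\omega'^2\big)^{\frac{p-2}{2}}\omega+|\omega|^{q-1}\omega=0\qquad(\ast)$$ on $S^1=\mathbb R/2\pi\mathbb Z$. A solution is a $2\pi$-periodic function $\omega\in C^1(\mathbb R)$ such that $\big(\beta_q^2\omega^2+\omega'^2\big)^{(p-2)/2}\omega'$ (taken to be $0$ where $\omega=\omega'=0$; likewise for the second term) is differentiable and $(\ast)$ holds at every point. Let $\mathcal E$ be the set of solutions that take both positive and negative values, and $\mathcal E^+$ the set of everywhere positive solutions. (i) There are functions $\omega_k$, for integers $k\ge k_q$, such that $\omega_k$ has least period $2\pi/k$ and $$\mathcal E=\bigcup_{k=k_q}^{\infty}\{\omega_k(\cdot+\psi):\psi\in S^1\}.$$ Here $k_q=1$ if $p<2$ and $q\ge \frac{2(p-1)}{2-p}$;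 otherwise (that is, if $p\ge2$, or $p<2$ and $q<\frac{2(p-1)}{2-p}$) $k_q$ is the smallest positive integer with $k_q>M_q$, where $M_q=\frac{2}{q-1}$ if $p=2$, and $$M_q=\frac{(p-2)m_q}{((p-1)m_q+1)(m_q-1)},\qquad m_q=\sqrt{\frac{2(p-1)+(p-2)q}{p(p-1)}}$$ if $p\ne2$. (ii) If $p\ge 2$, or if $p<2$ and $q\le\frac{2(p-1)}{2-p}$, then $\mathcal E^+=\emptyset$. If $p<2$ and $q>\frac{2(p-1)}{2-p}$, then $\mathcal E^+$ consists of exactly one function, the constant $(-c_q)^{1/(q+1-p)}$. -/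

import Mathlib

namespace SeparableSolutions

noncomputable section

/-- The exponent `β_q = p / (q + 1 - p)`. -/
def betaQ (p q : ℝ) : ℝ := p / (q + 1 - p)

/-- The constant `λ_q = β_q (q β_q - 2)`. -/
def lambdaQ (p q : ℝ) : ℝ := betaQ p q * (q * betaQ p q - 2)

/-- The constant `c_q = β_q ^ (p - 2) λ_q`. -/
def cQ (p q : ℝ) : ℝ := betaQ p q ^ (p - 2) * lambdaQ p q

/-- The weight `(β_q² ω² + ω'²) ^ ((p - 2) / 2)`. -/
def weight (p q : ℝ) (ω : ℝ → ℝ) (σ : ℝ) : ℝ :=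
  (betaQ p q ^ 2 * ω σ ^ 2 + deriv ω σ ^ 2) ^ ((p - 2) / 2)

/-- The flux `(β_q² ω² + ω'²) ^ ((p - 2) / 2) ω'`. For `p > 1` it is a continuous function of
`(ω, ω')`, with value `0` at `(0, 0)`. -/
def flux (p q : ℝ) (ω : ℝ → ℝ) (σ : ℝ) : ℝ := weight p q ω σ * deriv ω σ

/-- `ω` is a solution on the circle `ℝ / 2πℤ` of
`[(β_q² ω² + ω'²) ^ ((p-2)/2) ω']' + λ_q (β_q² ω² + ω'²) ^ ((p-2)/2) ω + |ω|^(q-1) ω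
  - c |ω|^(p-2) ω = 0`:
a `2π`-periodic function of class `C¹` on the line, whose flux is differentiable and which
satisfies the equation at every point. -/
structure IsSolution (p q c : ℝ) (ω : ℝ → ℝ) : Prop where
  contDiff : ContDiff ℝ 1 ω
  periodic : Function.Periodic ω (2 * Real.pi)
  differentiable_flux : Differentiable ℝ (flux p q ω)
  equation : ∀ σ : ℝ,
    deriv (flux p q ω) σ + lambdaQ p q * weight p q ω σ * ω σ
      + |ω σ| ^ (q - 1) * ω σ - c * |ω σ| ^ (p - 2) * ω σ = 0

/-- The set `𝓔` of sign changing solutions. -/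
def signChangingSolutions (p q c : ℝ) : Set (ℝ → ℝ) :=
  {ω | IsSolution p q c ω ∧ (∃ σ, ω σ < 0) ∧ (∃ σ, 0 < ω σ)}

/-- The set `𝓔⁺` of positive solutions. -/
def positiveSolutions (p q c : ℝ) : Set (ℝ → ℝ) :=
  {ω | IsSolution p q c ω ∧ ∀ σ, 0 < ω σ}

/-- `T` is the least (positive) period of `f`. -/
def HasLeastPeriod (f : ℝ → ℝ) (T : ℝ) : Prop :=
  IsLeast {t : ℝ | 0 < t ∧ Function.Periodic f t} T

/-- `m_q = √((2 (p - 1) + (p - 2) q) / (p (p - 1)))`. -/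
def mQ (p q : ℝ) : ℝ := √((2 * (p - 1) + (p - 2) * q) / (p * (p - 1)))

/-- The threshold `M_q`. It is only used when `2 (p - 1) + (p - 2) q > 0`, in which case
`m_q > 0`; moreover `m_q = 1` only for `p = 2`. -/
def bigMQ (p q : ℝ) : ℝ :=
  if p = 2 then 2 / (q - 1)
  else (p - 2) * mQ p q / (((p - 1) * mQ p q + 1) * (mQ p q - 1))

/-- The integer `k_q`: it is `1` if `p < 2` and `q ≥ 2 (p - 1) / (2 - p)`, and the smallest
positive integer `k` with `k > M_q` otherwise. -/
def kQ (p q : ℝ) : ℕ :=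
  if p < 2 ∧ 2 * (p - 1) / (2 - p) ≤ q then 1
  else sInf {k : ℕ | 0 < k ∧ bigMQ p q < (k : ℝ)}

end

end SeparableSolutions

namespace SeparableSolutions

open Real Filter Topology Set
open scoped NNReal

/-! In the coordinates `β ω = ρ sin θ`, `ω' = ρ cos θ`, with `x` an affine function of `log ρ`, the
equation becomes an autonomous planar system with `θ' = N / (β W)`, where `W = sin² θ + (p - 1) cos²
θ` and `N = angLin + exp x * |sin θ| ^ (q + 1)`. A solution that is not identically zero never has
`ω = ω' = 0` (`IsSolution.radius_sq_pos`), so polar coordinates exist along the whole line.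

Sign-changing solutions. Such a solution has a zero, hence starts at angle `0` or `π`. From there
`N` stays positive, so the orbit is a graph `x = X θ` of an even, `π`-periodic profile determined by
`X 0` (`exists_isProfile`, `IsPolar.radial_eq`). The least period of the wave is twice `travel p q X
π = ∫ β W / N` over `[0, π]`. Profiles are ordered by `X 0` and `N` increases with `x`, so this half
period is strictly decreasing in `X 0`; it is continuous and tends to `0` as `X 0 → ∞`. As `X 0 →
-∞` the nonlinear part of `N` disappears: for `λ > 0` the half period tends to, but never reaches,
`2 ∫ β W / angLin = π / M_q` over `[0, π/2]`, while for `λ ≤ 0` it is unbounded because `angLin` has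
a zero in `[0, π/2]`. Hence the half period `π / k` is attained exactly when `k ≥ k_q`, for exactly
one profile. This gives one solution up to translation for each such `k`.

Positive solutions. For `λ ≥ 0` the flux of a positive solution would be strictly decreasing and
periodic. For `λ < 0` put `y = ω' / ω` and let `P` be the flux divided by `ω ^ (p - 1)`. An energy
identity for `P` gives `∫ P'² + (q + 1 - p)(p - 1) ∫ (y P)² = ν² ∫ P²` between critical points, with
`ν² = -λ (q + 1 - p) < 1`. As `P` vanishes at both ends, the Dirichlet inequality on an interval of
length at most `π` forces `P = 0`. A maximum and a minimum can be chosen at distance at most `π`, so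
the solution is constant. -/

theorem betaQ_pos {p q : ℝ} (hp : 1 < p) (hq : p - 1 < q) : 0 < betaQ p q := by
  unfold betaQ; apply div_pos <;> linarith

theorem mul_betaQ {p q : ℝ} (hq : p - 1 < q) : (q + 1 - p) * betaQ p q = p := by
  unfold betaQ; field_simp [show q + 1 - p ≠ 0 by linarith]

/-! ### Polar coordinates for the equation -/

/-- The radius `(β² ω² + ω'²)^(1/2)` as a function of the logarithmic radial variable. -/
noncomputable def radius (p q x : ℝ) : ℝ := exp ((x + (q - 1) * log (betaQ p q)) / (q + 1 - p))

/-- The weight `sin² θ + (p - 1) cos² θ`. -/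
noncomputable def angWeight (p θ : ℝ) : ℝ := sin θ ^ 2 + (p - 1) * cos θ ^ 2

/-- The part of the angular speed that does not depend on the radius. -/
noncomputable def angLin (p q θ : ℝ) : ℝ :=
  (p - 1) * betaQ p q ^ 2 * cos θ ^ 2 + lambdaQ p q * sin θ ^ 2

/-- The numerator of the angular speed. -/
noncomputable def angNum (p q θ x : ℝ) : ℝ := angLin p q θ + exp x * |sin θ| ^ (q + 1)

/-- The numerator of the radial speed. -/
noncomputable def radNum (p q θ x : ℝ) : ℝ :=
  (q + 1 - p) * cos θ *
    ((betaQ p q ^ 2 - lambdaQ p q) * sin θ - exp x * (|sin θ| ^ (q - 1) * sin θ))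

/-- The equation in polar coordinates `β ω = ρ sin θ`, `ω' = ρ cos θ`, where `ρ = radius p q x`. -/
structure IsPolar (p q : ℝ) (θ x : ℝ → ℝ) : Prop where
  angle : ∀ σ, HasDerivAt θ (angNum p q (θ σ) (x σ) / (betaQ p q * angWeight p (θ σ))) σ
  radial : ∀ σ, HasDerivAt x (radNum p q (θ σ) (x σ) / (betaQ p q * angWeight p (θ σ))) σ

theorem angWeight_pos {p : ℝ} (hp : 1 < p) (θ : ℝ) : 0 < angWeight p θ := by
  unfold angWeight
  have h := sin_sq_add_cos_sq θ
  rcases eq_or_ne (cos θ) 0 with h0 | h0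
  · rw [h0] at h ⊢; nlinarith
  · have : 0 < cos θ ^ 2 := by positivity
    nlinarith [sq_nonneg (sin θ)]

theorem abs_rpow_mul_self {q : ℝ} (hq : 0 < q) (s : ℝ) :
    |s| ^ (q + 1) = |s| ^ (q - 1) * s * s := by
  rcases eq_or_ne s 0 with rfl | h
  · simp; exact zero_rpow (by linarith)
  · have h1 : 0 < |s| := abs_pos.2 h
    rw [show q + 1 = (q - 1) + 2 by ring, rpow_add h1, rpow_two, sq_abs]; ring

/-- This identity makes the derivative of `ρ sin θ / β` collapse to `ρ cos θ`, which is the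
compatibility of the two polar coordinates. -/
theorem angLin_add (p q θ : ℝ) :
    (betaQ p q ^ 2 - lambdaQ p q) * sin θ ^ 2 + angLin p q θ
      = betaQ p q ^ 2 * angWeight p θ := by
  unfold angLin angWeight; ring

theorem radius_pos (p q x : ℝ) : 0 < radius p q x := exp_pos _

/-- The normalization of `x` is chosen so that the reaction term enters the polar system with
coefficient exactly `exp x`. -/
theorem radius_rpow {p q : ℝ} (hp : 1 < p) (hq : p - 1 < q) (x : ℝ) :
    radius p q x ^ (q + 1 - p) = betaQ p q ^ (q - 1) * exp x := by
  have hb := betaQ_pos hp hq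
  unfold radius
  rw [← exp_mul, div_mul_cancel₀ _ (by linarith), rpow_def_of_pos hb, ← exp_add]
  congr 1; ring

/-- The function with given polar coordinates. -/
noncomputable def ofPolar (p q : ℝ) (θ x : ℝ → ℝ) (σ : ℝ) : ℝ :=
  radius p q (x σ) * sin (θ σ) / betaQ p q

theorem IsPolar.hasDerivAt_radius {p q : ℝ} (hq : p - 1 < q) {θ x : ℝ → ℝ}
    (h : IsPolar p q θ x) (σ : ℝ) :
    HasDerivAt (fun σ => radius p q (x σ)) (radius p q (x σ) * (cos (θ σ) *
    ((betaQ p q ^ 2 - lambdaQ p q) * sin (θ σ)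
      - exp (x σ) * (|sin (θ σ)| ^ (q - 1) * sin (θ σ)))) /
      (betaQ p q * angWeight p (θ σ))) σ := by
  have hk : q + 1 - p ≠ 0 := by linarith
  have h1 := ((((h.radial σ).add_const ((q - 1) * log (betaQ p q))).div_const (q + 1 - p)).exp)
  refine h1.congr_deriv ?_
  unfold radNum radius
  field_simp

theorem IsPolar.hasDerivAt {p q : ℝ} (hp : 1 < p) (hq : p - 1 < q) {θ x : ℝ → ℝ}
    (h : IsPolar p q θ x) (σ : ℝ) :
    HasDerivAt (ofPolar p q θ x) (radius p q (x σ) * cos (θ σ)) σ := by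
  have hb := betaQ_pos hp hq
  have hw := angWeight_pos hp (θ σ)
  have h1 := (((h.hasDerivAt_radius hq σ).mul (h.angle σ).sin).div_const (betaQ p q))
  refine h1.congr_deriv ?_
  have h2 := angLin_add p q (θ σ)
  unfold angNum
  rw [abs_rpow_mul_self (by linarith)]
  field_simp
  linear_combination (radius p q (x σ) * cos (θ σ)) * h2

theorem IsPolar.deriv_eq {p q : ℝ} (hp : 1 < p) (hq : p - 1 < q) {θ x : ℝ → ℝ}
    (h : IsPolar p q θ x) : deriv (ofPolar p q θ x) = fun σ => radius p q (x σ) * cos (θ σ) :=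
  funext fun σ => (h.hasDerivAt hp hq σ).deriv

theorem IsPolar.weight_eq {p q : ℝ} (hp : 1 < p) (hq : p - 1 < q) {θ x : ℝ → ℝ}
    (h : IsPolar p q θ x) (σ : ℝ) :
    weight p q (ofPolar p q θ x) σ = radius p q (x σ) ^ (p - 2) := by
  have hb := betaQ_pos hp hq
  have hr := radius_pos p q (x σ)
  unfold weight
  rw [h.deriv_eq hp hq]
  have : betaQ p q ^ 2 * ofPolar p q θ x σ ^ 2 + (radius p q (x σ) * cos (θ σ)) ^ 2
      = radius p q (x σ) ^ (2 : ℝ) := by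
    unfold ofPolar; rw [rpow_two]; field_simp
    linear_combination sin_sq_add_cos_sq (θ σ)
  rw [this, ← rpow_mul hr.le]; congr 1; ring

theorem IsPolar.hasDerivAt_flux {p q : ℝ} (hp : 1 < p) (hq : p - 1 < q) {θ x : ℝ → ℝ}
    (h : IsPolar p q θ x) (σ : ℝ) :
    HasDerivAt (flux p q (ofPolar p q θ x))
      (-(lambdaQ p q * weight p q (ofPolar p q θ x) σ * ofPolar p q θ x σ
        + |ofPolar p q θ x σ| ^ (q - 1) * ofPolar p q θ x σ)) σ := by
  have hb := betaQ_pos hp hq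
  have hw := angWeight_pos hp (θ σ)
  have hr := radius_pos p q (x σ)
  have e1 : flux p q (ofPolar p q θ x) = fun σ => radius p q (x σ) ^ (p - 1) * cos (θ σ) := by
    funext σ
    have hr := radius_pos p q (x σ)
    unfold flux
    rw [h.weight_eq hp hq, h.deriv_eq hp hq, show p - 1 = (p - 2) + 1 by ring, rpow_add_one hr.ne']
    ring
  rw [e1, h.weight_eq hp hq]
  have h1 := ((h.hasDerivAt_radius hq σ).rpow_const (p := p - 1) (Or.inl hr.ne')).mul (h.angle σ).cos
  refine h1.congr_deriv ?_
  have e2 : |ofPolar p q θ x σ| ^ (q - 1) * ofPolar p q θ x σ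
      = radius p q (x σ) ^ (p - 2) * radius p q (x σ) * exp (x σ)
        * (|sin (θ σ)| ^ (q - 1) * sin (θ σ)) / betaQ p q := by
    have e3 : |ofPolar p q θ x σ| = radius p q (x σ) * |sin (θ σ)| / betaQ p q := by
      unfold ofPolar; rw [abs_div, abs_mul, abs_of_pos hr, abs_of_pos hb]
    have e4 : radius p q (x σ) ^ (q - 1)
        = radius p q (x σ) ^ (p - 2) * (betaQ p q ^ (q - 1) * exp (x σ)) := by
      rw [← radius_rpow hp hq, ← rpow_add hr]; congr 1; ring
    have : betaQ p q ^ (q - 1) ≠ 0 := (rpow_pos_of_pos hb _).ne'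
    rw [e3, div_rpow (by positivity) hb.le, mul_rpow hr.le (abs_nonneg _), e4]
    unfold ofPolar
    field_simp
  rw [e2, show p - 1 - 1 = p - 2 by ring, show p - 1 = (p - 2) + 1 by ring, rpow_add_one hr.ne']
  unfold angNum ofPolar
  rw [abs_rpow_mul_self (by linarith)]
  have h3 : angWeight p (θ σ) = sin (θ σ) ^ 2 + (p - 1) * cos (θ σ) ^ 2 := rfl
  unfold angLin
  field_simp
  rw [h3]
  ring

theorem IsPolar.isSolution {p q : ℝ} (hp : 1 < p) (hq : p - 1 < q) {θ x : ℝ → ℝ}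
    (h : IsPolar p q θ x) (hper : Function.Periodic (ofPolar p q θ x) (2 * π)) :
    IsSolution p q 0 (ofPolar p q θ x) where
  contDiff := by
    rw [contDiff_one_iff_deriv]
    refine ⟨fun σ => (h.hasDerivAt hp hq σ).differentiableAt, ?_⟩
    rw [h.deriv_eq hp hq]
    have hx : Continuous x := continuous_iff_continuousAt.2 fun σ => (h.radial σ).continuousAt
    have ht : Continuous θ := continuous_iff_continuousAt.2 fun σ => (h.angle σ).continuousAt
    unfold radius
    fun_prop
  periodic := hper
  differentiable_flux := fun σ => (h.hasDerivAt_flux hp hq σ).differentiableAt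
  equation := fun σ => by rw [(h.hasDerivAt_flux hp hq σ).deriv]; ring

/-! ### Nonzero solutions have global polar coordinates -/

/-- If `f` and `g` are continuous at `s`, `f` is differentiable, and `F (f, g)` is differentiable
where `∂₂F ≠ 0`, then `g` is differentiable. -/
theorem differentiableAt_of_comp {F : ℝ × ℝ → ℝ} {f g : ℝ → ℝ} {s c : ℝ}
    (hF : ContDiffAt ℝ 1 F (f s, g s)) (hc : HasDerivAt (fun b => F (f s, b)) c (g s)) (hc0 : c ≠ 0)
    (hf : DifferentiableAt ℝ f s) (hg : ContinuousAt g s)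
    (hV : DifferentiableAt ℝ (fun σ => F (f σ, g σ)) s) : DifferentiableAt ℝ g s := by
  have hS := hF.hasStrictFDerivAt one_ne_zero
  set F' := fderiv ℝ F (f s, g s) with hF'
  have h01 : F' (0, 1) = c := by
    have h1 : HasDerivAt (fun b : ℝ => (f s, b)) ((0 : ℝ), (1 : ℝ)) (g s) :=
      (hasDerivAt_const _ _).prodMk (hasDerivAt_id _)
    exact (hS.hasFDerivAt.comp_hasDerivAt (g s) h1).unique hc
  set A := F' (1, 0) with hA
  have hF'x : ∀ v : ℝ × ℝ, F' v = A * v.1 + c * v.2 := by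
    intro v
    have : v = v.1 • ((1 : ℝ), (0 : ℝ)) + v.2 • ((0 : ℝ), (1 : ℝ)) := by ext <;> simp
    conv_lhs => rw [this]
    rw [map_add, map_smul, map_smul, h01, ← hA]; simp; ring
  let e : (ℝ × ℝ) ≃L[ℝ] (ℝ × ℝ) := ContinuousLinearEquiv.equivOfInverse
    ((ContinuousLinearMap.fst ℝ ℝ ℝ).prod F')
    ((ContinuousLinearMap.fst ℝ ℝ ℝ).prod
      (c⁻¹ • (ContinuousLinearMap.snd ℝ ℝ ℝ - A • ContinuousLinearMap.fst ℝ ℝ ℝ)))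
    (by intro v; ext <;> simp [hF'x]; field_simp)
    (by intro v; ext <;> simp [hF'x]; field_simp; ring)
  -- As `∂₂F ≠ 0`, the map `(a, b) ↦ (a, F (a, b))` is locally invertible. Continuity of `g` keeps
  -- the curve `(f, g)` where the local inverse applies, so near `s` the curve is the inverse
  -- applied to the differentiable curve `(f, F (f, g))`.
  have hΦ : HasStrictFDerivAt (fun v : ℝ × ℝ => (v.1, F v)) (e : (ℝ × ℝ) →L[ℝ] (ℝ × ℝ))
      (f s, g s) := hasStrictFDerivAt_fst.prodMk hS
  have h2 := hΦ.eventually_left_inverse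
  have hcont : Tendsto (fun σ => (f σ, g σ)) (𝓝 s) (𝓝 (f s, g s)) :=
    hf.continuousAt.prodMk_nhds hg
  have h3 := hcont.eventually h2
  have h4 : DifferentiableAt ℝ (fun σ => (f σ, F (f σ, g σ))) s := hf.prodMk hV
  have h5 := DifferentiableAt.comp (g := hΦ.localInverse _ _ _) s
    (f := fun σ => (f σ, F (f σ, g σ))) hΦ.to_localInverse.hasFDerivAt.differentiableAt h4
  have h6 : DifferentiableAt ℝ (fun σ => (f σ, g σ)) s :=
    h5.congr_of_eventuallyEq (h3.mono fun σ hσ => hσ.symm)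
  exact h6.snd

/-- Only the flux is assumed differentiable. Its partial derivative in `ω'` is a positive power of
`β² ω² + ω'²` times `β² ω² + (p - 1) ω'²`, which is nonzero off the origin since `p > 1`, so `ω'` is
differentiable there and the equation can be solved for `ω''`. -/
theorem IsSolution.hasDerivAt_deriv {p q : ℝ} (hp : 1 < p) (hq : p - 1 < q) {ω : ℝ → ℝ}
    (h : IsSolution p q 0 ω) {s : ℝ} (hs : 0 < betaQ p q ^ 2 * ω s ^ 2 + deriv ω s ^ 2) :
    HasDerivAt (deriv ω)
      (-((lambdaQ p q * (betaQ p q ^ 2 * ω s ^ 2 + deriv ω s ^ 2)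
          + (p - 2) * betaQ p q ^ 2 * deriv ω s ^ 2) * ω s
        + (betaQ p q ^ 2 * ω s ^ 2 + deriv ω s ^ 2) ^ ((4 - p) / 2) * (|ω s| ^ (q - 1) * ω s))
        / (betaQ p q ^ 2 * ω s ^ 2 + (p - 1) * deriv ω s ^ 2)) s := by
  have hb := betaQ_pos hp hq
  set β := betaQ p q with hβ
  have hω : Differentiable ℝ ω := h.contDiff.differentiable one_ne_zero
  have hu : Continuous (deriv ω) := h.contDiff.continuous_deriv_one
  have hDpos : 0 < β ^ 2 * ω s ^ 2 + (p - 1) * deriv ω s ^ 2 := by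
    rcases eq_or_ne (deriv ω s) 0 with h0 | h0
    · rw [h0] at hs ⊢; simpa using hs
    · have : 0 < deriv ω s ^ 2 := by positivity
      have := mul_pos (sub_pos.2 hp) this
      positivity
  have hdiff : DifferentiableAt ℝ (deriv ω) s := by
    refine differentiableAt_of_comp
      (F := fun v => (β ^ 2 * v.1 ^ 2 + v.2 ^ 2) ^ ((p - 2) / 2) * v.2) (f := ω)
      (c := (β ^ 2 * ω s ^ 2 + deriv ω s ^ 2) ^ ((p - 2) / 2 - 1)
        * (β ^ 2 * ω s ^ 2 + (p - 1) * deriv ω s ^ 2)) ?_ ?_ ?_ (hω s)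
      hu.continuousAt ?_
    · refine ContDiffAt.mul (ContDiffAt.rpow_const_of_ne (by fun_prop) hs.ne') (by fun_prop)
    · have h1 : HasDerivAt (fun b => β ^ 2 * ω s ^ 2 + b ^ 2) (2 * deriv ω s) (deriv ω s) := by
        simpa using (hasDerivAt_pow 2 (deriv ω s)).const_add (β ^ 2 * ω s ^ 2)
      have h2 := (h1.rpow_const (p := (p - 2) / 2) (Or.inl hs.ne')).mul (hasDerivAt_id (deriv ω s))
      refine h2.congr_deriv ?_
      have : (β ^ 2 * ω s ^ 2 + deriv ω s ^ 2) ^ ((p - 2) / 2)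
          = (β ^ 2 * ω s ^ 2 + deriv ω s ^ 2) ^ ((p - 2) / 2 - 1)
            * (β ^ 2 * ω s ^ 2 + deriv ω s ^ 2) := by
        rw [← rpow_add_one hs.ne']; congr 1; ring
      rw [this]; simp only [id]; ring
    · exact (mul_pos (rpow_pos_of_pos hs _) hDpos).ne'
    · exact h.differentiable_flux s
  refine hdiff.hasDerivAt.congr_deriv ?_
  have h1 : HasDerivAt (fun σ => β ^ 2 * ω σ ^ 2 + deriv ω σ ^ 2)
      (β ^ 2 * (2 * ω s * deriv ω s) + 2 * deriv ω s * deriv (deriv ω) s) s := by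
    have := (((hω s).hasDerivAt.pow 2).const_mul (β ^ 2)).add (hdiff.hasDerivAt.pow 2)
    refine this.congr_deriv (by simp)
  have h2 := ((h1.rpow_const (p := (p - 2) / 2) (Or.inl hs.ne')).mul hdiff.hasDerivAt).deriv
  have h3 := h.equation s
  have h4 : deriv (flux p q ω) s = _ := h2
  rw [h4] at h3
  unfold weight at h3
  rw [← hβ] at h3
  set R := β ^ 2 * ω s ^ 2 + deriv ω s ^ 2 with hR
  have e1 : R ^ ((p - 2) / 2) = R ^ ((p - 2) / 2 - 1) * R := by
    rw [← rpow_add_one hs.ne']; congr 1; ring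
  have e2 : R ^ ((p - 2) / 2 - 1) * R ^ ((4 - p) / 2) = 1 := by
    rw [← rpow_add hs]; convert rpow_zero R using 2; ring
  have hne : R ^ ((p - 2) / 2 - 1) ≠ 0 := (rpow_pos_of_pos hs _).ne'
  rw [e1] at h3
  rw [eq_div_iff hDpos.ne']
  apply mul_left_cancel₀ hne
  linear_combination h3 + (|ω s| ^ (q - 1) * ω s) * e2
    - R ^ ((p - 2) / 2 - 1) * deriv (deriv ω) s * hR

/-- Before the first zero of `R` the function `R exp (C t)` is nondecreasing, so it cannot fall to
zero. Differentiability is required only where `R > 0`, since nothing is known about `ω''` at the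
origin of the phase plane. -/
theorem pos_right_of_abs_deriv_le {R : ℝ → ℝ} {C : ℝ} (hR : Continuous R) (h0 : ∀ s, 0 ≤ R s)
    (h : ∀ s, 0 < R s → ∃ R', HasDerivAt R R' s ∧ |R'| ≤ C * R s) {a b : ℝ} (hab : a ≤ b)
    (ha : 0 < R a) : 0 < R b := by
  by_contra hb
  have hb0 : R b = 0 := le_antisymm (not_lt.1 hb) (h0 b)
  have hc : IsCompact (Icc a b ∩ R ⁻¹' {0}) :=
    isCompact_Icc.inter_right (isClosed_singleton.preimage hR)
  obtain ⟨S, ⟨hS, hS0⟩, hmin⟩ := hc.exists_isLeast ⟨b, ⟨hab, le_rfl⟩, hb0⟩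
  have hpos : ∀ t ∈ Ico a S, 0 < R t := by
    intro t ht
    refine lt_of_le_of_ne (h0 t) fun h1 => ?_
    exact absurd (hmin ⟨⟨ht.1, ht.2.le.trans hS.2⟩, h1.symm⟩) (not_le.2 ht.2)
  have hmono : MonotoneOn (fun t => R t * exp (C * t)) (Icc a S) := by
    refine monotoneOn_of_hasDerivWithinAt_nonneg (convex_Icc a S) (by fun_prop)
      (f' := fun t => deriv R t * exp (C * t) + R t * (exp (C * t) * C)) ?_ ?_
    · intro t ht
      rw [interior_Icc] at ht
      obtain ⟨R', hR', -⟩ := h t (hpos t ⟨ht.1.le, ht.2⟩)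
      have h1 := hR'.mul (((hasDerivAt_id t).const_mul C).exp)
      refine (h1.congr_deriv ?_).hasDerivWithinAt
      rw [hR'.deriv]; simp
    · intro t ht
      rw [interior_Icc] at ht
      obtain ⟨R', hR', hle⟩ := h t (hpos t ⟨ht.1.le, ht.2⟩)
      rw [hR'.deriv]
      have := neg_le_of_abs_le hle
      have h2 := exp_pos (C * t)
      nlinarith
  have h1 := hmono ⟨le_rfl, hS.1⟩ ⟨hS.1, le_rfl⟩ hS.1
  simp only [mem_preimage, mem_singleton_iff] at hS0
  simp only [hS0, zero_mul] at h1
  exact absurd (mul_pos ha (exp_pos (C * a))) (not_lt.2 h1)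

theorem pos_of_abs_deriv_le {R : ℝ → ℝ} {C : ℝ} (hR : Continuous R) (h0 : ∀ s, 0 ≤ R s)
    (h : ∀ s, 0 < R s → ∃ R', HasDerivAt R R' s ∧ |R'| ≤ C * R s) {a : ℝ}
    (ha : 0 < R a) (b : ℝ) : 0 < R b := by
  rcases le_total a b with hab | hab
  · exact pos_right_of_abs_deriv_le hR h0 h hab ha
  · have := pos_right_of_abs_deriv_le (R := fun s => R (-s)) (C := C) (a := -a) (b := -b)
      (by fun_prop) (fun s => h0 _) ?_ (by linarith) (by simpa using ha)
    · simpa using this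
    · intro s hs
      obtain ⟨R', h1, h2⟩ := h (-s) hs
      refine ⟨-R', ?_, by simpa using h2⟩
      exact (h1.comp s (hasDerivAt_neg s)).congr_deriv (by simp)

/-- A nonvanishing differentiable curve in the plane has a differentiable angle. -/
theorem exists_angle {A B A' B' : ℝ → ℝ} (hA : ∀ s, HasDerivAt A (A' s) s)
    (hB : ∀ s, HasDerivAt B (B' s) s) (hA' : Continuous A') (hB' : Continuous B')
    (hpos : ∀ s, 0 < A s ^ 2 + B s ^ 2) {σ₀ θ₀ : ℝ}
    (hA0 : A σ₀ = √(A σ₀ ^ 2 + B σ₀ ^ 2) * cos θ₀) (hB0 : B σ₀ = √(A σ₀ ^ 2 + B σ₀ ^ 2) * sin θ₀) :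
    ∃ θ : ℝ → ℝ, θ σ₀ = θ₀ ∧
      (∀ s, HasDerivAt θ ((A s * B' s - B s * A' s) / (A s ^ 2 + B s ^ 2)) s) ∧
      ∀ s, A s = √(A s ^ 2 + B s ^ 2) * cos (θ s) ∧ B s = √(A s ^ 2 + B s ^ 2) * sin (θ s) := by
  have hAc : Continuous A := continuous_iff_continuousAt.2 fun s => (hA s).continuousAt
  have hBc : Continuous B := continuous_iff_continuousAt.2 fun s => (hB s).continuousAt
  set g : ℝ → ℝ := fun s => (A s * B' s - B s * A' s) / (A s ^ 2 + B s ^ 2) with hg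
  have hgc : Continuous g := by
    refine Continuous.div (by fun_prop) (by fun_prop) fun s => (hpos s).ne'
  set θ : ℝ → ℝ := fun s => θ₀ + ∫ t in σ₀..s, g t with hθ
  have hθ' : ∀ s, HasDerivAt θ (g s) s := fun s =>
    (intervalIntegral.integral_hasDerivAt_right (hgc.intervalIntegrable _ _)
      (hgc.stronglyMeasurableAtFilter _ _) hgc.continuousAt).const_add θ₀
  have hθ0 : θ σ₀ = θ₀ := by simp [hθ]
  set r : ℝ → ℝ := fun s => √(A s ^ 2 + B s ^ 2) with hr
  have hrpos : ∀ s, 0 < r s := fun s => sqrt_pos.2 (hpos s)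
  have hr2 : ∀ s, r s ^ 2 = A s ^ 2 + B s ^ 2 := fun s => sq_sqrt (hpos s).le
  have hr' : ∀ s, HasDerivAt r ((A s * A' s + B s * B' s) / r s) s := by
    intro s
    have h1 := (((hA s).pow 2).add ((hB s).pow 2)).sqrt (hpos s).ne'
    refine h1.congr_deriv ?_
    change _ / (2 * r s) = _
    have := (hrpos s).ne'
    field_simp
    simp
    ring
  -- This quotient and the next are the cosine and sine of the difference between the polar angle of
  -- `(A, B)` and `θ`. Both are constant, and initially they are `1` and `0`.
  have hf1 : ∀ s, HasDerivAt (fun s => (A s * cos (θ s) + B s * sin (θ s)) / r s) 0 s := by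
    intro s
    have h1 := (((hA s).mul (hθ' s).cos).add ((hB s).mul (hθ' s).sin)).div (hr' s) (hrpos s).ne'
    refine h1.congr_deriv ?_
    have := (hrpos s).ne'
    have h2 := (hpos s).ne'
    have h3 := hr2 s
    simp only [hg, Pi.add_apply, Pi.mul_apply]
    rw [← h3]
    field_simp
    linear_combination (A' s * cos (θ s) + B' s * sin (θ s)) * h3
  have hf2 : ∀ s, HasDerivAt (fun s => (B s * cos (θ s) - A s * sin (θ s)) / r s) 0 s := by
    intro s
    have h1 := (((hB s).mul (hθ' s).cos).sub ((hA s).mul (hθ' s).sin)).div (hr' s) (hrpos s).ne'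
    refine h1.congr_deriv ?_
    have := (hrpos s).ne'
    have h2 := (hpos s).ne'
    have h3 := hr2 s
    simp only [hg, Pi.sub_apply, Pi.mul_apply]
    rw [← h3]
    field_simp
    linear_combination (B' s * cos (θ s) - A' s * sin (θ s)) * h3
  refine ⟨θ, hθ0, hθ', fun s => ?_⟩
  have e1 := is_const_of_deriv_eq_zero (fun s => (hf1 s).differentiableAt)
    (fun s => (hf1 s).deriv) s σ₀
  have e2 := is_const_of_deriv_eq_zero (fun s => (hf2 s).differentiableAt)
    (fun s => (hf2 s).deriv) s σ₀
  change A σ₀ = r σ₀ * cos θ₀ at hA0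
  change B σ₀ = r σ₀ * sin θ₀ at hB0
  simp only [hθ0] at e1 e2
  rw [hA0, hB0] at e1 e2
  have r0 := (hrpos σ₀).ne'
  have r1 := (hrpos s).ne'
  have t0 := sin_sq_add_cos_sq θ₀
  have t1 := sin_sq_add_cos_sq (θ s)
  rw [div_eq_iff r1] at e1 e2
  have e1' : A s * cos (θ s) + B s * sin (θ s) = r s := by
    rw [e1]; field_simp; linear_combination t0
  have e2' : B s * cos (θ s) - A s * sin (θ s) = 0 := by
    rw [e2]; field_simp; ring
  change A s = r s * cos (θ s) ∧ B s = r s * sin (θ s)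
  constructor
  · linear_combination cos (θ s) * e1' - sin (θ s) * e2' - A s * t1
  · linear_combination sin (θ s) * e1' + cos (θ s) * e2' - B s * t1

/-- With `R = β² ω² + ω'²`, the reaction term contributes at most a multiple of `R ^ ((q + 1 - p) /
2) * R` to `R'`. The exponent is positive and `R` is bounded by periodicity, so `|R'| ≤ C R`. This
replaces uniqueness at the origin, where the equation may be degenerate or singular. -/
theorem IsSolution.radius_sq_pos {p q : ℝ} (hp : 1 < p) (hq : p - 1 < q) {ω : ℝ → ℝ}
    (h : IsSolution p q 0 ω) {a : ℝ} (ha : ω a ≠ 0) (b : ℝ) :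
    0 < betaQ p q ^ 2 * ω b ^ 2 + deriv ω b ^ 2 := by
  have hb := betaQ_pos hp hq
  set β := betaQ p q with hβ
  have hω : Differentiable ℝ ω := h.contDiff.differentiable one_ne_zero
  have hu : Continuous (deriv ω) := h.contDiff.continuous_deriv_one
  set R : ℝ → ℝ := fun s => β ^ 2 * ω s ^ 2 + deriv ω s ^ 2 with hR
  have hRc : Continuous R := by have := hω.continuous; fun_prop
  have hper : Function.Periodic R (2 * π) := by
    intro s
    have h1 : deriv ω (s + 2 * π) = deriv ω s := by
      rw [← deriv_comp_add_const]
      congr 1; funext t; exact h.periodic t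
    simp only [hR, h1, h.periodic s]
  obtain ⟨M, hM⟩ : ∃ M, ∀ s, R s ≤ M := by
    have := (hper.isBounded_of_continuous (by positivity) hRc).bddAbove
    obtain ⟨M, hM⟩ := this
    exact ⟨M, fun s => hM ⟨s, rfl⟩⟩
  have hM0 : 0 ≤ M := le_trans (by positivity) (hM a)
  set m := min 1 (p - 1) with hm
  have hmpos : 0 < m := lt_min one_pos (by linarith)
  -- The three summands of `C` bound, in turn, the term `2 β² ω ω'` and the linear and reaction
  -- parts of `2 ω' ω''`. The factor `m` comes from `β² ω² + (p - 1) ω'² ≥ m R`.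
  refine pos_of_abs_deriv_le (R := R)
    (C := β + (|lambdaQ p q| + |p - 2| * β ^ 2) / (m * β)
      + 2 * M ^ ((q + 1 - p) / 2) / (m * β ^ q)) hRc
    (fun s => by positivity) ?_ (a := a) (by positivity) b
  intro s hs
  have h1 := h.hasDerivAt_deriv hp hq hs
  have h2 : HasDerivAt R _ s := (((hω s).hasDerivAt.pow 2).const_mul (β ^ 2)).add (h1.pow 2)
  refine ⟨_, h2, ?_⟩
  have hRs : R s = β ^ 2 * ω s ^ 2 + deriv ω s ^ 2 := rfl
  rw [← hβ, ← hRs]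
  set w := ω s
  set u := deriv ω s
  have hD : m * R s ≤ β ^ 2 * w ^ 2 + (p - 1) * u ^ 2 := by
    have h3 : m ≤ 1 := min_le_left _ _
    have h4 : m ≤ p - 1 := min_le_right _ _
    rw [hRs, mul_add]
    refine add_le_add ?_ (mul_le_mul_of_nonneg_right h4 (sq_nonneg _))
    nlinarith [mul_nonneg (sq_nonneg β) (sq_nonneg w)]
  set D := β ^ 2 * w ^ 2 + (p - 1) * u ^ 2
  have hmR : 0 < m * R s := mul_pos hmpos hs
  have hDpos : 0 < D := hmR.trans_le hD
  have huw : 2 * β * |w * u| ≤ R s := by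
    rw [hRs, abs_mul]
    have := sq_nonneg (β * |w| - |u|)
    rw [← sq_abs w, ← sq_abs u]; nlinarith
  have hu2 : u ^ 2 ≤ R s := by rw [hRs]; nlinarith [mul_nonneg (sq_nonneg β) (sq_nonneg w)]
  have hw2 : (β * |w|) ^ 2 ≤ R s := by rw [hRs, mul_pow, sq_abs]; nlinarith [sq_nonneg u]
  have hn : |lambdaQ p q * R s + (p - 2) * β ^ 2 * u ^ 2|
      ≤ (|lambdaQ p q| + |p - 2| * β ^ 2) * R s := by
    refine (abs_add_le _ _).trans ?_
    rw [abs_mul, abs_mul, abs_mul, abs_of_pos hs, abs_of_nonneg (sq_nonneg β),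
      abs_of_nonneg (sq_nonneg u)]
    have := mul_le_mul_of_nonneg_left hu2 (mul_nonneg (abs_nonneg (p - 2)) (sq_nonneg β))
    nlinarith
  have hpow : |u| * R s ^ ((4 - p) / 2) * |(|w| ^ (q - 1) * w)|
      ≤ R s * (M ^ ((q + 1 - p) / 2) / β ^ q) * R s := by
    have e0 : |(|w| ^ (q - 1) * w)| = |w| ^ q := by
      rcases eq_or_ne w 0 with h0 | h0
      · rw [h0]; simp; exact (zero_rpow (by linarith)).symm
      · rw [abs_mul, abs_of_nonneg (rpow_nonneg (abs_nonneg _) _),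
          ← rpow_add_one (abs_pos.2 h0).ne']
        congr 1; ring
    have e1 : |u| ≤ R s ^ (1 / 2 : ℝ) := by
      rw [← sqrt_eq_rpow]; exact abs_le_sqrt hu2
    have e2 : |w| ^ q ≤ R s ^ (q / 2) / β ^ q := by
      rw [le_div_iff₀ (rpow_pos_of_pos hb _), ← mul_rpow (abs_nonneg _) hb.le, mul_comm |w|]
      have : R s ^ (q / 2) = (√(R s)) ^ q := by
        rw [sqrt_eq_rpow, ← rpow_mul hs.le]; congr 1; ring
      rw [this]
      exact rpow_le_rpow (by positivity) (le_sqrt_of_sq_le hw2) (by linarith)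
    have e3 : R s ^ ((q + 1 - p) / 2) ≤ M ^ ((q + 1 - p) / 2) :=
      rpow_le_rpow hs.le (hM s) (by linarith)
    rw [e0]
    have hR1 := rpow_nonneg hs.le ((4 - p) / 2)
    calc |u| * R s ^ ((4 - p) / 2) * |w| ^ q
        ≤ R s ^ (1 / 2 : ℝ) * R s ^ ((4 - p) / 2) * (R s ^ (q / 2) / β ^ q) := by gcongr
      _ = R s * (R s ^ ((q + 1 - p) / 2) / β ^ q) * R s := by
        have : R s ^ (1 / 2 : ℝ) * R s ^ ((4 - p) / 2) * R s ^ (q / 2)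
            = R s * R s ^ ((q + 1 - p) / 2) * R s := by
          rw [← rpow_add hs, ← rpow_add hs, mul_right_comm, ← pow_two, ← rpow_two, ← rpow_add hs]
          congr 1; ring
        rw [← mul_div_assoc, this]; ring
      _ ≤ _ := by
        have := rpow_pos_of_pos hb q
        gcongr
  set n := lambdaQ p q * R s + (p - 2) * β ^ 2 * u ^ 2
  set G := |w| ^ (q - 1) * w
  set c := |lambdaQ p q| + |p - 2| * β ^ 2
  have key : β ^ 2 * (((2 : ℕ) : ℝ) * w ^ (2 - 1) * u)
      + ((2 : ℕ) : ℝ) * u ^ (2 - 1) * (-(n * w + R s ^ ((4 - p) / 2) * G) / D)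
      = 2 * β ^ 2 * (w * u) - 2 * n * (w * u) / D
        - 2 * (u * R s ^ ((4 - p) / 2) * G) / D := by
    field_simp; push_cast; ring
  rw [key]
  have b1 : |2 * β ^ 2 * (w * u)| ≤ β * R s := by
    rw [abs_mul, abs_of_pos (by positivity)]
    nlinarith
  have b2 : |2 * n * (w * u) / D| ≤ c / (m * β) * R s := by
    have h5 : |2 * n * (w * u)| ≤ (c * R s) * (R s / β) := by
      have : |w * u| ≤ R s / β / 2 := by
        rw [div_div, le_div_iff₀ (by positivity)]; linarith
      rw [abs_mul, abs_mul, abs_two]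
      calc 2 * |n| * |w * u| ≤ 2 * (c * R s) * (R s / β / 2) := by gcongr
        _ = _ := by ring
    rw [abs_div, abs_of_pos hDpos]
    have h6 : 0 ≤ (c * R s) * (R s / β) := (abs_nonneg _).trans h5
    calc |2 * n * (w * u)| / D ≤ (c * R s) * (R s / β) / (m * R s) := by gcongr
      _ = _ := by field_simp
  have b3 : |2 * (u * R s ^ ((4 - p) / 2) * G) / D|
      ≤ 2 * M ^ ((q + 1 - p) / 2) / (m * β ^ q) * R s := by
    have hbq := rpow_pos_of_pos hb q
    rw [abs_div, abs_of_pos hDpos, abs_mul, abs_mul, abs_mul, abs_two,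
      abs_of_nonneg (rpow_nonneg hs.le ((4 - p) / 2))]
    have h6 : 0 ≤ R s * (M ^ ((q + 1 - p) / 2) / β ^ q) * R s := by positivity
    calc 2 * (|u| * R s ^ ((4 - p) / 2) * |G|) / D
        ≤ 2 * (R s * (M ^ ((q + 1 - p) / 2) / β ^ q) * R s) / (m * R s) := by gcongr
      _ = _ := by field_simp
  calc _ ≤ |2 * β ^ 2 * (w * u)| + |2 * n * (w * u) / D|
        + |2 * (u * R s ^ ((4 - p) / 2) * G) / D| :=
        (abs_sub _ _).trans (add_le_add_left (abs_sub _ _) _)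
    _ ≤ β * R s + c / (m * β) * R s + 2 * M ^ ((q + 1 - p) / 2) / (m * β ^ q) * R s := by gcongr
    _ = _ := by ring

theorem continuous_abs_rpow_mul {q : ℝ} (hq : 0 < q) : Continuous fun t : ℝ => |t| ^ (q - 1) * t := by
  rw [continuous_iff_continuousAt]
  intro t
  rcases eq_or_ne t 0 with rfl | ht
  · have h1 : Tendsto (fun t : ℝ => |t| ^ q) (𝓝 0) (𝓝 0) := by
      have : Continuous fun t : ℝ => |t| ^ q :=
        continuous_abs.rpow_const fun _ => Or.inr hq.le
      have h2 := this.tendsto 0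
      rwa [abs_zero, zero_rpow hq.ne'] at h2
    rw [ContinuousAt, mul_zero]
    refine squeeze_zero_norm (fun t => ?_) h1
    rw [norm_mul, norm_eq_abs, norm_eq_abs, abs_of_nonneg (rpow_nonneg (abs_nonneg _) _)]
    rcases eq_or_ne t 0 with rfl | ht
    · simpa using zero_rpow_nonneg q
    · rw [← rpow_add_one (abs_pos.2 ht).ne', sub_add_cancel]
  · exact ((continuous_abs.continuousAt).rpow_const (Or.inl (abs_pos.2 ht).ne')).mul
      continuousAt_id

theorem IsSolution.exists_polar {p q : ℝ} (hp : 1 < p) (hq : p - 1 < q) {ω : ℝ → ℝ}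
    (h : IsSolution p q 0 ω) {a σ₀ : ℝ} (ha : ω a ≠ 0) (h0 : ω σ₀ = 0) :
    ∃ θ x : ℝ → ℝ, IsPolar p q θ x ∧ ω = ofPolar p q θ x ∧ (θ σ₀ = 0 ∨ θ σ₀ = π) := by
  have hb := betaQ_pos hp hq
  have hR : ∀ s, 0 < betaQ p q ^ 2 * ω s ^ 2 + deriv ω s ^ 2 := h.radius_sq_pos hp hq ha
  have hω : Differentiable ℝ ω := h.contDiff.differentiable one_ne_zero
  have hωc := hω.continuous
  have hu : Continuous (deriv ω) := h.contDiff.continuous_deriv_one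
  have hu' := fun s => h.hasDerivAt_deriv hp hq (hR s)
  set u' : ℝ → ℝ := fun s => (-((lambdaQ p q * (betaQ p q ^ 2 * ω s ^ 2 + deriv ω s ^ 2)
          + (p - 2) * betaQ p q ^ 2 * deriv ω s ^ 2) * ω s
        + (betaQ p q ^ 2 * ω s ^ 2 + deriv ω s ^ 2) ^ ((4 - p) / 2) * (|ω s| ^ (q - 1) * ω s))
        / (betaQ p q ^ 2 * ω s ^ 2 + (p - 1) * deriv ω s ^ 2)) with hu'def
  have hu'c : Continuous u' := by
    have hg : Continuous fun s => |ω s| ^ (q - 1) * ω s :=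
      (continuous_abs_rpow_mul (by linarith)).comp hωc
    have hRe : Continuous fun s => (betaQ p q ^ 2 * ω s ^ 2 + deriv ω s ^ 2) ^ ((4 - p) / 2) :=
      Continuous.rpow_const (by fun_prop) fun s => Or.inl (hR s).ne'
    refine Continuous.div ?_ (by fun_prop) fun s => ?_
    · exact (((by fun_prop : Continuous fun s =>
        (lambdaQ p q * (betaQ p q ^ 2 * ω s ^ 2 + deriv ω s ^ 2)
          + (p - 2) * betaQ p q ^ 2 * deriv ω s ^ 2) * ω s)).add (hRe.mul hg)).neg
    · have := hR s
      rcases eq_or_ne (deriv ω s) 0 with h0 | h0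
      · rw [h0] at this ⊢; intro h3; apply this.ne'; linear_combination h3
      · have : 0 < (p - 1) * deriv ω s ^ 2 := mul_pos (by linarith) (by positivity)
        positivity
  have hAB : ∀ s, deriv ω s ^ 2 + (betaQ p q * ω s) ^ 2
      = betaQ p q ^ 2 * ω s ^ 2 + deriv ω s ^ 2 := fun s => by ring
  -- At a zero of `ω` the phase point lies on the axis `sin θ = 0`, so the initial angle is read off
  -- from the sign of `ω'`.
  obtain ⟨θ₀, hθ₀, hA0, hB0⟩ : ∃ θ₀ : ℝ, (θ₀ = 0 ∨ θ₀ = π) ∧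
      deriv ω σ₀ = √(deriv ω σ₀ ^ 2 + (betaQ p q * ω σ₀) ^ 2) * cos θ₀ ∧
      betaQ p q * ω σ₀ = √(deriv ω σ₀ ^ 2 + (betaQ p q * ω σ₀) ^ 2) * sin θ₀ := by
    rcases le_total 0 (deriv ω σ₀) with hs | hs
    · exact ⟨0, Or.inl rfl, by simp [h0, sqrt_sq hs], by simp [h0]⟩
    · refine ⟨π, Or.inr rfl, ?_, by simp [h0]⟩
      rw [h0, ← neg_sq]; simp [sqrt_sq (neg_nonneg.2 hs), -even_two, -Even.neg_pow]
  obtain ⟨θ, hθσ, hθ', hθ⟩ := exists_angle (A := deriv ω) (B := fun s => betaQ p q * ω s)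
    (A' := u') (B' := fun s => betaQ p q * deriv ω s) hu'
    (fun s => (hω s).hasDerivAt.const_mul _) hu'c (by fun_prop)
    (fun s => by rw [hAB]; exact hR s) (σ₀ := σ₀) hA0 hB0
  simp only [hAB] at hθ hθ'
  set r : ℝ → ℝ := fun s => √(betaQ p q ^ 2 * ω s ^ 2 + deriv ω s ^ 2) with hr
  have hθ1 : ∀ s, deriv ω s = r s * cos (θ s) := fun s => (hθ s).1
  have hrpos : ∀ s, 0 < r s := fun s => sqrt_pos.2 (hR s)
  have hr2 : ∀ s, betaQ p q ^ 2 * ω s ^ 2 + deriv ω s ^ 2 = r s ^ 2 :=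
    fun s => (sq_sqrt (hR s).le).symm
  have hk : q + 1 - p ≠ 0 := by linarith
  set x : ℝ → ℝ := fun s => (q + 1 - p) / 2 * log (betaQ p q ^ 2 * ω s ^ 2 + deriv ω s ^ 2)
    - (q - 1) * log (betaQ p q) with hx
  have hrad : ∀ s, radius p q (x s) = r s := by
    intro s
    have : log (betaQ p q ^ 2 * ω s ^ 2 + deriv ω s ^ 2) = 2 * log (r s) := by
      rw [hr2, log_pow]; simp
    simp only [hx, radius, this]
    rw [show ((q + 1 - p) / 2 * (2 * log (r s)) - (q - 1) * log (betaQ p q)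
      + (q - 1) * log (betaQ p q)) / (q + 1 - p) = log (r s) by field_simp; ring]
    exact exp_log (hrpos s)
  have hrκ : ∀ s, r s ^ (q + 1 - p) = betaQ p q ^ (q - 1) * exp (x s) := fun s => by
    rw [← hrad, radius_rpow hp hq]
  have hW := fun s => angWeight_pos hp (θ s)
  have huu : ∀ s, u' s = -(r s / (betaQ p q * angWeight p (θ s))) *
      ((lambdaQ p q + (p - 2) * betaQ p q ^ 2 * cos (θ s) ^ 2) * sin (θ s)
        + exp (x s) * (|sin (θ s)| ^ (q - 1) * sin (θ s))) := by
    intro s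
    have hws : ω s = r s * sin (θ s) / betaQ p q := by rw [eq_div_iff hb.ne', mul_comm, (hθ s).2]
    have e1 : (r s ^ 2) ^ ((4 - p) / 2) * (|ω s| ^ (q - 1) * ω s)
        = r s ^ 3 * exp (x s) * (|sin (θ s)| ^ (q - 1) * sin (θ s)) / betaQ p q := by
      have e2 : (r s ^ 2) ^ ((4 - p) / 2) * r s ^ (q - 1)
          = r s ^ 2 * (betaQ p q ^ (q - 1) * exp (x s)) := by
        rw [← hrκ, ← rpow_two, ← rpow_mul (hrpos s).le, ← rpow_add (hrpos s),
          ← rpow_add (hrpos s)]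
        congr 1; ring
      have e3 : betaQ p q ^ (q - 1) ≠ 0 := (rpow_pos_of_pos hb _).ne'
      rw [hws, abs_div, abs_mul, abs_of_pos (hrpos s), abs_of_pos hb,
        div_rpow (by have := hrpos s; positivity) hb.le, mul_rpow (hrpos s).le (abs_nonneg _)]
      field_simp
      linear_combination r s * |sin (θ s)| ^ (q - 1) * sin (θ s) * e2
    have e4 : betaQ p q ^ 2 * ω s ^ 2 + (p - 1) * deriv ω s ^ 2
        = r s ^ 2 * angWeight p (θ s) := by
      rw [(hθ1 s), hws]; unfold angWeight; field_simp
    simp only [hu'def]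
    rw [e4, hr2, e1, (hθ1 s), hws]
    have := hrpos s
    have := hW s
    field_simp
  refine ⟨θ, x, ⟨fun s => ?_, fun s => ?_⟩, ?_, ?_⟩
  · refine (hθ' s).congr_deriv ?_
    have hws : ω s = r s * sin (θ s) / betaQ p q := by rw [eq_div_iff hb.ne', mul_comm, (hθ s).2]
    rw [hr2, huu s, hws, (hθ1 s)]
    have := hrpos s
    have hWs := hW s
    have hWd : angWeight p (θ s) = sin (θ s) ^ 2 + (p - 1) * cos (θ s) ^ 2 := rfl
    unfold angNum angLin
    rw [abs_rpow_mul_self (by linarith)]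
    field_simp
    rw [hWd]
    linear_combination ((p - 1) * betaQ p q ^ 2 * cos (θ s) ^ 2) * sin_sq_add_cos_sq (θ s)
  · have h1 := ((((hω s).hasDerivAt.pow 2).const_mul (betaQ p q ^ 2)).add ((hu' s).pow 2)).log
      (hR s).ne'
    refine ((h1.const_mul ((q + 1 - p) / 2)).sub_const ((q - 1) * log (betaQ p q))).congr_deriv ?_
    have hws : ω s = r s * sin (θ s) / betaQ p q := by rw [eq_div_iff hb.ne', mul_comm, (hθ s).2]
    change (q + 1 - p) / 2 * (_ / (betaQ p q ^ 2 * ω s ^ 2 + deriv ω s ^ 2)) = _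
    change (q + 1 - p) / 2 * ((betaQ p q ^ 2 * (((2 : ℕ) : ℝ) * ω s ^ (2 - 1) * deriv ω s)
      + ((2 : ℕ) : ℝ) * deriv ω s ^ (2 - 1) * u' s) / _) = _
    rw [hr2, huu s, hws, (hθ1 s)]
    have := hrpos s
    have hWs := hW s
    have hWd : angWeight p (θ s) = sin (θ s) ^ 2 + (p - 1) * cos (θ s) ^ 2 := rfl
    unfold radNum
    field_simp
    rw [hWd]
    push_cast
    field_simp
    linear_combination (cos (θ s) * betaQ p q ^ 2 * sin (θ s)) * sin_sq_add_cos_sq (θ s)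
  · funext s
    unfold ofPolar
    rw [hrad, ← (hθ s).2]
    field_simp
  · rw [hθσ]; exact hθ₀

/-! ### Existence of profiles: a truncated equation -/

theorem exists_solution_of_bounded_lipschitz {f : ℝ → ℝ → ℝ} {T L K : ℝ} (hT : 0 ≤ T)
    (hL0 : 0 ≤ L) (hK0 : 0 ≤ K)
    (hK : ∀ t ∈ Icc 0 T, ∀ x y, |f t x - f t y| ≤ K * |x - y|)
    (hc : ∀ x, ContinuousOn (fun t => f t x) (Icc 0 T)) (hL : ∀ t ∈ Icc 0 T, ∀ x, |f t x| ≤ L)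
    (x₀ : ℝ) :
    ∃ X : ℝ → ℝ, X 0 = x₀ ∧ ∀ t ∈ Icc 0 T, HasDerivWithinAt X (f t (X t)) (Icc 0 T) t := by
  lift L to ℝ≥0 using hL0
  lift K to ℝ≥0 using hK0
  -- With speed at most `L`, the ball of radius `L T` is not left before time `T`; hence one
  -- application covers the whole interval.
  have hpl : IsPicardLindelof f (tmin := 0) (tmax := T) ⟨0, left_mem_Icc.2 hT⟩ x₀ (L * ⟨T, hT⟩) 0 L K :=
    { lipschitzOnWith := fun t ht => LipschitzOnWith.of_dist_le_mul fun x _ y _ => by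
        simpa [Real.dist_eq] using hK t ht x y
      continuousOn := fun x _ => hc x
      norm_le := fun t ht x _ => by simpa using hL t ht x
      mul_max_le := by
        change (L : ℝ) * max (T - 0) (0 - 0) ≤ (L : ℝ) * T - 0
        simp [hT] }
  exact hpl.exists_eq_forall_mem_Icc_hasDerivWithinAt₀

theorem sub_le_of_deriv_le {X X' : ℝ → ℝ} {T B s t : ℝ} 
    (hX : ∀ t ∈ Icc 0 T, HasDerivWithinAt X (X' t) (Icc 0 T) t) (hs : 0 ≤ s) (hst : s ≤ t)
    (ht : t ≤ T) (hB : ∀ r ∈ Icc s t, X' r ≤ B) : X t - X s ≤ B * (t - s) := by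
  have hsub : Icc s t ⊆ Icc 0 T := Icc_subset_Icc hs ht
  have hd : ∀ r ∈ Ioo s t, HasDerivAt X (X' r) r := fun r hr =>
    (hX r ⟨by linarith [hr.1], by linarith [hr.2]⟩).hasDerivAt
      (Icc_mem_nhds (by linarith [hr.1]) (by linarith [hr.2]))
  refine (convex_Icc s t).image_sub_le_mul_sub_of_deriv_le
    (fun r hr => ((hX r (hsub hr)).continuousWithinAt.mono hsub)) ?_ ?_ s ⟨le_rfl, hst⟩ t
    ⟨hst, le_rfl⟩ hst
  · rw [interior_Icc]; exact fun r hr => (hd r hr).differentiableAt.differentiableWithinAt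
  · rw [interior_Icc]; intro r hr
    rw [(hd r hr).deriv]; exact hB r ⟨hr.1.le, hr.2.le⟩

theorem le_sub_of_le_deriv {X X' : ℝ → ℝ} {T B s t : ℝ} 
    (hX : ∀ t ∈ Icc 0 T, HasDerivWithinAt X (X' t) (Icc 0 T) t) (hs : 0 ≤ s) (hst : s ≤ t)
    (ht : t ≤ T) (hB : ∀ r ∈ Icc s t, B ≤ X' r) : B * (t - s) ≤ X t - X s := by
  have := sub_le_of_deriv_le (X := fun t => -X t) (X' := fun t => -X' t) (B := -B)
    (fun t ht => (hX t ht).neg) hs hst ht (fun r hr => neg_le_neg (hB r hr))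
  linarith

theorem continuous_angLin (p q : ℝ) : Continuous (angLin p q) := by
  unfold angLin; fun_prop

theorem abs_abs_rpow_mul_le {q t : ℝ} (hq : 0 < q) (ht : |t| ≤ 1) : |(|t| ^ (q - 1) * t)| ≤ 1 := by
  rcases eq_or_ne t 0 with rfl | h0
  · simp
  · rw [abs_mul, abs_of_nonneg (rpow_nonneg (abs_nonneg _) _), ← rpow_add_one (abs_pos.2 h0).ne',
      sub_add_cancel]
    exact rpow_le_one (abs_nonneg _) ht hq.le

/-- For `λ > 0` the form `angLin` is positive definite. For `λ ≤ 0` it is only positive near angle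
`0`, but then `β² - λ ≥ 0`, a sign that controls the radial slope on the rest of the quarter turn.
-/
theorem exists_angLin_lower {p q : ℝ} (hp : 1 < p) (hq : p - 1 < q) :
    ∃ θ₁ n : ℝ, 0 < θ₁ ∧ θ₁ ≤ π / 2 ∧ 0 < n ∧ (∀ θ ∈ Icc 0 θ₁, n ≤ angLin p q θ) ∧
      (θ₁ = π / 2 ∨ 0 ≤ betaQ p q ^ 2 - lambdaQ p q) := by
  have hb := betaQ_pos hp hq
  have hb2 : 0 < (p - 1) * betaQ p q ^ 2 := mul_pos (by linarith) (by positivity)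
  rcases lt_or_ge 0 (lambdaQ p q) with hl | hl
  · refine ⟨π / 2, min ((p - 1) * betaQ p q ^ 2) (lambdaQ p q), by positivity, le_rfl,
      lt_min hb2 hl, fun θ _ => ?_, Or.inl rfl⟩
    have h1 := mul_le_mul_of_nonneg_right (min_le_left ((p - 1) * betaQ p q ^ 2) (lambdaQ p q))
      (sq_nonneg (cos θ))
    have h2 := mul_le_mul_of_nonneg_right (min_le_right ((p - 1) * betaQ p q ^ 2) (lambdaQ p q))
      (sq_nonneg (sin θ))
    have h3 := sin_sq_add_cos_sq θ
    set n := min ((p - 1) * betaQ p q ^ 2) (lambdaQ p q)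
    have h4 : n = n * cos θ ^ 2 + n * sin θ ^ 2 := by rw [← mul_add, add_comm, h3, mul_one]
    unfold angLin
    linarith
  · have h0 : angLin p q 0 = (p - 1) * betaQ p q ^ 2 := by simp [angLin]
    have h1 : ∀ᶠ θ in 𝓝 (0 : ℝ), angLin p q 0 / 2 < angLin p q θ :=
      (continuous_angLin p q).continuousAt.eventually (lt_mem_nhds (by rw [h0]; linarith))
    obtain ⟨ε, hε, h2⟩ := Metric.eventually_nhds_iff.1 h1
    refine ⟨min (ε / 2) (π / 2), angLin p q 0 / 2, by positivity, min_le_right _ _,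
      by rw [h0]; positivity, fun θ hθ => (h2 ?_).le, Or.inr (by nlinarith [sq_nonneg (betaQ p q)])⟩
    rw [Real.dist_eq, sub_zero, abs_of_nonneg hθ.1]
    linarith [hθ.2, min_le_left (ε / 2) (π / 2)]

theorem betaQ_sq_sub_lambdaQ {p q : ℝ} (hq : p - 1 < q) :
    lambdaQ p q - (p - 1) * betaQ p q ^ 2 = (p - 2) * betaQ p q := by
  have h := mul_betaQ hq
  unfold lambdaQ
  linear_combination betaQ p q * h

/-- The angular speed, truncated away from zero. -/
noncomputable def angTrunc (p q θ x : ℝ) : ℝ :=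
  max (angNum p q θ x) (1 / 3 * (exp x * |sin θ| ^ (q + 1)))

theorem angLin_le_angTrunc (p q θ x : ℝ) : angLin p q θ ≤ angTrunc p q θ x := by
  refine le_max_of_le_left ?_
  unfold angNum
  have : 0 ≤ exp x * |sin θ| ^ (q + 1) := by positivity
  linarith

/-- Where `sin θ = 0` the first entry of the maximum is positive, elsewhere the second one is.
Compactness over a period gives the bound at `x = y`, and the second entry only grows with `x`. -/
theorem exists_angTrunc_lower {p q : ℝ} (hp : 1 < p) (hq : p - 1 < q) (y : ℝ) :
    ∃ m : ℝ, 0 < m ∧ ∀ θ x, y ≤ x → m ≤ angTrunc p q θ x := by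
  have hb := betaQ_pos hp hq
  have hq1 : 0 < q + 1 := by linarith
  have hcont : Continuous fun θ => max (angLin p q θ) (1 / 3 * (exp y * |sin θ| ^ (q + 1))) := by
    have : Continuous fun θ => |sin θ| ^ (q + 1) :=
      (continuous_sin.abs).rpow_const fun _ => Or.inr hq1.le
    exact (continuous_angLin p q).max (by fun_prop)
  obtain ⟨t, -, ht⟩ := (isCompact_Icc (a := (0 : ℝ)) (b := 2 * π)).exists_isMinOn
    (nonempty_Icc.2 (by positivity)) hcont.continuousOn
  refine ⟨max (angLin p q t) (1 / 3 * (exp y * |sin t| ^ (q + 1))), ?_, fun θ x hx => ?_⟩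
  · rcases eq_or_ne (sin t) 0 with h0 | h0
    · refine lt_max_of_lt_left ?_
      have h1 := sin_sq_add_cos_sq t
      unfold angLin
      rw [h0] at h1 ⊢
      have : 0 < p - 1 := by linarith
      have h2 : cos t ^ 2 = 1 := by linarith
      rw [h2]; simp; positivity
    · refine lt_max_of_lt_right ?_
      have := abs_pos.2 h0
      positivity
  · obtain ⟨θ', hθ', h1⟩ : ∃ θ' ∈ Icc (0 : ℝ) (2 * π), sin θ = sin θ' ∧ cos θ = cos θ' := by
      have hper : Function.Periodic (fun t => (sin t, cos t)) (2 * π) := fun t => by simp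
      obtain ⟨z, hz, h2⟩ := hper.exists_mem_Ico₀ (by positivity) θ
      exact ⟨z, ⟨hz.1, hz.2.le⟩, Prod.ext_iff.1 h2⟩
    have h2 : max (angLin p q θ') (1 / 3 * (exp y * |sin θ'| ^ (q + 1)))
        = max (angLin p q θ) (1 / 3 * (exp y * |sin θ| ^ (q + 1))) := by
      unfold angLin; rw [h1.1, h1.2]
    refine (ht hθ').trans ?_
    simp only []
    rw [h2]
    refine max_le (angLin_le_angTrunc _ _ _ _) (le_max_of_le_right ?_)
    gcongr

/-- The truncated right hand side of the equation for the radial variable as a function of the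
angle. -/
noncomputable def slopeTrunc (p q l u θ x : ℝ) : ℝ :=
  radNum p q θ (max l (min u x)) / angTrunc p q θ (max l (min u x))

theorem abs_radNum_le {p q θ x : ℝ} (hp : 1 < p) (hq : p - 1 < q) :
    |radNum p q θ x| ≤ (q + 1 - p) * (|betaQ p q ^ 2 - lambdaQ p q| + exp x) := by
  have hk : 0 < q + 1 - p := by linarith
  have h1 := abs_abs_rpow_mul_le (q := q) (by linarith) (abs_sin_le_one θ)
  unfold radNum
  rw [abs_mul, abs_mul, abs_of_pos hk]
  have h2 : |(betaQ p q ^ 2 - lambdaQ p q) * sin θ - exp x * (|sin θ| ^ (q - 1) * sin θ)|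
      ≤ |betaQ p q ^ 2 - lambdaQ p q| + exp x := by
    refine (abs_sub _ _).trans (add_le_add ?_ ?_)
    · rw [abs_mul]; exact mul_le_of_le_one_right (abs_nonneg _) (abs_sin_le_one θ)
    · rw [abs_mul, abs_of_pos (exp_pos x)]; exact mul_le_of_le_one_right (exp_pos x).le h1
  have h3 := abs_cos_le_one θ
  exact mul_le_mul (mul_le_of_le_one_right hk.le h3) h2 (abs_nonneg _) hk.le

theorem slopeTrunc_lipschitz {p q l u m : ℝ} (hp : 1 < p) (hq : p - 1 < q) (hlu : l ≤ u)
    (hm : 0 < m) (hml : ∀ θ x, l ≤ x → m ≤ angTrunc p q θ x) (θ x y : ℝ) :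
    |slopeTrunc p q l u θ x - slopeTrunc p q l u θ y|
      ≤ ((q + 1 - p) / m + (q + 1 - p) * (|betaQ p q ^ 2 - lambdaQ p q| + exp u) / m ^ 2)
        * exp u * |x - y| := by
  have hk : 0 < q + 1 - p := by linarith
  set x' := max l (min u x)
  set y' := max l (min u y)
  have hx' : l ≤ x' := le_max_left _ _
  have hy' : l ≤ y' := le_max_left _ _
  have hxu : x' ≤ u := max_le hlu (min_le_left _ _)
  have hyu : y' ≤ u := max_le hlu (min_le_left _ _)
  have hxy : |x' - y'| ≤ |x - y| := by
    exact (abs_max_sub_max_le_max l (min u x) l (min u y)).trans (max_le (by simp)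
      ((abs_min_sub_min_le_max u x u y).trans (max_le (by simp) le_rfl)))
  have hexp : |exp x' - exp y'| ≤ exp u * |x - y| := by
    refine le_trans ?_ (mul_le_mul_of_nonneg_left hxy (exp_pos u).le)
    have := (convex_Iic u).norm_image_sub_le_of_norm_deriv_le (f := exp) (C := exp u)
      (fun t _ => Real.differentiableAt_exp) (fun t ht => by
        rw [Real.deriv_exp, norm_eq_abs, abs_of_pos (exp_pos t)]; exact exp_le_exp.2 ht)
      hyu hxu
    simpa [Real.norm_eq_abs] using this
  have hg := abs_abs_rpow_mul_le (q := q) (by linarith) (abs_sin_le_one θ)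
  have hs1 : |sin θ| ^ (q + 1) ≤ 1 :=
    rpow_le_one (abs_nonneg _) (abs_sin_le_one θ) (by linarith)
  have hs0 : 0 ≤ |sin θ| ^ (q + 1) := by positivity
  have hn : |radNum p q θ x' - radNum p q θ y'| ≤ (q + 1 - p) * |exp x' - exp y'| := by
    have : radNum p q θ x' - radNum p q θ y'
        = -((q + 1 - p) * (cos θ * (|sin θ| ^ (q - 1) * sin θ) * (exp x' - exp y'))) := by
      unfold radNum; ring
    rw [this, abs_neg, abs_mul, abs_of_pos hk, abs_mul, abs_mul]
    have h3 : |cos θ| * |(|sin θ| ^ (q - 1) * sin θ)| ≤ 1 :=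
      mul_le_one₀ (abs_cos_le_one θ) (abs_nonneg _) hg
    exact mul_le_mul_of_nonneg_left (mul_le_of_le_one_left (abs_nonneg _) h3) hk.le
  have hd : |angTrunc p q θ x' - angTrunc p q θ y'| ≤ |exp x' - exp y'| := by
    refine (abs_max_sub_max_le_max _ _ _ _).trans (max_le ?_ ?_)
    · have : angNum p q θ x' - angNum p q θ y' = |sin θ| ^ (q + 1) * (exp x' - exp y') := by
        unfold angNum; ring
      rw [this, abs_mul, abs_of_nonneg hs0]
      exact mul_le_of_le_one_left (abs_nonneg _) hs1
    · rw [show 1 / 3 * (exp x' * |sin θ| ^ (q + 1)) - 1 / 3 * (exp y' * |sin θ| ^ (q + 1))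
        = (1 / 3 * |sin θ| ^ (q + 1)) * (exp x' - exp y') by ring, abs_mul,
        abs_of_nonneg (by positivity)]
      exact mul_le_of_le_one_left (abs_nonneg _) (by linarith)
  have hdx := hml θ x' hx'
  have hdy := hml θ y' hy'
  have hny : |radNum p q θ y'| ≤ (q + 1 - p) * (|betaQ p q ^ 2 - lambdaQ p q| + exp u) :=
    (abs_radNum_le hp hq).trans (by gcongr)
  unfold slopeTrunc
  set n1 := radNum p q θ x'
  set n2 := radNum p q θ y'
  set d1 := angTrunc p q θ x'
  set d2 := angTrunc p q θ y'
  have hd1 : 0 < d1 := hm.trans_le hdx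
  have hd2 : 0 < d2 := hm.trans_le hdy
  set N := (q + 1 - p) * (|betaQ p q ^ 2 - lambdaQ p q| + exp u)
  have hN : 0 ≤ N := by positivity
  have key : n1 / d1 - n2 / d2 = (n1 - n2) / d1 - n2 * (d1 - d2) / (d1 * d2) := by
    field_simp; ring
  change |n1 / d1 - n2 / d2| ≤ _
  rw [key]
  calc |(n1 - n2) / d1 - n2 * (d1 - d2) / (d1 * d2)|
      ≤ |(n1 - n2) / d1| + |n2 * (d1 - d2) / (d1 * d2)| := abs_sub _ _
    _ = |n1 - n2| / d1 + |n2| * |d1 - d2| / (d1 * d2) := by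
        rw [abs_div, abs_div, abs_mul, abs_mul, abs_of_pos hd1, abs_of_pos hd2]
    _ ≤ ((q + 1 - p) * (exp u * |x - y|)) / m + N * (exp u * |x - y|) / (m * m) := by
        have := hn.trans (mul_le_mul_of_nonneg_left hexp hk.le)
        have := hd.trans hexp
        gcongr
    _ = _ := by field_simp

/-- On `[0, π/2]` the truncated equation has a solution along which the truncation of the radial
variable is inactive. -/
theorem exists_trunc_solution {p q : ℝ} (hp : 1 < p) (hq : p - 1 < q) (x₀ : ℝ) :
    ∃ X : ℝ → ℝ, X 0 = x₀ ∧ ∀ t ∈ Icc 0 (π / 2),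
      HasDerivWithinAt X (radNum p q t (X t) / angTrunc p q t (X t)) (Icc 0 (π / 2)) t := by
  have hk : 0 < q + 1 - p := by linarith
  have hq0 : 0 < q := by linarith
  obtain ⟨θ₁, n, hθ0, hθ1, hn, hnl, halt⟩ := exists_angLin_lower hp hq
  set a := betaQ p q ^ 2 - lambdaQ p q with ha
  set κ := q + 1 - p with hκ
  set s₁ := sin θ₁ with hs₁
  have hs1 : 0 < s₁ := sin_pos_of_pos_of_lt_pi hθ0 (by linarith [pi_pos])
  -- The bounds are chosen in an order free of circularity: above then below on `[0, θ₁]`, where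
  -- `angLin ≥ n`; then below on `[θ₁, π/2]`, independently of any upper bound; this gives the floor
  -- `m` of the angular speed, and `m` gives the upper bound `u`.
  set u₁ := x₀ + κ * |a| / n * (π / 2) with hu₁
  set l₁ := x₀ - κ * (|a| + exp u₁) / n * (π / 2) with hl₁
  set l := l₁ - 3 * κ / s₁ * (π / 2) with hl
  obtain ⟨m, hm, hml⟩ := exists_angTrunc_lower hp hq l
  set u := u₁ + κ * |a| / m * (π / 2) with hu
  have hpi := pi_pos
  have hu₁x : x₀ ≤ u₁ := by have : 0 ≤ κ * |a| / n * (π / 2) := by positivity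
                            linarith
  have hl₁x : l₁ ≤ x₀ := by have : 0 ≤ κ * (|a| + exp u₁) / n * (π / 2) := by positivity
                            linarith
  have hll : l ≤ l₁ := by have : 0 ≤ 3 * κ / s₁ * (π / 2) := by positivity
                          linarith
  have huu : u₁ ≤ u := by have : 0 ≤ κ * |a| / m * (π / 2) := by positivity
                          linarith
  have hlu : l ≤ u := by linarith
  set N := κ * (|a| + exp u) with hN
  obtain ⟨X, hX0, hX⟩ := exists_solution_of_bounded_lipschitz (f := slopeTrunc p q l u)
    (T := π / 2) (L := N / m)
    (K := (κ / m + κ * (|a| + exp u) / m ^ 2) * exp u)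
    (by positivity) (by positivity) (by positivity)
    (fun t _ x y => slopeTrunc_lipschitz hp hq hlu hm hml t x y)
    (fun x => by
      have h1 : Continuous fun θ => |sin θ| ^ (q + 1) :=
        (continuous_sin.abs).rpow_const fun _ => Or.inr (by linarith)
      have h2 : Continuous fun θ => |sin θ| ^ (q - 1) * sin θ :=
        (continuous_abs_rpow_mul hq0).comp continuous_sin
      refine (Continuous.div ?_ ?_ fun t => ?_).continuousOn
      · unfold radNum; fun_prop
      · unfold angTrunc angNum
        have := continuous_angLin p q
        fun_prop
      · exact (hm.trans_le (hml t _ (le_max_left _ _))).ne')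
    (fun t _ x => by
      unfold slopeTrunc
      have h1 := hml t (max l (min u x)) (le_max_left _ _)
      rw [abs_div, abs_of_pos (hm.trans_le h1)]
      have h2 : |radNum p q t (max l (min u x))| ≤ N :=
        (abs_radNum_le hp hq).trans (by
          have : max l (min u x) ≤ u := max_le hlu (min_le_left _ _)
          rw [hN]; gcongr)
      have : 0 ≤ N := by positivity
      gcongr) x₀
  -- upper bound for the slope where the angular speed is bounded below
  have hup : ∀ t ∈ Icc 0 (π / 2), ∀ x d : ℝ, 0 < d → d ≤ angTrunc p q t x →
      radNum p q t x / angTrunc p q t x ≤ κ * |a| / d := by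
    intro t ht x d hd hdl
    have hs : 0 ≤ sin t := sin_nonneg_of_nonneg_of_le_pi ht.1 (by linarith [ht.2])
    have hc : 0 ≤ cos t := cos_nonneg_of_mem_Icc ⟨by linarith [ht.1], ht.2⟩
    have h1 : radNum p q t x ≤ κ * |a| := by
      unfold radNum
      have h2 : a * sin t - exp x * (|sin t| ^ (q - 1) * sin t) ≤ |a| := by
        have : 0 ≤ exp x * (|sin t| ^ (q - 1) * sin t) := by positivity
        have h3 : a * sin t ≤ |a| := by
          refine (mul_le_mul_of_nonneg_right (le_abs_self a) hs).trans ?_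
          exact mul_le_of_le_one_right (abs_nonneg _) (sin_le_one t)
        linarith
      exact (mul_le_mul_of_nonneg_left h2 (by positivity)).trans
        (mul_le_mul_of_nonneg_right (mul_le_of_le_one_right hk.le (cos_le_one t)) (abs_nonneg _))
    calc radNum p q t x / angTrunc p q t x ≤ κ * |a| / angTrunc p q t x := by
          have := hd.trans_le hdl; gcongr
      _ ≤ κ * |a| / d := by gcongr
  have hpi2 : θ₁ ∈ Icc 0 (π / 2) := ⟨hθ0.le, hθ1⟩
  have b1 : ∀ t ∈ Icc 0 θ₁, X t ≤ u₁ := by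
    intro t ht
    have := sub_le_of_deriv_le hX le_rfl ht.1 (ht.2.trans hθ1) (B := κ * |a| / n)
      (fun r hr => hup r ⟨hr.1, hr.2.trans (ht.2.trans hθ1)⟩ _ n hn
        ((hnl r ⟨hr.1, hr.2.trans ht.2⟩).trans (angLin_le_angTrunc _ _ _ _)))
    have h2 : κ * |a| / n * (t - 0) ≤ κ * |a| / n * (π / 2) := by
      have := ht.2.trans hθ1
      gcongr; linarith
    linarith
  have b2 : ∀ t ∈ Icc 0 θ₁, l₁ ≤ X t := by
    intro t ht
    have := le_sub_of_le_deriv hX le_rfl ht.1 (ht.2.trans hθ1) (B := -(κ * (|a| + exp u₁) / n))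
      (fun r hr => by
        have hr1 : r ∈ Icc 0 θ₁ := ⟨hr.1, hr.2.trans ht.2⟩
        have hd := (hnl r hr1).trans (angLin_le_angTrunc p q r (max l (min u (X r))))
        have h3 : |slopeTrunc p q l u r (X r)| ≤ κ * (|a| + exp u₁) / n := by
          unfold slopeTrunc
          rw [abs_div, abs_of_pos (hn.trans_le hd)]
          have h4 : |radNum p q r (max l (min u (X r)))| ≤ κ * (|a| + exp u₁) :=
            (abs_radNum_le hp hq).trans (by
              have : max l (min u (X r)) ≤ u₁ :=
                max_le (by linarith) ((min_le_right _ _).trans (b1 r hr1))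
              gcongr)
          gcongr
        exact neg_le_of_abs_le h3)
    have h2 : κ * (|a| + exp u₁) / n * (t - 0) ≤ κ * (|a| + exp u₁) / n * (π / 2) := by
      have := ht.2.trans hθ1
      gcongr; linarith
    linarith
  have b3 : ∀ t ∈ Icc 0 (π / 2), l ≤ X t ∧ X t ≤ u := by
    intro t ht
    rcases le_total t θ₁ with h | h
    · exact ⟨hll.trans (b2 t ⟨ht.1, h⟩), (b1 t ⟨ht.1, h⟩).trans huu⟩
    rcases halt with h0 | ha0
    · have h : t ≤ θ₁ := by rw [h0]; exact ht.2
      exact ⟨hll.trans (b2 t ⟨ht.1, h⟩), (b1 t ⟨ht.1, h⟩).trans huu⟩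
    constructor
    -- Since `β² - λ ≥ 0`, only the reaction term can make the slope negative, and the floor `exp y
    -- * |sin r| ^ (q + 1) / 3` of the denominator bounds its share by `3 κ / sin r`, whatever `y`
    -- is.
    · have := le_sub_of_le_deriv hX hθ0.le h ht.2 (B := -(3 * κ / s₁))
        (fun r hr => by
          have hr0 : 0 < r := hθ0.trans_le hr.1
          have hrpi : r ≤ π / 2 := hr.2.trans ht.2
          have hs : 0 < sin r := sin_pos_of_pos_of_lt_pi hr0 (by linarith)
          have hc : 0 ≤ cos r := cos_nonneg_of_mem_Icc ⟨by linarith, hrpi⟩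
          have hsr : s₁ ≤ sin r := sin_le_sin_of_le_of_le_pi_div_two (by linarith) hrpi hr.1
          unfold slopeTrunc
          set y := max l (min u (X r))
          have hd : 1 / 3 * (exp y * |sin r| ^ (q + 1)) ≤ angTrunc p q r y := le_max_right _ _
          have hdpos : 0 < angTrunc p q r y := hm.trans_le (hml r y (le_max_left _ _))
          rw [le_div_iff₀ hdpos, neg_mul, neg_le]
          rw [abs_rpow_mul_self hq0] at hd
          set g := |sin r| ^ (q - 1) * sin r with hg
          have hg0 : 0 ≤ g := by positivity
          have h5 : -radNum p q r y ≤ κ * (exp y * g) := by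
            have h6 : -radNum p q r y
                = κ * (cos r * (exp y * g) - cos r * (a * sin r)) := by
              unfold radNum; rw [← hg, ← ha, ← hκ]; ring
            rw [h6]
            refine mul_le_mul_of_nonneg_left ?_ hk.le
            have h7 : 0 ≤ cos r * (a * sin r) := by positivity
            have h8 : cos r * (exp y * g) ≤ exp y * g :=
              mul_le_of_le_one_left (by positivity) (cos_le_one r)
            linarith
          refine h5.trans ?_
          calc κ * (exp y * g) ≤ 3 * κ / s₁ * (1 / 3 * (exp y * (g * sin r))) := by
                rw [div_mul_eq_mul_div, le_div_iff₀ hs1]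
                have : κ * (exp y * g) * s₁ ≤ κ * (exp y * g) * sin r := by gcongr
                linarith
            _ ≤ _ := by gcongr)
      have h2 : 3 * κ / s₁ * (t - θ₁) ≤ 3 * κ / s₁ * (π / 2) := by
        have := ht.2
        gcongr; linarith
      have := b2 θ₁ ⟨hθ0.le, le_rfl⟩
      linarith
    · have := sub_le_of_deriv_le hX hθ0.le h ht.2 (B := κ * |a| / m)
        (fun r hr => hup r ⟨hθ0.le.trans hr.1, hr.2.trans ht.2⟩ _ m hm
          (hml r _ (le_max_left _ _)))
      have h2 : κ * |a| / m * (t - θ₁) ≤ κ * |a| / m * (π / 2) := by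
        have := ht.2
        gcongr; linarith
      have := b1 θ₁ ⟨hθ0.le, le_rfl⟩
      linarith
  refine ⟨X, hX0, fun t ht => ?_⟩
  have h1 := hX t ht
  unfold slopeTrunc at h1
  rwa [min_eq_right (b3 t ht).2, max_eq_right (b3 t ht).1] at h1

theorem hasDerivAt_angLin (p q θ : ℝ) :
    HasDerivAt (angLin p q) (cos θ * (2 * (lambdaQ p q - (p - 1) * betaQ p q ^ 2) * sin θ)) θ := by
  have h := (((hasDerivAt_cos θ).pow 2).const_mul ((p - 1) * betaQ p q ^ 2)).add
    (((hasDerivAt_sin θ).pow 2).const_mul (lambdaQ p q))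
  refine h.congr_deriv ?_
  push_cast
  ring

theorem hasDerivAt_abs_sin_rpow {q : ℝ} (hq : 0 < q) (θ : ℝ) :
    HasDerivAt (fun θ => |sin θ| ^ (q + 1)) (cos θ * ((q + 1) * (|sin θ| ^ (q - 1) * sin θ))) θ := by
  have h := (hasDerivAt_abs_rpow (sin θ) (p := q + 1) (by linarith)).comp θ (hasDerivAt_sin θ)
  refine h.congr_deriv ?_
  rw [show q + 1 - 2 = q - 1 by ring]; ring

/-- Along a solution of the truncated equation the truncation is inactive. -/
theorem trunc_inactive {p q : ℝ} (hp : 1 < p) (hq : p - 1 < q) {X : ℝ → ℝ}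
    (hX : ∀ t ∈ Icc 0 (π / 2),
      HasDerivWithinAt X (radNum p q t (X t) / angTrunc p q t (X t)) (Icc 0 (π / 2)) t) :
    ∀ t ∈ Icc 0 (π / 2), 0 < angLin p q t + 2 / 3 * (exp (X t) * |sin t| ^ (q + 1)) := by
  have hb := betaQ_pos hp hq
  have hq0 : 0 < q := by linarith
  have hpi := pi_pos
  -- The weight `2/3` is such that at a zero of `M` the two entries of the maximum in `angTrunc`
  -- coincide, both being a third of the nonlinear term. Positivity of `M` means that `angNum`
  -- strictly exceeds the floor.
  set M : ℝ → ℝ := fun t => angLin p q t + 2 / 3 * (exp (X t) * |sin t| ^ (q + 1)) with hM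
  have hXc : ContinuousOn X (Icc 0 (π / 2)) := fun t ht => (hX t ht).continuousWithinAt
  have hs1 : Continuous fun θ => |sin θ| ^ (q + 1) :=
    (continuous_sin.abs).rpow_const fun _ => Or.inr (by linarith)
  have hs2 : Continuous fun θ => |sin θ| ^ (q - 1) * sin θ :=
    (continuous_abs_rpow_mul hq0).comp continuous_sin
  have hl := continuous_angLin p q
  have hMc : ContinuousOn M (Icc 0 (π / 2)) := by
    have := hs1.continuousOn (s := Icc 0 (π / 2)); have := hl.continuousOn (s := Icc 0 (π / 2))
    fun_prop
  have hM0 : 0 < M 0 := by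
    have : 0 < p - 1 := by linarith
    simp only [hM, angLin, sin_zero, cos_zero, abs_zero]
    rw [zero_rpow (by linarith)]
    simp; positivity
  intro t ht
  by_contra hcon
  have hcon : M t ≤ 0 := not_lt.1 hcon
  have hc : IsCompact (Icc 0 (π / 2) ∩ M ⁻¹' Iic 0) :=
    isCompact_Icc.of_isClosed_subset (hMc.preimage_isClosed_of_isClosed isClosed_Icc isClosed_Iic)
      inter_subset_left
  obtain ⟨t₀, ⟨ht₀, hMt₀⟩, hmin⟩ := hc.exists_isLeast ⟨t, ht, hcon⟩
  have hMt₀ : M t₀ ≤ 0 := hMt₀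
  have ht0 : 0 < t₀ := by
    refine lt_of_le_of_ne ht₀.1 fun h => ?_
    rw [← h] at hMt₀; linarith
  have hpos : ∀ r ∈ Ico 0 t₀, 0 < M r := by
    intro r hr
    by_contra hr'
    exact absurd (hmin ⟨⟨hr.1, hr.2.le.trans ht₀.2⟩, not_lt.1 hr'⟩) (not_le.2 hr.2)
  have hs0 : 0 < sin t₀ := sin_pos_of_pos_of_lt_pi ht0 (by linarith [ht₀.2])
  -- Inside the interval `M' = cos * h`. The factor `cos` is split off because it vanishes at `π/2`;
  -- positivity of `h` at the first zero `t₀` still makes `M` strictly increasing just before `t₀`,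
  -- which contradicts `M > 0` there and `M t₀ = 0`.
  set h : ℝ → ℝ := fun r => 2 * (lambdaQ p q - (p - 1) * betaQ p q ^ 2) * sin r
    + 2 / 3 * (exp (X r) * (|sin r| ^ (q + 1) * ((q + 1 - p) *
      ((betaQ p q ^ 2 - lambdaQ p q) * sin r - exp (X r) * (|sin r| ^ (q - 1) * sin r))
        / angTrunc p q r (X r)) + (q + 1) * (|sin r| ^ (q - 1) * sin r))) with hh
  obtain ⟨m, hm, hml⟩ := exists_angTrunc_lower hp hq (X t₀)
  have hMeq : M t₀ = 0 := by
    refine le_antisymm hMt₀ ?_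
    have h1 : Tendsto M (𝓝[Ico 0 t₀] t₀) (𝓝 (M t₀)) :=
      (hMc t₀ ht₀).mono fun r hr => ⟨hr.1, hr.2.le.trans ht₀.2⟩
    have : (𝓝[Ico 0 t₀] t₀).NeBot := by
      rw [← mem_closure_iff_nhdsWithin_neBot, closure_Ico ht0.ne]
      exact ⟨ht0.le, le_rfl⟩
    exact ge_of_tendsto h1 (eventually_nhdsWithin_of_forall fun r hr => (hpos r hr).le)
  have hE : exp (X t₀) * |sin t₀| ^ (q + 1) = -(3 / 2) * angLin p q t₀ := by
    simp only [hM] at hMeq; linarith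
  have hEpos : 0 < exp (X t₀) * |sin t₀| ^ (q + 1) := by
    have := abs_pos.2 hs0.ne'; positivity
  have hAt : angTrunc p q t₀ (X t₀) = 1 / 3 * (exp (X t₀) * |sin t₀| ^ (q + 1)) := by
    unfold angTrunc angNum
    exact max_eq_right (by linarith)
  have hht : 0 < h t₀ := by
    have h1 : 0 < sin t₀ * h t₀ := by
      simp only [hh]
      rw [hAt]
      have e1 := abs_rpow_mul_self hq0 (sin t₀)
      have e2 := angLin_add p q t₀
      have e3 := betaQ_sq_sub_lambdaQ hq
      have e4 := mul_betaQ hq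
      set E := exp (X t₀) * |sin t₀| ^ (q + 1) with hEdef
      set g := |sin t₀| ^ (q - 1) * sin t₀
      have e5 : exp (X t₀) * g * sin t₀ = E := by rw [hEdef, e1]; ring
      have key : sin t₀ * (2 * (lambdaQ p q - (p - 1) * betaQ p q ^ 2) * sin t₀
          + 2 / 3 * (exp (X t₀) * (|sin t₀| ^ (q + 1) * ((q + 1 - p) *
          ((betaQ p q ^ 2 - lambdaQ p q) * sin t₀ - exp (X t₀) * g)
          / (1 / 3 * E)) + (q + 1) * g)))
          = 2 * betaQ p q * ((2 * p - 2) * sin t₀ ^ 2 + p * (p - 1) * cos t₀ ^ 2)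
            + 2 / 3 * p * E := by
        have e6 : exp (X t₀) * (|sin t₀| ^ (q + 1) * ((q + 1 - p) *
          ((betaQ p q ^ 2 - lambdaQ p q) * sin t₀ - exp (X t₀) * g) / (1 / 3 * E)))
          = 3 * ((q + 1 - p) * ((betaQ p q ^ 2 - lambdaQ p q) * sin t₀ - exp (X t₀) * g)) := by
          rw [← mul_assoc, ← hEdef]; field_simp
        rw [mul_add (exp (X t₀)), e6, e3]
        have e7 : angWeight p t₀ = sin t₀ ^ 2 + (p - 1) * cos t₀ ^ 2 := rfl
        rw [e7] at e2
        linear_combination (2 / 3 * (q + 1) - 2 * (q + 1 - p)) * e5 + 2 * (q + 1 - p) * e2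
          + 2 * betaQ p q * (sin t₀ ^ 2 + (p - 1) * cos t₀ ^ 2) * e4
          - 4 / 3 * (q + 1 - p) * hE
      rw [key]
      have h2 : 0 < p - 1 := by linarith
      have h3 : 0 < 2 * p - 2 := by linarith
      have h4 : 0 < p := by linarith
      positivity
    exact (pos_iff_pos_of_mul_pos h1).1 hs0
  have hhc : ContinuousWithinAt h (Icc 0 (π / 2)) t₀ := by
    have c1 : ContinuousWithinAt X (Icc 0 (π / 2)) t₀ := hXc t₀ ht₀
    have c2 : ContinuousWithinAt (fun r => angTrunc p q r (X r)) (Icc 0 (π / 2)) t₀ := by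
      unfold angTrunc angNum
      have := hs1.continuousWithinAt (s := Icc 0 (π / 2)) (x := t₀)
      have := hl.continuousWithinAt (s := Icc 0 (π / 2)) (x := t₀)
      fun_prop
    have c3 := hs1.continuousWithinAt (s := Icc 0 (π / 2)) (x := t₀)
    have c4 := hs2.continuousWithinAt (s := Icc 0 (π / 2)) (x := t₀)
    have c6 : ContinuousWithinAt (fun r => (q + 1 - p) *
      ((betaQ p q ^ 2 - lambdaQ p q) * sin r - exp (X r) * (|sin r| ^ (q - 1) * sin r))
        / angTrunc p q r (X r)) (Icc 0 (π / 2)) t₀ := by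
      refine ContinuousWithinAt.div (by fun_prop) c2 ?_
      exact (hm.trans_le (hml t₀ _ le_rfl)).ne'
    have c5 : ContinuousWithinAt (fun r => sin r) (Icc 0 (π / 2)) t₀ := by fun_prop
    have c7 : ContinuousWithinAt (fun r => exp (X r)) (Icc 0 (π / 2)) t₀ := c1.rexp
    exact (c5.const_mul _).add ((c7.mul ((c3.mul c6).add (c4.const_mul _))).const_mul _)
  have hev : ∀ᶠ r in 𝓝[Icc 0 (π / 2)] t₀, 0 < h r := hhc.eventually (lt_mem_nhds hht)
  obtain ⟨ε, hε, hball⟩ := Metric.mem_nhdsWithin_iff.1 hev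
  set r₀ := max 0 (t₀ - ε / 2) with hr₀
  have hr₀t : r₀ < t₀ := max_lt ht0 (by linarith)
  have hr₀0 : 0 ≤ r₀ := le_max_left _ _
  have hmono : StrictMonoOn M (Icc r₀ t₀) := by
    refine strictMonoOn_of_hasDerivWithinAt_pos (convex_Icc _ _)
      (hMc.mono (Icc_subset_Icc hr₀0 ht₀.2)) (f' := fun r => cos r * h r) ?_ ?_
    · intro r hr
      rw [interior_Icc] at hr
      have hr1 : 0 < r := by linarith [hr.1]
      have hr2 : r < π / 2 := by linarith [hr.2, ht₀.2]
      have d1 : HasDerivAt X _ r := (hX r ⟨hr1.le, hr2.le⟩).hasDerivAt (Icc_mem_nhds hr1 hr2)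
      have d2 := (hasDerivAt_angLin p q r).add
        ((d1.exp.mul (hasDerivAt_abs_sin_rpow hq0 r)).const_mul (2 / 3))
      refine (d2.congr_deriv ?_).hasDerivWithinAt
      simp only [hh]; unfold radNum
      ring
    · intro r hr
      rw [interior_Icc] at hr
      have hr1 : 0 < r := by linarith [hr.1]
      have hr2 : r < π / 2 := by linarith [hr.2, ht₀.2]
      refine mul_pos (cos_pos_of_mem_Ioo ⟨by linarith, hr2⟩) (hball ⟨?_, hr1.le, hr2.le⟩)
      rw [Metric.mem_ball, Real.dist_eq, abs_sub_comm, abs_of_pos (by linarith [hr.2])]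
      have := le_max_right 0 (t₀ - ε / 2)
      linarith [hr.1]
  have := hmono ⟨le_rfl, hr₀t.le⟩ ⟨hr₀t.le, le_rfl⟩ hr₀t
  have := hpos r₀ ⟨hr₀0, hr₀t⟩
  linarith

/-- The radial variable of a solution as a function of the angle. -/
structure IsProfile (p q : ℝ) (X : ℝ → ℝ) : Prop where
  hasDerivAt : ∀ θ, HasDerivAt X (radNum p q θ (X θ) / angNum p q θ (X θ)) θ
  pos : ∀ θ, 0 < angNum p q θ (X θ)
  even : ∀ θ, X (-θ) = X θ
  periodic : ∀ θ, X (θ + π) = X θ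

theorem continuous_radNum_comp {p q : ℝ} (hq : 0 < q) {X : ℝ → ℝ} (hX : Continuous X) :
    Continuous fun θ => radNum p q θ (X θ) := by
  have hs2 : Continuous fun θ => |sin θ| ^ (q - 1) * sin θ :=
    (continuous_abs_rpow_mul hq).comp continuous_sin
  unfold radNum; fun_prop

theorem continuous_angNum_comp {p q : ℝ} (hq : 0 < q) {X : ℝ → ℝ} (hX : Continuous X) :
    Continuous fun θ => angNum p q θ (X θ) := by
  have hs1 : Continuous fun θ => |sin θ| ^ (q + 1) :=
    (continuous_sin.abs).rpow_const fun _ => Or.inr (by linarith)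
  have := continuous_angLin p q
  unfold angNum; fun_prop

/-- The slope is odd under `θ ↦ -θ` and `θ ↦ π - θ`, so a solution on `[0, π/2]` extends by
reflection to an even, `π`-periodic solution on the line. -/
theorem exists_isProfile {p q : ℝ} (hp : 1 < p) (hq : p - 1 < q) (x₀ : ℝ) :
    ∃ X : ℝ → ℝ, X 0 = x₀ ∧ IsProfile p q X := by
  have hq0 : 0 < q := by linarith
  have hpi := pi_pos
  obtain ⟨Y, hY0, hY⟩ := exists_trunc_solution hp hq x₀
  have hYpos := trunc_inactive hp hq hY
  have hYc : ContinuousOn Y (Icc 0 (π / 2)) := fun t ht => (hY t ht).continuousWithinAt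
  -- `φ` folds the line onto `[0, π/2]`. Integrating the slope evaluated along `Y ∘ φ` avoids
  -- differentiating across the folds; that `X = Y ∘ φ` is recovered afterwards from the symmetries
  -- of `X`.
  set φ : ℝ → ℝ := fun θ => arcsin |sin θ| with hφ
  have hφmem : ∀ θ, φ θ ∈ Icc 0 (π / 2) := fun θ =>
    ⟨arcsin_nonneg.2 (abs_nonneg _), arcsin_le_pi_div_two _⟩
  have hφid : ∀ θ ∈ Icc 0 (π / 2), φ θ = θ := fun θ hθ => by
    simp only [hφ]
    rw [abs_of_nonneg (sin_nonneg_of_nonneg_of_le_pi hθ.1 (by linarith [hθ.2])),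
      arcsin_sin (by linarith [hθ.1]) hθ.2]
  have hsφ : ∀ θ, |sin (φ θ)| = |sin θ| := fun θ => by
    simp only [hφ]
    rw [sin_arcsin (by linarith [abs_nonneg (sin θ)]) (abs_sin_le_one θ), abs_abs]
  have hZc : Continuous fun θ => Y (φ θ) :=
    hYc.comp_continuous (by fun_prop) hφmem
  have hangEq : ∀ θ x, angNum p q (φ θ) x = angNum p q θ x := fun θ x => by
    unfold angNum angLin
    rw [hsφ, cos_sq', cos_sq', ← sq_abs (sin (φ θ)), hsφ, sq_abs]
  have hangpos : ∀ θ, 0 < angNum p q θ (Y (φ θ)) := fun θ => by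
    rw [← hangEq]
    have h1 := hYpos (φ θ) (hφmem θ)
    unfold angNum
    have : 0 ≤ exp (Y (φ θ)) * |sin (φ θ)| ^ (q + 1) := by positivity
    linarith
  set g : ℝ → ℝ := fun θ => radNum p q θ (Y (φ θ)) / angNum p q θ (Y (φ θ)) with hg
  have hgc : Continuous g := (continuous_radNum_comp hq0 hZc).div
    (continuous_angNum_comp hq0 hZc) fun θ => (hangpos θ).ne'
  set X : ℝ → ℝ := fun θ => x₀ + ∫ t in (0 : ℝ)..θ, g t with hXdef
  have hX' : ∀ θ, HasDerivAt X (g θ) θ := fun θ =>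
    (intervalIntegral.integral_hasDerivAt_right (hgc.intervalIntegrable _ _)
      (hgc.stronglyMeasurableAtFilter _ _) hgc.continuousAt).const_add x₀
  have hX0 : X 0 = x₀ := by simp [hXdef]
  have hφneg : ∀ θ, φ (-θ) = φ θ := fun θ => by simp [hφ]
  have hφpi : ∀ θ, φ (π - θ) = φ θ := fun θ => by simp [hφ]
  have hgneg : ∀ θ, g (-θ) = -g θ := fun θ => by
    simp only [hg, hφneg]; unfold radNum angNum angLin; simp; ring
  have hgpi : ∀ θ, g (π - θ) = -g θ := fun θ => by
    simp only [hg, hφpi]; unfold radNum angNum angLin; simp; ring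
  have hXeven : ∀ θ, X (-θ) = X θ := by
    intro θ
    have h1 : ∀ θ, HasDerivAt (fun θ => X (-θ) - X θ) 0 θ := fun θ => by
      have h2 := ((hX' (-θ)).comp θ (hasDerivAt_neg θ)).sub (hX' θ)
      refine h2.congr_deriv ?_
      rw [hgneg]; ring
    have h3 := is_const_of_deriv_eq_zero (fun s => (h1 s).differentiableAt)
      (fun s => (h1 s).deriv) θ 0
    simp at h3; linarith
  have hXpi : ∀ θ, X (π - θ) = X θ := by
    intro θ
    have h1 : ∀ θ, HasDerivAt (fun θ => X (π - θ) - X θ) 0 θ := fun θ => by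
      have h2 := ((hX' (π - θ)).comp θ ((hasDerivAt_id θ).const_sub π)).sub (hX' θ)
      refine h2.congr_deriv ?_
      rw [hgpi]; ring
    have h3 := is_const_of_deriv_eq_zero (fun s => (h1 s).differentiableAt)
      (fun s => (h1 s).deriv) θ (π / 2)
    simp only [show π - π / 2 = π / 2 by ring, sub_self] at h3; linarith
  have hXper : ∀ θ, X (θ + π) = X θ := fun θ => by
    rw [← hXpi, show π - (θ + π) = -θ by ring, hXeven]
  have hXY : ∀ θ ∈ Icc 0 (π / 2), X θ = Y θ := by
    intro θ hθ
    have h1 : ∀ t ∈ Icc 0 (π / 2), HasDerivWithinAt (fun t => X t - Y t) 0 (Icc 0 (π / 2)) t := by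
      intro t ht
      have h2 := (hX' t).hasDerivWithinAt (s := Icc 0 (π / 2)) |>.sub (hY t ht)
      refine h2.congr_deriv ?_
      have h3 : angTrunc p q t (Y t) = angNum p q t (Y t) := by
        refine max_eq_left ?_
        have := hYpos t ht
        unfold angNum; linarith
      simp only [hg]
      rw [hφid t ht, h3, sub_self]
    have h2 := sub_le_of_deriv_le h1 le_rfl hθ.1 hθ.2 (B := 0) (fun _ _ => le_rfl)
    have h3 := le_sub_of_le_deriv h1 le_rfl hθ.1 hθ.2 (B := 0) (fun _ _ => le_rfl)
    simp only [hX0, hY0] at h2 h3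
    linarith
  have hXφ : ∀ θ, X (φ θ) = X θ := by
    intro θ
    -- Equality of these cosines says `θ = ± φ θ` modulo `π`, and `X` is invariant under both
    -- symmetries.
    have h1 : cos (2 * φ θ) = cos (2 * θ) := by
      rw [cos_two_mul, cos_two_mul, cos_sq', cos_sq', ← sq_abs (sin (φ θ)), hsφ, sq_abs]
    have hper : ∀ k : ℤ, ∀ θ, X (θ + k * π) = X θ := fun k θ => by
      have : Function.Periodic X π := hXper
      exact this.int_mul k θ
    obtain ⟨k, hk⟩ := Real.cos_eq_cos_iff.1 h1
    rcases hk with hk | hk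
    · rw [show θ = φ θ + k * π by linarith, hper]
      rw [← show θ = φ θ + k * π by linarith]
    · have : θ = -φ θ + k * π := by linarith
      conv_rhs => rw [this, hper, hXeven]
  have hXZ : ∀ θ, Y (φ θ) = X θ := fun θ => by rw [← hXφ, hXY _ (hφmem θ)]
  refine ⟨X, hX0, fun θ => ?_, fun θ => ?_, hXeven, hXper⟩
  · have := hX' θ
    simp only [hg, hXZ] at this
    exact this
  · rw [← hXZ]; exact hangpos θ

/-! ### Uniqueness and ordering of profiles -/

theorem eq_zero_of_abs_deriv_le {d d' K : ℝ → ℝ} (hd : ∀ s, HasDerivAt d (d' s) s)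
    (hK : Continuous K) (h : ∀ s, |d' s| ≤ K s * |d s|) {a : ℝ} (ha : d a = 0) (b : ℝ) :
    d b = 0 := by
  have main : ∀ {d d' K : ℝ → ℝ} (_ : ∀ s, HasDerivAt d (d' s) s)
    (_ : Continuous K) (_ : ∀ s, |d' s| ≤ K s * |d s|) {a b : ℝ} (_ : d a = 0) (_ : a ≤ b),
    d b = 0 := by
    intro d d' K hd hK h a b ha hab
    obtain ⟨M, hM⟩ := (isCompact_Icc (a := a) (b := b)).bddAbove_image hK.continuousOn
    refine eq_zero_of_abs_deriv_le_mul_abs_self_of_eq_zero_right (f := d) (f' := d') (K := M)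
      (a := a) (b := b) (fun t _ => (hd t).continuousAt.continuousWithinAt)
      (fun t _ => (hd t).hasDerivWithinAt) ha (fun t ht => ?_) b ⟨hab, le_rfl⟩
    exact (h t).trans (mul_le_mul_of_nonneg_right (hM ⟨t, ⟨ht.1, ht.2.le⟩, rfl⟩) (abs_nonneg _))
  rcases le_total a b with hab | hab
  · exact main hd hK h ha hab
  · have := main (d := fun s => d (-s)) (d' := fun s => d' (-s) * -1) (K := fun s => K (-s))
      (fun s => (hd (-s)).comp s (hasDerivAt_neg s)) (by fun_prop)
      (fun s => by simpa using h (-s)) (a := -a) (b := -b) (by simpa using ha) (by linarith)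
    simpa using this

theorem abs_exp_sub_exp_le (x y : ℝ) : |exp x - exp y| ≤ (exp x + exp y) * |x - y| := by
  have := (convex_Iic (max x y)).norm_image_sub_le_of_norm_deriv_le (f := exp)
    (C := exp (max x y)) (fun t _ => Real.differentiableAt_exp) (fun t ht => by
        rw [Real.deriv_exp, norm_eq_abs, abs_of_pos (exp_pos t)]; exact exp_le_exp.2 ht)
      (le_max_right x y) (le_max_left x y)
  rw [norm_eq_abs, norm_eq_abs] at this
  refine this.trans (mul_le_mul_of_nonneg_right ?_ (abs_nonneg _))
  rcases le_total x y with h | h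
  · rw [max_eq_right h]; linarith [exp_pos x]
  · rw [max_eq_left h]; linarith [exp_pos y]

/-- The factor in the difference of two radial slopes at the same angle. -/
noncomputable def crossFactor (p q θ : ℝ) : ℝ :=
  -((q + 1 - p) * cos θ * (|sin θ| ^ (q - 1) * sin θ * angLin p q θ
    + (betaQ p q ^ 2 - lambdaQ p q) * sin θ * |sin θ| ^ (q + 1)))

theorem radNum_mul_angNum_sub {p q : ℝ} (hq : 0 < q) (θ x y : ℝ) :
    radNum p q θ x * angNum p q θ y - radNum p q θ y * angNum p q θ x
      = crossFactor p q θ * (exp x - exp y) := by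
  unfold radNum angNum crossFactor
  rw [abs_rpow_mul_self hq]; ring

theorem continuous_crossFactor {p q : ℝ} (hq : 0 < q) : Continuous (crossFactor p q) := by
  have hs1 : Continuous fun θ => |sin θ| ^ (q + 1) :=
    (continuous_sin.abs).rpow_const fun _ => Or.inr (by linarith)
  have hs2 : Continuous fun θ => |sin θ| ^ (q - 1) * sin θ :=
    (continuous_abs_rpow_mul hq).comp continuous_sin
  have := continuous_angLin p q
  unfold crossFactor; fun_prop

theorem continuous_angWeight (p : ℝ) : Continuous (angWeight p) := by
  unfold angWeight; fun_prop

theorem IsProfile.continuous {p q : ℝ} {X : ℝ → ℝ} (h : IsProfile p q X) : Continuous X :=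
  continuous_iff_continuousAt.2 fun s => (h.hasDerivAt s).continuousAt

theorem IsPolar.continuous_angle {p q : ℝ} {θ x : ℝ → ℝ} (h : IsPolar p q θ x) : Continuous θ :=
  continuous_iff_continuousAt.2 fun s => (h.angle s).continuousAt

theorem IsPolar.continuous_radial {p q : ℝ} {θ x : ℝ → ℝ} (h : IsPolar p q θ x) : Continuous x :=
  continuous_iff_continuousAt.2 fun s => (h.radial s).continuousAt

/-- The derivative of `x - X ∘ θ` is a continuous factor times `exp x - exp (X ∘ θ)`, so Grönwall
applies. Monotonicity of `θ` is not needed; it is a consequence, because `angNum > 0` on the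
profile. -/
theorem IsPolar.radial_eq {p q : ℝ} (hp : 1 < p) (hq : p - 1 < q) {θ x X : ℝ → ℝ}
    (h : IsPolar p q θ x) (hX : IsProfile p q X) {a : ℝ} (ha : x a = X (θ a)) (b : ℝ) :
    x b = X (θ b) := by
  have hq0 : 0 < q := by linarith
  have hb := betaQ_pos hp hq
  have hθc := h.continuous_angle
  have hxc := h.continuous_radial
  have hXc := hX.continuous
  have hd : ∀ s, HasDerivAt (fun s => x s - X (θ s))
      (crossFactor p q (θ s) / (betaQ p q * angWeight p (θ s) * angNum p q (θ s) (X (θ s)))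
        * (exp (x s) - exp (X (θ s)))) s := by
    intro s
    have h1 := (h.radial s).sub ((hX.hasDerivAt (θ s)).comp s (h.angle s))
    refine h1.congr_deriv ?_
    have h2 := radNum_mul_angNum_sub (p := p) hq0 (θ s) (x s) (X (θ s))
    have h3 := hX.pos (θ s)
    have h4 := angWeight_pos hp (θ s)
    field_simp
    linear_combination h2
  have := eq_zero_of_abs_deriv_le hd
    (K := fun s => |crossFactor p q (θ s) /
      (betaQ p q * angWeight p (θ s) * angNum p q (θ s) (X (θ s)))|
        * (exp (x s) + exp (X (θ s)))) ?_ ?_ (a := a) (sub_eq_zero.2 ha) b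
  · exact sub_eq_zero.1 this
  · have c1 := (continuous_crossFactor (p := p) hq0).comp hθc
    have c2 := (continuous_angWeight p).comp hθc
    have c3 := (continuous_angNum_comp (p := p) hq0 hXc).comp hθc
    refine Continuous.mul (Continuous.abs (c1.div ((continuous_const.mul c2).mul c3) ?_))
      (by fun_prop)
    exact fun s => (mul_pos (mul_pos hb (angWeight_pos hp _)) (hX.pos (θ s))).ne'
  · intro s
    rw [abs_mul]
    exact (mul_le_mul_of_nonneg_left (abs_exp_sub_exp_le _ _) (abs_nonneg _)).trans_eq
      (mul_assoc _ _ _).symm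

theorem IsProfile.slope_sub {p q : ℝ} (hq : 0 < q) {X Y : ℝ → ℝ} (hX : IsProfile p q X)
    (hY : IsProfile p q Y) (s : ℝ) :
    radNum p q s (X s) / angNum p q s (X s) - radNum p q s (Y s) / angNum p q s (Y s)
      = crossFactor p q s / (angNum p q s (X s) * angNum p q s (Y s))
        * (exp (X s) - exp (Y s)) := by
  have h2 := radNum_mul_angNum_sub (p := p) hq s (X s) (Y s)
  have h3 := hX.pos s
  have h4 := hY.pos s
  field_simp
  linear_combination h2

theorem IsProfile.eq_of_eq {p q : ℝ} (hq : 0 < q) {X Y : ℝ → ℝ} (hX : IsProfile p q X)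
    (hY : IsProfile p q Y) {a : ℝ} (ha : X a = Y a) (b : ℝ) : X b = Y b := by
  have hd : ∀ s, HasDerivAt (fun s => X s - Y s) _ s := fun s =>
    ((hX.hasDerivAt s).sub (hY.hasDerivAt s)).congr_deriv (hX.slope_sub hq hY s)
  have := eq_zero_of_abs_deriv_le hd
    (K := fun s => |crossFactor p q s / (angNum p q s (X s) * angNum p q s (Y s))|
        * (exp (X s) + exp (Y s))) ?_ ?_ (a := a) (sub_eq_zero.2 ha) b
  · exact sub_eq_zero.1 this
  · have hXc := hX.continuous
    have hYc := hY.continuous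
    refine Continuous.mul (Continuous.abs ((continuous_crossFactor (p := p) hq).div
      ((continuous_angNum_comp (p := p) hq hXc).mul (continuous_angNum_comp (p := p) hq hYc)) ?_))
      (by fun_prop)
    exact fun s => (mul_pos (hX.pos s) (hY.pos s)).ne'
  · intro s
    rw [abs_mul]
    exact (mul_le_mul_of_nonneg_left (abs_exp_sub_exp_le _ _) (abs_nonneg _)).trans_eq
      (mul_assoc _ _ _).symm

/-- If the order were reversed somewhere, the two profiles would meet, hence coincide by uniqueness.
-/
theorem IsProfile.lt_of_lt {p q : ℝ} (hq : 0 < q) {X Y : ℝ → ℝ} (hX : IsProfile p q X)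
    (hY : IsProfile p q Y) {a : ℝ} (ha : X a < Y a) (b : ℝ) : X b < Y b := by
  by_contra hcon
  have hXc := hX.continuous
  have hYc := hY.continuous
  obtain ⟨c, hc⟩ := mem_range_of_exists_le_of_exists_ge (c := (0 : ℝ)) (hXc.sub hYc)
    ⟨a, by simp; linarith⟩ ⟨b, by simp; linarith⟩
  have := hX.eq_of_eq hq hY (a := c) (by simp at hc; linarith) a
  linarith

/-! ### Time along a profile and the least period of a wave -/

/-- The time needed to reach the angle `θ` from the angle `0`. -/
noncomputable def travel (p q : ℝ) (X : ℝ → ℝ) (θ : ℝ) : ℝ :=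
  ∫ t in (0 : ℝ)..θ, betaQ p q * angWeight p t / angNum p q t (X t)

/-- The angle as a function of time. -/
noncomputable def angleOf (p q : ℝ) (X : ℝ → ℝ) : ℝ → ℝ := Function.invFun (travel p q X)

/-- The solution with a given profile. -/
noncomputable def wave (p q : ℝ) (X : ℝ → ℝ) : ℝ → ℝ :=
  ofPolar p q (angleOf p q X) (X ∘ angleOf p q X)

section profile

variable {p q : ℝ} {X : ℝ → ℝ}

theorem IsProfile.continuous_inv_speed (hp : 1 < p) (hq : p - 1 < q) (h : IsProfile p q X) :
    Continuous fun t => betaQ p q * angWeight p t / angNum p q t (X t) :=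
  (continuous_const.mul (continuous_angWeight p)).div
    (continuous_angNum_comp (by linarith) h.continuous) fun t => (h.pos t).ne'

theorem IsProfile.hasDerivAt_travel (hp : 1 < p) (hq : p - 1 < q) (h : IsProfile p q X) (θ : ℝ) :
    HasDerivAt (travel p q X) (betaQ p q * angWeight p θ / angNum p q θ (X θ)) θ :=
  have hc := h.continuous_inv_speed hp hq
  intervalIntegral.integral_hasDerivAt_right (hc.intervalIntegrable _ _)
    (hc.stronglyMeasurableAtFilter _ _) hc.continuousAt

theorem IsProfile.inv_speed_pos (hp : 1 < p) (hq : p - 1 < q) (h : IsProfile p q X) (θ : ℝ) :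
    0 < betaQ p q * angWeight p θ / angNum p q θ (X θ) :=
  div_pos (mul_pos (betaQ_pos hp hq) (angWeight_pos hp θ)) (h.pos θ)

theorem travel_zero : travel p q X 0 = 0 := by simp [travel]

theorem IsProfile.strictMono_travel (hp : 1 < p) (hq : p - 1 < q) (h : IsProfile p q X) :
    StrictMono (travel p q X) :=
  strictMono_of_hasDerivAt_pos (h.hasDerivAt_travel hp hq) (h.inv_speed_pos hp hq)

theorem IsProfile.travel_pi_pos (hp : 1 < p) (hq : p - 1 < q) (h : IsProfile p q X) :
    0 < travel p q X π := by
  rw [← travel_zero (p := p) (q := q) (X := X)]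
  exact h.strictMono_travel hp hq pi_pos

theorem IsProfile.travel_add_pi (hp : 1 < p) (hq : p - 1 < q) (h : IsProfile p q X) (θ : ℝ) :
    travel p q X (θ + π) = travel p q X θ + travel p q X π := by
  have h1 : ∀ θ, HasDerivAt (fun θ => travel p q X (θ + π) - travel p q X θ) 0 θ := fun θ => by
    have h2 := ((h.hasDerivAt_travel hp hq (θ + π)).comp_add_const θ π).sub
      (h.hasDerivAt_travel hp hq θ)
    refine h2.congr_deriv ?_
    rw [h.periodic]
    unfold angWeight angNum angLin
    simp
  have h3 := is_const_of_deriv_eq_zero (fun s => (h1 s).differentiableAt)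
    (fun s => (h1 s).deriv) θ 0
  simp only [zero_add, travel_zero] at h3
  linarith

theorem IsProfile.travel_add_int_mul_pi (hp : 1 < p) (hq : p - 1 < q) (h : IsProfile p q X)
    (θ : ℝ) (n : ℤ) : travel p q X (θ + n * π) = travel p q X θ + n * travel p q X π := by
  induction n using Int.induction_on with
  | zero => simp
  | succ n ih =>
    rw [show θ + ((n + 1 : ℤ) : ℝ) * π = (θ + (n : ℤ) * π) + π by push_cast; ring,
      h.travel_add_pi hp hq, ih]; push_cast; ring
  | pred n ih =>
    have h1 := h.travel_add_pi hp hq (θ + ((-n - 1 : ℤ) : ℝ) * π)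
    rw [show θ + ((-n - 1 : ℤ) : ℝ) * π + π = (θ + ((-n : ℤ) : ℝ) * π) by push_cast; ring, ih] at h1
    push_cast at h1 ⊢; linarith

theorem IsProfile.surjective_travel (hp : 1 < p) (hq : p - 1 < q) (h : IsProfile p q X) :
    Function.Surjective (travel p q X) := by
  intro y
  have hT := h.travel_pi_pos hp hq
  have hc : Continuous (travel p q X) :=
    continuous_iff_continuousAt.2 fun s => (h.hasDerivAt_travel hp hq s).continuousAt
  have h1 : ∀ n : ℤ, travel p q X (n * π) = n * travel p q X π := fun n => by
    have := h.travel_add_int_mul_pi hp hq 0 n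
    rwa [zero_add, travel_zero, zero_add] at this
  refine mem_range_of_exists_le_of_exists_ge hc ⟨(⌊y / travel p q X π⌋ : ℤ) * π, ?_⟩
    ⟨(⌈y / travel p q X π⌉ : ℤ) * π, ?_⟩
  · rw [h1]; exact (le_div_iff₀ hT).1 (Int.floor_le _)
  · rw [h1]; exact (div_le_iff₀ hT).1 (Int.le_ceil _)

theorem IsProfile.travel_angleOf (hp : 1 < p) (hq : p - 1 < q) (h : IsProfile p q X) (σ : ℝ) :
    travel p q X (angleOf p q X σ) = σ :=
  Function.rightInverse_invFun (h.surjective_travel hp hq) σ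

theorem IsProfile.angleOf_travel (hp : 1 < p) (hq : p - 1 < q) (h : IsProfile p q X) (θ : ℝ) :
    angleOf p q X (travel p q X θ) = θ :=
  Function.leftInverse_invFun (h.strictMono_travel hp hq).injective θ

theorem IsProfile.isPolar (hp : 1 < p) (hq : p - 1 < q) (h : IsProfile p q X) :
    IsPolar p q (angleOf p q X) (X ∘ angleOf p q X) := by
  have hb := betaQ_pos hp hq
  have hcont : Continuous (angleOf p q X) := by
    let e := (h.strictMono_travel hp hq).orderIsoOfSurjective _ (h.surjective_travel hp hq)
    have : angleOf p q X = e.symm := by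
      funext σ
      rw [eq_comm, e.symm_apply_eq]
      exact (h.travel_angleOf hp hq σ).symm
    rw [this]; exact e.symm.continuous
  have h1 : ∀ σ, HasDerivAt (angleOf p q X) (angNum p q (angleOf p q X σ)
      ((X ∘ angleOf p q X) σ) / (betaQ p q * angWeight p (angleOf p q X σ))) σ := by
    intro σ
    have h2 := HasDerivAt.of_local_left_inverse hcont.continuousAt
      (h.hasDerivAt_travel hp hq (angleOf p q X σ)) (h.inv_speed_pos hp hq _).ne'
      (Eventually.of_forall (h.travel_angleOf hp hq))
    rwa [inv_div] at h2
  refine ⟨h1, fun σ => ?_⟩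
  refine ((h.hasDerivAt _).comp σ (h1 σ)).congr_deriv ?_
  have := h.pos (angleOf p q X σ)
  have := angWeight_pos hp (angleOf p q X σ)
  simp only [Function.comp]
  field_simp

theorem IsProfile.angleOf_add (hp : 1 < p) (hq : p - 1 < q) (h : IsProfile p q X) (σ : ℝ) (n : ℤ) :
    angleOf p q X (σ + n * travel p q X π) = angleOf p q X σ + n * π := by
  rw [← h.angleOf_travel hp hq (angleOf p q X σ + n * π), h.travel_add_int_mul_pi hp hq,
    h.travel_angleOf hp hq]

theorem IsProfile.periodic_wave (hp : 1 < p) (hq : p - 1 < q) (h : IsProfile p q X) :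
    Function.Periodic (wave p q X) (2 * travel p q X π) := by
  intro σ
  have h1 := h.angleOf_add hp hq σ 2
  have h2 : ∀ θ, X (θ + 2 * π) = X θ := fun θ => by
    rw [show θ + 2 * π = (θ + π) + π by ring, h.periodic, h.periodic]
  push_cast at h1
  unfold wave ofPolar
  simp only [Function.comp]
  rw [h1, h2, sin_add_two_pi]

/-- A period carries the upward zero at time `0` to another upward zero, whose angle must be a
multiple of `2 π`. -/
theorem IsProfile.eq_of_periodic (hp : 1 < p) (hq : p - 1 < q) (h : IsProfile p q X) {t : ℝ}
    (ht : 0 < t) (hper : Function.Periodic (wave p q X) t) :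
    ∃ j : ℕ, 0 < j ∧ t = j * (2 * travel p q X π) := by
  have hb := betaQ_pos hp hq
  have hT := h.travel_pi_pos hp hq
  have hP := h.isPolar hp hq
  have h0 : angleOf p q X 0 = 0 := by
    have := h.angleOf_travel hp hq 0
    rwa [travel_zero] at this
  have hd : deriv (wave p q X) t = deriv (wave p q X) 0 := by
    have : wave p q X = fun s => wave p q X (s + t) := funext fun s => (hper s).symm
    conv_rhs => rw [this, deriv_comp_add_const, zero_add]
  have hv : wave p q X t = wave p q X 0 := by simpa using hper 0
  have hv' : sin (angleOf p q X t) = 0 := by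
    unfold wave ofPolar at hv
    rw [h0, sin_zero, mul_zero, zero_div, div_eq_zero_iff, mul_eq_zero] at hv
    rcases hv with (hv | hv) | hv
    · exact absurd hv (radius_pos _ _ _).ne'
    · exact hv
    · exact absurd hv hb.ne'
  -- The sign of the derivative excludes the downward zeros, that is, the odd multiples of `π`.
  have hc : 0 < cos (angleOf p q X t) := by
    unfold wave at hd
    rw [hP.deriv_eq hp hq] at hd
    simp only [] at hd
    rw [h0, cos_zero, mul_one] at hd
    have := radius_pos p q ((X ∘ angleOf p q X) 0)
    rw [← hd] at this
    exact (pos_iff_pos_of_mul_pos this).1 (radius_pos _ _ _)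
  have hc1 : cos (angleOf p q X t) = 1 := by
    have := sin_sq_add_cos_sq (angleOf p q X t)
    rw [hv'] at this
    nlinarith
  obtain ⟨n, hn⟩ := (cos_eq_one_iff _).1 hc1
  have h3 : t = n * (2 * travel p q X π) := by
    have h4 := h.travel_add_int_mul_pi hp hq 0 (2 * n)
    rw [travel_zero, zero_add, zero_add] at h4
    rw [← h.travel_angleOf hp hq t, ← hn]
    push_cast at h4
    rw [show (n : ℝ) * (2 * π) = 2 * n * π by ring, h4]; ring
  have hn0 : 0 < n := by
    by_contra hneg
    have : (n : ℝ) ≤ 0 := by exact_mod_cast not_lt.1 hneg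
    nlinarith
  refine ⟨n.toNat, by omega, ?_⟩
  rw [h3]
  congr 1
  exact_mod_cast (Int.toNat_of_nonneg hn0.le).symm

theorem IsProfile.hasLeastPeriod_wave (hp : 1 < p) (hq : p - 1 < q) (h : IsProfile p q X) :
    HasLeastPeriod (wave p q X) (2 * travel p q X π) := by
  have hT := h.travel_pi_pos hp hq
  refine ⟨⟨by positivity, h.periodic_wave hp hq⟩, fun t ht => ?_⟩
  obtain ⟨j, hj, rfl⟩ := h.eq_of_periodic hp hq ht.1 ht.2
  have : (1 : ℝ) ≤ j := by exact_mod_cast hj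
  nlinarith

theorem IsProfile.exists_wave_pos (hp : 1 < p) (hq : p - 1 < q) (h : IsProfile p q X) :
    ∃ σ, 0 < wave p q X σ := by
  refine ⟨travel p q X (π / 2), ?_⟩
  unfold wave ofPolar
  rw [h.angleOf_travel hp hq, sin_pi_div_two, mul_one]
  exact div_pos (radius_pos _ _ _) (betaQ_pos hp hq)

theorem IsProfile.exists_wave_neg (hp : 1 < p) (hq : p - 1 < q) (h : IsProfile p q X) :
    ∃ σ, wave p q X σ < 0 := by
  refine ⟨travel p q X (-(π / 2)), ?_⟩
  unfold wave ofPolar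
  rw [h.angleOf_travel hp hq, sin_neg, sin_pi_div_two]
  have := div_pos (radius_pos p q ((X ∘ angleOf p q X) (travel p q X (-(π / 2)))))
    (betaQ_pos hp hq)
  rw [mul_neg, mul_one, neg_div]
  linarith

theorem IsProfile.wave_mem (hp : 1 < p) (hq : p - 1 < q) (h : IsProfile p q X) {k : ℕ}
    (hk : travel p q X π * k = π) (ψ : ℝ) :
    (fun σ => wave p q X (σ + ψ)) ∈ signChangingSolutions p q 0 := by
  have hper : Function.Periodic (wave p q X) (2 * π) := by
    have h1 := (h.periodic_wave hp hq).nat_mul k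
    rwa [show (k : ℝ) * (2 * travel p q X π) = 2 * π by linear_combination 2 * hk] at h1
  have hs := (h.isPolar hp hq).isSolution hp hq hper
  change IsSolution p q 0 (wave p q X) at hs
  have hd : deriv (fun σ => wave p q X (σ + ψ)) = fun σ => deriv (wave p q X) (σ + ψ) :=
    funext fun σ => deriv_comp_add_const ..
  have hw : weight p q (fun σ => wave p q X (σ + ψ)) = fun σ => weight p q (wave p q X) (σ + ψ) := by
    funext σ; unfold weight; rw [hd]
  have hf : flux p q (fun σ => wave p q X (σ + ψ)) = fun σ => flux p q (wave p q X) (σ + ψ) := by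
    funext σ; unfold flux; rw [hd, hw]
  obtain ⟨a, ha⟩ := h.exists_wave_neg hp hq
  obtain ⟨b, hb⟩ := h.exists_wave_pos hp hq
  refine ⟨⟨?_, ?_, ?_, ?_⟩, ⟨a - ψ, by simpa using ha⟩, ⟨b - ψ, by simpa using hb⟩⟩
  · exact hs.contDiff.comp (contDiff_id.add contDiff_const)
  · intro σ
    have := hs.periodic (σ + ψ)
    simp only []
    rw [← this]; congr 1; ring
  · rw [hf]; exact hs.differentiable_flux.comp (by fun_prop)
  · intro σ
    rw [hf, hw, deriv_comp_add_const]
    exact hs.equation (σ + ψ)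

/-- Starting at a zero, the solution lies over the profile through that phase point. There `travel
(θ σ) - σ` is constant, so the solution is a translate of the wave. Its period `2 π` is then a
multiple of the least period. -/
theorem exists_eq_wave (hp : 1 < p) (hq : p - 1 < q) {f : ℝ → ℝ}
    (hf : f ∈ signChangingSolutions p q 0) :
    ∃ X : ℝ → ℝ, IsProfile p q X ∧ (∃ ψ, f = fun σ => wave p q X (σ + ψ)) ∧
      ∃ k : ℕ, 0 < k ∧ travel p q X π * k = π := by
  obtain ⟨hs, ⟨a, ha⟩, ⟨b, hb⟩⟩ := hf
  obtain ⟨σ₀, hσ₀⟩ := mem_range_of_exists_le_of_exists_ge (c := (0 : ℝ)) hs.contDiff.continuous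
    ⟨a, ha.le⟩ ⟨b, hb.le⟩
  obtain ⟨θ, x, hP, hfeq, hθ⟩ := hs.exists_polar hp hq hb.ne' hσ₀
  obtain ⟨X, hX0, hX⟩ := exists_isProfile hp hq (x σ₀)
  have hxX : ∀ σ, x σ = X (θ σ) := hP.radial_eq hp hq hX (a := σ₀) (by
    rcases hθ with h | h
    · rw [h, hX0]
    · have := hX.periodic 0
      rw [zero_add] at this
      rw [h, this, hX0])
  have hβ := betaQ_pos hp hq
  have hd : ∀ σ, HasDerivAt (fun σ => travel p q X (θ σ) - σ) 0 σ := fun σ => by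
    have h1 := ((hX.hasDerivAt_travel hp hq (θ σ)).comp σ (hP.angle σ)).sub (hasDerivAt_id σ)
    refine h1.congr_deriv ?_
    rw [hxX]
    have := hX.pos (θ σ)
    have := angWeight_pos hp (θ σ)
    field_simp; ring
  set c := travel p q X (θ 0) with hc
  have hθe : ∀ σ, θ σ = angleOf p q X (σ + c) := fun σ => by
    have h3 := is_const_of_deriv_eq_zero (fun s => (hd s).differentiableAt)
      (fun s => (hd s).deriv) σ 0
    rw [← hX.angleOf_travel hp hq (θ σ)]
    congr 1; linarith
  have hfw : f = fun σ => wave p q X (σ + c) := by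
    rw [hfeq]; funext σ
    unfold wave ofPolar
    simp only [Function.comp]
    rw [hxX, hθe]
  refine ⟨X, hX, ⟨c, hfw⟩, ?_⟩
  have hper : Function.Periodic (wave p q X) (2 * π) := by
    intro σ
    have h4 := hs.periodic (σ - c)
    rw [hfw] at h4
    simp only [] at h4
    rw [show σ - c + 2 * π + c = σ + 2 * π by ring, sub_add_cancel] at h4
    exact h4
  obtain ⟨j, hj, h5⟩ := hX.eq_of_periodic hp hq (by positivity) hper
  exact ⟨j, hj, by linarith⟩

end profile

/-! ### Monotonicity of the half period and its small-amplitude limit -/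

theorem angWeight_le {p : ℝ} (hp : 1 < p) (θ : ℝ) : angWeight p θ ≤ p := by
  unfold angWeight
  nlinarith [sin_sq_add_cos_sq θ, sq_nonneg (sin θ), sq_nonneg (cos θ)]

theorem angNum_mono (p q θ : ℝ) {x y : ℝ} (h : x ≤ y) : angNum p q θ x ≤ angNum p q θ y := by
  unfold angNum; gcongr

theorem angLin_le_angNum (p q θ x : ℝ) : angLin p q θ ≤ angNum p q θ x := by
  unfold angNum
  have : 0 ≤ exp x * |sin θ| ^ (q + 1) := by positivity
  linarith

theorem radNum_le {p q t : ℝ} (hq : p - 1 < q) (ht : t ∈ Icc 0 (π / 2)) (x : ℝ) :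
    radNum p q t x ≤ (q + 1 - p) * |betaQ p q ^ 2 - lambdaQ p q| := by
  have hk : 0 < q + 1 - p := by linarith
  have hs : 0 ≤ sin t := sin_nonneg_of_nonneg_of_le_pi ht.1 (by linarith [ht.2, pi_pos])
  have hc : 0 ≤ cos t := cos_nonneg_of_mem_Icc ⟨by linarith [ht.1, pi_pos], ht.2⟩
  unfold radNum
  set a := betaQ p q ^ 2 - lambdaQ p q
  have h2 : a * sin t - exp x * (|sin t| ^ (q - 1) * sin t) ≤ |a| := by
    have : 0 ≤ exp x * (|sin t| ^ (q - 1) * sin t) := by positivity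
    have h3 : a * sin t ≤ |a| :=
      (mul_le_mul_of_nonneg_right (le_abs_self a) hs).trans
        (mul_le_of_le_one_right (abs_nonneg _) (sin_le_one t))
    linarith
  exact (mul_le_mul_of_nonneg_left h2 (by positivity)).trans
    (mul_le_mul_of_nonneg_right (mul_le_of_le_one_right hk.le (cos_le_one t)) (abs_nonneg _))

section profile

variable {p q : ℝ} {X Y : ℝ → ℝ}

theorem IsProfile.travel_pi (hp : 1 < p) (hq : p - 1 < q) (h : IsProfile p q X) :
    travel p q X π = 2 * travel p q X (π / 2) := by
  have h1 : ∀ θ, HasDerivAt (fun θ => travel p q X (-θ) + travel p q X θ) 0 θ := fun θ => by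
    have h2 := ((h.hasDerivAt_travel hp hq (-θ)).comp θ (hasDerivAt_neg θ)).add
      (h.hasDerivAt_travel hp hq θ)
    refine h2.congr_deriv ?_
    rw [h.even]
    unfold angWeight angNum angLin
    simp
  have h3 := is_const_of_deriv_eq_zero (fun s => (h1 s).differentiableAt)
    (fun s => (h1 s).deriv) (π / 2) 0
  simp only [neg_zero, travel_zero, add_zero] at h3
  have h4 := h.travel_add_pi hp hq (-(π / 2))
  rw [show -(π / 2) + π = π / 2 by ring] at h4
  linarith

theorem IsProfile.travel_lt_travel (hp : 1 < p) (hq : p - 1 < q) (hX : IsProfile p q X)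
    (hY : IsProfile p q Y) (h : X 0 < Y 0) : travel p q Y π < travel p q X π := by
  have hb := betaQ_pos hp hq
  have hle : ∀ θ, angNum p q θ (X θ) ≤ angNum p q θ (Y θ) := fun θ =>
    angNum_mono _ _ _ (hX.lt_of_lt (by linarith) hY h θ).le
  refine intervalIntegral.integral_lt_integral_of_continuousOn_of_le_of_exists_lt pi_pos
    (hY.continuous_inv_speed hp hq).continuousOn (hX.continuous_inv_speed hp hq).continuousOn
    (fun θ _ => ?_) ⟨π / 2, ⟨by positivity, by linarith [pi_pos]⟩, ?_⟩
  · have := angWeight_pos hp θ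
    have := hX.pos θ
    have := hle θ
    gcongr
  · have := angWeight_pos hp (π / 2)
    have h1 := hX.pos (π / 2)
    have h2 : angNum p q (π / 2) (X (π / 2)) < angNum p q (π / 2) (Y (π / 2)) := by
      have := exp_lt_exp.2 (hX.lt_of_lt (by linarith) hY h (π / 2))
      unfold angNum
      simpa using this
    gcongr

/-- The nonlinear term only speeds up the rotation. The strictness of this bound is what excludes `k
= M_q`. -/
theorem IsProfile.travel_lt (hp : 1 < p) (hq : p - 1 < q) (hX : IsProfile p q X)
    (hl : 0 < lambdaQ p q) :
    travel p q X (π / 2) < ∫ t in (0 : ℝ)..π / 2, betaQ p q * angWeight p t / angLin p q t := by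
  have hb := betaQ_pos hp hq
  have hpos : ∀ θ, 0 < angLin p q θ := fun θ => by
    have h1 := sin_sq_add_cos_sq θ
    have h2 : 0 < (p - 1) * betaQ p q ^ 2 := mul_pos (by linarith) (by positivity)
    unfold angLin
    rcases eq_or_ne (sin θ) 0 with h0 | h0
    · rw [h0] at h1 ⊢
      have : cos θ ^ 2 = 1 := by linarith
      rw [this]; simpa using h2
    · positivity
  refine intervalIntegral.integral_lt_integral_of_continuousOn_of_le_of_exists_lt
    (by positivity)
    (hX.continuous_inv_speed hp hq).continuousOn
    (((continuous_const.mul (continuous_angWeight p)).div (continuous_angLin p q)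
      fun t => (hpos t).ne').continuousOn)
    (fun θ _ => ?_) ⟨π / 2, ⟨by positivity, le_rfl⟩, ?_⟩
  · have := angWeight_pos hp θ
    have := hpos θ
    have := angLin_le_angNum p q θ (X θ)
    gcongr
  · have := angWeight_pos hp (π / 2)
    have := hpos (π / 2)
    have : angLin p q (π / 2) < angNum p q (π / 2) (X (π / 2)) := by
      unfold angNum
      simpa using exp_pos _
    gcongr

/-- On `[0, θ₁]` the profile rises by at most a constant `C`, so the angular speed differs from its
linear part by at most `exp (X 0 + C)`, which is small for very negative `X 0`. -/
theorem exists_lt_travel (hp : 1 < p) (hq : p - 1 < q) {θ₁ n : ℝ} (hθ0 : 0 ≤ θ₁)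
    (hθ1 : θ₁ ≤ π / 2) (hn : 0 < n) (hnl : ∀ θ ∈ Icc 0 θ₁, n ≤ angLin p q θ) {ε : ℝ} (hε : 0 < ε) :
    ∃ x₀, ∀ X, IsProfile p q X → X 0 = x₀ →
      (∫ t in (0 : ℝ)..θ₁, betaQ p q * angWeight p t / angLin p q t) - ε < travel p q X θ₁ := by
  have hb := betaQ_pos hp hq
  have hk : 0 < q + 1 - p := by linarith
  have hq0 : 0 < q := by linarith
  set C := (q + 1 - p) * |betaQ p q ^ 2 - lambdaQ p q| / n * (π / 2)
  set D := betaQ p q * p / n ^ 2 * exp C * (π / 2) with hD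
  have hpi := pi_pos
  have hp0 : 0 < p := by linarith
  have hDpos : 0 < D := by positivity
  -- The total loss in the integral is at most `exp (X 0) * D`, which equals `ε / 2` for this
  -- initial value.
  refine ⟨log (ε / (2 * D)), fun X hX hX0 => ?_⟩
  have hexp : exp (X 0) * D < ε := by
    rw [hX0, exp_log (by positivity)]
    field_simp; linarith
  have hXle : ∀ θ ∈ Icc 0 θ₁, X θ ≤ X 0 + C := by
    intro θ hθ
    have := sub_le_of_deriv_le (X := X) (X' := fun θ => radNum p q θ (X θ) / angNum p q θ (X θ))
      (T := θ₁) (B := (q + 1 - p) * |betaQ p q ^ 2 - lambdaQ p q| / n)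
      (fun t _ => (hX.hasDerivAt t).hasDerivWithinAt) le_rfl hθ.1 hθ.2 (fun r hr => by
        have hr1 : r ∈ Icc 0 θ₁ := ⟨hr.1, hr.2.trans hθ.2⟩
        have h1 := radNum_le hq ⟨hr1.1, hr1.2.trans hθ1⟩ (X r)
        have h2 := (hnl r hr1).trans (angLin_le_angNum p q r (X r))
        have := hX.pos r
        calc _ ≤ (q + 1 - p) * |betaQ p q ^ 2 - lambdaQ p q| / angNum p q r (X r) := by gcongr
          _ ≤ _ := by gcongr)
    have h2 : (q + 1 - p) * |betaQ p q ^ 2 - lambdaQ p q| / n * (θ - 0) ≤ C := by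
      have := hθ.2.trans hθ1
      simp only [C]
      gcongr; linarith
    linarith
  have hc1 : ContinuousOn (fun t => betaQ p q * angWeight p t / angLin p q t) (uIcc 0 θ₁) := by
    rw [uIcc_of_le hθ0]
    exact ((continuous_const.mul (continuous_angWeight p)).continuousOn).div
      (continuous_angLin p q).continuousOn fun t ht => (hn.trans_le (hnl t ht)).ne'
  have hc2 := (hX.continuous_inv_speed hp hq).intervalIntegrable
    (μ := MeasureTheory.volume) 0 θ₁
  have hmono := intervalIntegral.integral_mono_on (μ := MeasureTheory.volume) hθ0
    (hc1.intervalIntegrable.sub (intervalIntegrable_const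
      (c := betaQ p q * p / n ^ 2 * exp C * exp (X 0)))) hc2 (fun t ht => by
      have h1 := hnl t ht
      have h2 := angLin_le_angNum p q t (X t)
      have hL : 0 < angLin p q t := hn.trans_le h1
      have hA := hX.pos t
      have hW := angWeight_pos hp t
      have h3 : angNum p q t (X t) - angLin p q t ≤ exp C * exp (X 0) := by
        have : |sin t| ^ (q + 1) ≤ 1 :=
          rpow_le_one (abs_nonneg _) (abs_sin_le_one t) (by linarith)
        unfold angNum
        rw [← exp_add, add_sub_cancel_left]
        calc exp (X t) * |sin t| ^ (q + 1) ≤ exp (X t) * 1 := by gcongr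
          _ ≤ exp (C + X 0) := by rw [mul_one]; exact exp_le_exp.2 (by linarith [hXle t ht])
      have h4 : betaQ p q * angWeight p t / angLin p q t
          - betaQ p q * angWeight p t / angNum p q t (X t)
          = betaQ p q * angWeight p t * (angNum p q t (X t) - angLin p q t)
            / (angLin p q t * angNum p q t (X t)) := by field_simp
      have h5 : betaQ p q * angWeight p t * (angNum p q t (X t) - angLin p q t)
            / (angLin p q t * angNum p q t (X t))
          ≤ betaQ p q * p * (exp C * exp (X 0)) / (n * n) := by
        have := angWeight_le hp t
        have := h1.trans h2
        have : 0 ≤ angNum p q t (X t) - angLin p q t := by linarith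
        gcongr
      have h6 : betaQ p q * p * (exp C * exp (X 0)) / (n * n)
        = betaQ p q * p / n ^ 2 * exp C * exp (X 0) := by field_simp
      linarith)
  rw [intervalIntegral.integral_sub hc1.intervalIntegrable (by simp),
    intervalIntegral.integral_const, smul_eq_mul, sub_zero] at hmono
  have h7 : θ₁ * (betaQ p q * p / n ^ 2 * exp C * exp (X 0)) ≤ exp (X 0) * D := by
    have : exp (X 0) * D = π / 2 * (betaQ p q * p / n ^ 2 * exp C * exp (X 0)) := by
      rw [hD]; ring
    rw [this]; gcongr
  change _ ≤ travel p q X θ₁ at hmono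
  linarith

/-- For `λ ≤ 0` the linear speed has a first zero `z` in `(0, π/2]` and is at most `C (z - r)`
before it, so the travel time diverges at least logarithmically as `θ₁ → z`. -/
theorem exists_lt_integral (hp : 1 < p) (hq : p - 1 < q) (hl : lambdaQ p q ≤ 0) (t : ℝ) :
    ∃ θ₁ n : ℝ, 0 ≤ θ₁ ∧ θ₁ ≤ π / 2 ∧ 0 < n ∧ (∀ θ ∈ Icc 0 θ₁, n ≤ angLin p q θ) ∧
      t < ∫ t in (0 : ℝ)..θ₁, betaQ p q * angWeight p t / angLin p q t := by
  have hb := betaQ_pos hp hq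
  have hpi := pi_pos
  have hcl := continuous_angLin p q
  have hN0 : 0 < angLin p q 0 := by
    have : 0 < p - 1 := by linarith
    simp [angLin]; positivity
  have hNpi : angLin p q (π / 2) ≤ 0 := by simpa [angLin] using hl
  have hc : IsCompact (Icc 0 (π / 2) ∩ angLin p q ⁻¹' Iic 0) :=
    isCompact_Icc.inter_right (isClosed_Iic.preimage hcl)
  obtain ⟨z, ⟨hz, hNz⟩, hmin⟩ := hc.exists_isLeast ⟨π / 2, ⟨by positivity, le_rfl⟩, hNpi⟩
  have hNz : angLin p q z ≤ 0 := hNz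
  have hz0 : 0 < z := lt_of_le_of_ne hz.1 fun h => by rw [← h] at hNz; linarith
  have hpos : ∀ r ∈ Ico 0 z, 0 < angLin p q r := by
    intro r hr
    by_contra hr'
    exact absurd (hmin ⟨⟨hr.1, hr.2.le.trans hz.2⟩, not_lt.1 hr'⟩) (not_le.2 hr.2)
  set C := 2 * |lambdaQ p q - (p - 1) * betaQ p q ^ 2| + 1 with hC
  have hCpos : 0 < C := by positivity
  have hNle : ∀ r ∈ Icc 0 z, angLin p q r ≤ C * (z - r) := by
    intro r hr
    have := le_sub_of_le_deriv (X := angLin p q) (T := z) (B := -C)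
      (fun t _ => (hasDerivAt_angLin p q t).hasDerivWithinAt) hr.1 hr.2 le_rfl (fun s _ => by
        have : |cos s * (2 * (lambdaQ p q - (p - 1) * betaQ p q ^ 2) * sin s)| ≤ C := by
          rw [abs_mul, abs_mul, abs_mul, abs_two]
          have h1 := abs_cos_le_one s
          have h2 := abs_sin_le_one s
          have h3 := abs_nonneg (lambdaQ p q - (p - 1) * betaQ p q ^ 2)
          calc |cos s| * (2 * |lambdaQ p q - (p - 1) * betaQ p q ^ 2| * |sin s|)
              ≤ 1 * (2 * |lambdaQ p q - (p - 1) * betaQ p q ^ 2| * 1) := by gcongr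
            _ ≤ C := by rw [hC]; linarith
        exact neg_le_of_abs_le this)
    linarith
  set m := min 1 (p - 1) with hm
  have hmpos : 0 < m := lt_min one_pos (by linarith)
  have hmW : ∀ θ, m ≤ angWeight p θ := fun θ => by
    have h1 : m ≤ 1 := min_le_left _ _
    have h2 : m ≤ p - 1 := min_le_right _ _
    have h3 := sin_sq_add_cos_sq θ
    unfold angWeight
    nlinarith [sq_nonneg (sin θ), sq_nonneg (cos θ)]
  set K := betaQ p q * m / C with hK
  have hKpos : 0 < K := by positivity
  -- With `z - θ₁ = z exp (-s)` the comparison integral of `K / (z - r)` is `K s = |t| + 1`, which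
  -- exceeds `t`.
  set s := (|t| + 1) / K with hs
  have hspos : 0 < s := by positivity
  set θ₁ := z * (1 - exp (-s)) with hθ₁
  have he1 : exp (-s) < 1 := exp_lt_one_iff.2 (by linarith)
  have he0 := exp_pos (-s)
  have hθ0 : 0 ≤ θ₁ := mul_nonneg hz.1 (by linarith)
  have hθz : θ₁ < z := by rw [hθ₁]; nlinarith
  obtain ⟨w, hw, hwmin⟩ := (isCompact_Icc (a := (0 : ℝ)) (b := θ₁)).exists_isMinOn
    (nonempty_Icc.2 hθ0) hcl.continuousOn
  have hpos1 : ∀ r ∈ Icc 0 θ₁, 0 < angLin p q r := fun r hr => hpos r ⟨hr.1, hr.2.trans_lt hθz⟩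
  refine ⟨θ₁, angLin p q w, hθ0, hθz.le.trans hz.2, hpos1 w hw, fun θ hθ => hwmin hθ, ?_⟩
  have hc1 : ContinuousOn (fun t => betaQ p q * angWeight p t / angLin p q t) (uIcc 0 θ₁) := by
    rw [uIcc_of_le hθ0]
    exact ((continuous_const.mul (continuous_angWeight p)).continuousOn).div
      (continuous_angLin p q).continuousOn fun t ht => (hpos1 t ht).ne'
  have hc2 : ContinuousOn (fun t => K * (z - t)⁻¹) (uIcc 0 θ₁) := by
    rw [uIcc_of_le hθ0]
    refine continuousOn_const.mul (ContinuousOn.inv₀ (by fun_prop) fun t ht => ?_)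
    have := ht.2
    linarith
  have hint : ∫ t in (0 : ℝ)..θ₁, K * (z - t)⁻¹ = |t| + 1 := by
    have hd : ∀ r ∈ uIcc 0 θ₁, HasDerivAt (fun r => -(K * log (z - r))) (K * (z - r)⁻¹) r := by
      intro r hr
      rw [uIcc_of_le hθ0] at hr
      have h1 := (((hasDerivAt_id r).const_sub z).log (by have := hr.2; simp; linarith)).const_mul K
      refine h1.neg.congr_deriv ?_
      simp [div_eq_mul_inv]
    rw [intervalIntegral.integral_eq_sub_of_hasDerivAt hd hc2.intervalIntegrable]
    have : z - θ₁ = z * exp (-s) := by rw [hθ₁]; ring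
    rw [this, sub_zero, log_mul hz0.ne' he0.ne', log_exp]
    have : K * s = |t| + 1 := by rw [hs]; field_simp
    linear_combination this
  have hmono := intervalIntegral.integral_mono_on (μ := MeasureTheory.volume) hθ0
    hc2.intervalIntegrable hc1.intervalIntegrable (fun r hr => by
      have h1 := hpos1 r hr
      have h2 := hNle r ⟨hr.1, hr.2.trans hθz.le⟩
      have h3 := hmW r
      have h4 : 0 < z - r := by linarith [hr.2]
      calc K * (z - r)⁻¹ = betaQ p q * m / (C * (z - r)) := by rw [hK]; field_simp
        _ ≤ betaQ p q * angWeight p r / angLin p q r := by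
          have := angWeight_pos hp r
          gcongr)
  rw [hint] at hmono
  linarith [le_abs_self t]

end profile

/-! ### The large-amplitude limit of the half period -/

section profile

variable {p q : ℝ} {X Y : ℝ → ℝ}

/-- Along a solution `|ω|` increases up to its maximum. -/
theorem IsProfile.monotoneOn_log (hp : 1 < p) (hq : p - 1 < q) (h : IsProfile p q X) :
    MonotoneOn (fun θ => X θ + (q + 1 - p) * log (sin θ)) (Ioc 0 (π / 2)) := by
  have hk : 0 < q + 1 - p := by linarith
  have hq0 : 0 < q := by linarith
  have hpi := pi_pos
  have hs : ∀ t ∈ Ioc 0 (π / 2), 0 < sin t := fun t ht =>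
    sin_pos_of_pos_of_lt_pi ht.1 (by linarith [ht.2])
  have hd : ∀ t ∈ Ioc 0 (π / 2), HasDerivAt (fun θ => X θ + (q + 1 - p) * log (sin θ))
      (radNum p q t (X t) / angNum p q t (X t) + (q + 1 - p) * (cos t / sin t)) t := fun t ht =>
    (h.hasDerivAt t).add (((hasDerivAt_sin t).log (hs t ht).ne').const_mul _)
  refine monotoneOn_of_hasDerivWithinAt_nonneg (convex_Ioc _ _)
    (fun t ht => (hd t ht).continuousAt.continuousWithinAt)
    (fun t ht => (hd t (interior_subset ht)).hasDerivWithinAt) (fun t ht => ?_)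
  have ht := interior_subset ht
  have hst := hs t ht
  have hc : 0 ≤ cos t := cos_nonneg_of_mem_Icc ⟨by linarith [ht.1], ht.2⟩
  have hA := h.pos t
  have hW := angWeight_pos hp t
  have hb := betaQ_pos hp hq
  have key : radNum p q t (X t) / angNum p q t (X t) + (q + 1 - p) * (cos t / sin t)
      = (q + 1 - p) * cos t * (betaQ p q ^ 2 * angWeight p t) / (sin t * angNum p q t (X t)) := by
    have h2 := angLin_add p q t
    have h3 : angNum p q t (X t) = angLin p q t
      + exp (X t) * (|sin t| ^ (q - 1) * sin t * sin t) := by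
      unfold angNum; rw [abs_rpow_mul_self hq0]
    unfold radNum
    field_simp
    rw [h3]
    linear_combination cos t * h2
  rw [key]
  positivity

/-- A short initial sector, where the linear speed is at least `n`, costs little time. Beyond it
`|ω|` is at least its value at `θ₁`, which is huge when `X 0` is, so the nonlinear term makes the
speed at least `B`. -/
theorem exists_travel_lt (hp : 1 < p) (hq : p - 1 < q) {ε : ℝ} (hε : 0 < ε) :
    ∃ x₀, ∀ X, IsProfile p q X → X 0 = x₀ → travel p q X π < ε := by
  have hb := betaQ_pos hp hq
  have hk : 0 < q + 1 - p := by linarith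
  have hq0 : 0 < q := by linarith
  have hp0 : 0 < p := by linarith
  have hpi := pi_pos
  obtain ⟨θ₂, n, hθ0, hθ2, hn, hnl, -⟩ := exists_angLin_lower hp hq
  set κ := q + 1 - p with hκ
  set θ₁ := min θ₂ (ε * n / (8 * (betaQ p q * p))) with hθ₁
  have h10 : 0 < θ₁ := lt_min hθ0 (by positivity)
  have h12 : θ₁ ≤ π / 2 := (min_le_left _ _).trans hθ2
  have h1l : ∀ θ ∈ Icc 0 θ₁, n ≤ angLin p q θ := fun θ hθ =>
    hnl θ ⟨hθ.1, hθ.2.trans (min_le_left _ _)⟩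
  set s₁ := sin θ₁ with hs₁
  have hs1 : 0 < s₁ := sin_pos_of_pos_of_lt_pi h10 (by linarith)
  -- `θ₁` and `B` give each of the two pieces of the quarter turn a time of at most `ε / 8`; `H` is
  -- the value of `X + κ log sin` at `θ₁` from which the speed exceeds `B`, even after subtracting
  -- `|λ|`.
  set B := 4 * (betaQ p q * p) * π / ε with hB
  have hBpos : 0 < B := by positivity
  set H := log ((B + |lambdaQ p q|) / s₁ ^ p) with hH
  have hHexp : exp H * s₁ ^ p = B + |lambdaQ p q| := by
    have := rpow_pos_of_pos hs1 p
    rw [hH, exp_log (by positivity)]; field_simp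
  set a := betaQ p q ^ 2 - lambdaQ p q with ha
  refine ⟨H - κ * log s₁ + κ * (|a| + exp H) / n * (π / 2) + 1, fun X hX hX0 => ?_⟩
  have hmono := hX.monotoneOn_log hp hq
  have h1mem : θ₁ ∈ Ioc 0 (π / 2) := ⟨h10, h12⟩
  have hgt : H < X θ₁ + κ * log s₁ := by
    by_contra hcon
    have hcon := not_lt.1 hcon
    have := le_sub_of_le_deriv (X := X) (X' := fun θ => radNum p q θ (X θ) / angNum p q θ (X θ))
      (T := θ₁) (B := -(κ * (|a| + exp H) / n))
      (fun t _ => (hX.hasDerivAt t).hasDerivWithinAt) le_rfl h10.le le_rfl (fun r hr => by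
        have hd := (h1l r hr).trans (angLin_le_angNum p q r (X r))
        -- If `X + κ log sin` were at most `H` at `θ₁`, monotonicity would bound it on all of `(0,
        -- θ₁]`. As `κ ≤ q`, this bounds the reaction term and hence the descent of `X`, which
        -- contradicts the size of `X 0`.
        have hg : exp (X r) * |(|sin r| ^ (q - 1) * sin r)| ≤ exp H := by
          rcases hr.1.eq_or_lt with h0 | h0
          · rw [← h0]; simp; exact (exp_pos _).le
          · have hrm : r ∈ Ioc 0 (π / 2) := ⟨h0, hr.2.trans h12⟩
            have hsr : 0 < sin r := sin_pos_of_pos_of_lt_pi h0 (by linarith [hrm.2])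
            have h2 := (hmono hrm h1mem hr.2).trans hcon
            simp only [] at h2
            rw [abs_of_pos (by have := abs_pos.2 hsr.ne'; positivity), abs_of_pos hsr,
              ← rpow_add_one hsr.ne']
            have h3 : sin r ^ (q - 1 + 1) ≤ sin r ^ κ :=
              rpow_le_rpow_of_exponent_ge hsr (sin_le_one r) (by rw [hκ]; linarith)
            calc exp (X r) * sin r ^ (q - 1 + 1) ≤ exp (X r) * sin r ^ κ := by gcongr
              _ = exp (X r + κ * log (sin r)) := by
                rw [exp_add, rpow_def_of_pos hsr, mul_comm (log _)]
              _ ≤ exp H := exp_le_exp.2 h2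
        have h4 : |radNum p q r (X r)| ≤ κ * (|a| + exp H) := by
          unfold radNum
          rw [← ha, ← hκ, mul_assoc, abs_mul, abs_of_pos hk, abs_mul]
          refine mul_le_mul_of_nonneg_left ?_ hk.le
          refine (mul_le_of_le_one_left (abs_nonneg _) (abs_cos_le_one r)).trans ?_
          refine (abs_sub _ _).trans (add_le_add ?_ ?_)
          · rw [abs_mul]
            exact mul_le_of_le_one_right (abs_nonneg _) (abs_sin_le_one r)
          · rw [abs_mul, abs_of_pos (exp_pos _)]; exact hg
        refine neg_le_of_abs_le ?_
        have := hX.pos r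
        rw [abs_div, abs_of_pos this]
        gcongr)
    have h5 : κ * (|a| + exp H) / n * (θ₁ - 0) ≤ κ * (|a| + exp H) / n * (π / 2) := by
      gcongr; linarith
    rw [hX0] at this
    linarith
  have hbig : ∀ θ ∈ Icc θ₁ (π / 2), B ≤ angNum p q θ (X θ) := by
    intro θ hθ
    have hθm : θ ∈ Ioc 0 (π / 2) := ⟨h10.trans_le hθ.1, hθ.2⟩
    have hsθ : 0 < sin θ := sin_pos_of_pos_of_lt_pi hθm.1 (by linarith [hθ.2])
    have hss : s₁ ≤ sin θ := sin_le_sin_of_le_of_le_pi_div_two (by linarith) hθ.2 hθ.1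
    have h2 : H ≤ X θ + κ * log (sin θ) := hgt.le.trans (hmono h1mem hθm hθ.1)
    have h3 : exp (X θ) * |sin θ| ^ (q + 1) = exp (X θ + κ * log (sin θ)) * sin θ ^ p := by
      rw [abs_of_pos hsθ, show q + 1 = κ + p by rw [hκ]; ring, rpow_add hsθ, exp_add,
        rpow_def_of_pos hsθ κ, mul_comm (log _) κ]; ring
    have h4 : exp H * s₁ ^ p ≤ exp (X θ) * |sin θ| ^ (q + 1) := by
      rw [h3]; gcongr
    have h5 : -|lambdaQ p q| ≤ angLin p q θ := by
      have h6 : 0 ≤ (p - 1) * betaQ p q ^ 2 * cos θ ^ 2 := by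
        have : 0 ≤ p - 1 := by linarith
        positivity
      have h7 : |lambdaQ p q * sin θ ^ 2| ≤ |lambdaQ p q| := by
        rw [abs_mul, abs_of_nonneg (sq_nonneg (sin θ))]
        refine mul_le_of_le_one_right (abs_nonneg _) ?_
        nlinarith [sin_sq_add_cos_sq θ, sq_nonneg (cos θ)]
      have := neg_le_of_abs_le h7
      unfold angLin; linarith
    unfold angNum
    linarith
  have hi := hX.continuous_inv_speed hp hq
  have e1 : ∫ t in (0 : ℝ)..θ₁, betaQ p q * angWeight p t / angNum p q t (X t)
      ≤ ∫ t in (0 : ℝ)..θ₁, betaQ p q * p / n :=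
    intervalIntegral.integral_mono_on h10.le (hi.intervalIntegrable _ _)
      (intervalIntegrable_const) (fun t ht => by
        have h2 := (h1l t ht).trans (angLin_le_angNum p q t (X t))
        have := angWeight_le hp t
        gcongr)
  have e2 : ∫ t in θ₁..π / 2, betaQ p q * angWeight p t / angNum p q t (X t)
      ≤ ∫ t in θ₁..π / 2, betaQ p q * p / B :=
    intervalIntegral.integral_mono_on h12 (hi.intervalIntegrable _ _)
      (intervalIntegrable_const) (fun t ht => by
        have h2 := hbig t ht
        have := angWeight_le hp t
        gcongr)
  rw [intervalIntegral.integral_const, smul_eq_mul] at e1 e2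
  have e3 : travel p q X (π / 2) = _ := (intervalIntegral.integral_add_adjacent_intervals
    (hi.intervalIntegrable (μ := MeasureTheory.volume) 0 θ₁)
    (hi.intervalIntegrable θ₁ (π / 2))).symm
  have e4 : (θ₁ - 0) * (betaQ p q * p / n) ≤ ε / 8 := by
    have := min_le_right θ₂ (ε * n / (8 * (betaQ p q * p)))
    calc (θ₁ - 0) * (betaQ p q * p / n)
        ≤ (ε * n / (8 * (betaQ p q * p))) * (betaQ p q * p / n) := by
          rw [sub_zero]; gcongr
      _ = ε / 8 := by field_simp
  have e5 : (π / 2 - θ₁) * (betaQ p q * p / B) ≤ ε / 8 := by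
    calc (π / 2 - θ₁) * (betaQ p q * p / B) ≤ (π / 2) * (betaQ p q * p / B) := by
          gcongr; linarith
      _ = ε / 8 := by rw [hB]; field_simp; norm_num
  rw [hX.travel_pi hp hq, e3]
  linarith

/-! ### Continuity of the half period in the initial value -/

theorem IsProfile.le_of_le (hq : 0 < q) (hX : IsProfile p q X)
    (hY : IsProfile p q Y) (h : X 0 ≤ Y 0) (θ : ℝ) : X θ ≤ Y θ := by
  rcases h.lt_or_eq with h | h
  · exact (hX.lt_of_lt hq hY h θ).le
  · exact (hX.eq_of_eq hq hY h θ).le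

theorem continuousAt_profile (hq : 0 < q) {X : ℝ → ℝ → ℝ}
    (hX0 : ∀ x, X x 0 = x) (hX : ∀ x, IsProfile p q (X x)) (x₀ θ : ℝ) :
    0 ≤ θ → ContinuousAt (fun x => X x θ) x₀ := by
  intro hθ
  have hm := (hX (x₀ - 1)).continuous
  have hM := (hX (x₀ + 1)).continuous
  have hcA := continuous_angNum_comp (p := p) hq hm
  -- The profiles starting at `x₀ - 1` and `x₀ + 1` enclose all the nearby ones, so they provide one
  -- Grönwall constant valid for every `x` in this window.
  set K₀ : ℝ → ℝ := fun s => |crossFactor p q s| / angNum p q s (X (x₀ - 1) s) ^ 2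
    * (2 * exp (X (x₀ + 1) s)) with hK₀
  have hK₀c : Continuous K₀ := by
    refine Continuous.mul ((continuous_crossFactor hq).abs.div (hcA.pow 2) fun s => ?_)
      (by fun_prop)
    exact (pow_pos ((hX (x₀ - 1)).pos s) 2).ne'
  obtain ⟨K, hK⟩ := (isCompact_Icc (a := (0 : ℝ)) (b := θ)).bddAbove_image hK₀c.continuousOn
  have hbound : ∀ x ∈ Icc (x₀ - 1) (x₀ + 1), |X x θ - X x₀ θ| ≤ |x - x₀| * exp (K * θ) := by
    intro x hx
    have h1 := norm_le_gronwallBound_of_norm_deriv_right_le (f := fun s => X x s - X x₀ s)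
      (f' := fun s => crossFactor p q s / (angNum p q s (X x s) * angNum p q s (X x₀ s))
        * (exp (X x s) - exp (X x₀ s))) (δ := |x - x₀|) (K := K) (ε := 0) (a := 0) (b := θ)
      (((hX x).continuous.sub (hX x₀).continuous).continuousOn)
      (fun s _ => ((((hX x).hasDerivAt s).sub ((hX x₀).hasDerivAt s)).congr_deriv
        ((hX x).slope_sub hq (hX x₀) s)).hasDerivWithinAt)
      (by simp [hX0]) (fun s hs => by
        have hA := (hX (x₀ - 1)).pos s
        have hle : ∀ y ∈ Icc (x₀ - 1) (x₀ + 1), X (x₀ - 1) s ≤ X y s ∧ X y s ≤ X (x₀ + 1) s :=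
          fun y hy => ⟨(hX _).le_of_le hq (hX _) (by rw [hX0, hX0]; exact hy.1) s,
            (hX _).le_of_le hq (hX _) (by rw [hX0, hX0]; exact hy.2) s⟩
        have hx1 := hle x hx
        have hx2 := hle x₀ ⟨by linarith, by linarith⟩
        have a1 := angNum_mono p q s hx1.1
        have a2 := angNum_mono p q s hx2.1
        have e1 := exp_le_exp.2 hx1.2
        have e2 := exp_le_exp.2 hx2.2
        have hKs : K₀ s ≤ K := hK ⟨s, ⟨hs.1, hs.2.le⟩, rfl⟩
        rw [norm_eq_abs, norm_eq_abs, add_zero, abs_mul, abs_div, abs_of_pos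
          (mul_pos ((hX x).pos s) ((hX x₀).pos s))]
        have e3 := abs_exp_sub_exp_le (X x s) (X x₀ s)
        have hAx := (hX x).pos s
        have hAx0 := (hX x₀).pos s
        calc |crossFactor p q s| / (angNum p q s (X x s) * angNum p q s (X x₀ s))
              * |exp (X x s) - exp (X x₀ s)|
            ≤ |crossFactor p q s| / (angNum p q s (X (x₀ - 1) s) * angNum p q s (X (x₀ - 1) s))
              * ((exp (X (x₀ + 1) s) + exp (X (x₀ + 1) s)) * |X x s - X x₀ s|) := by
              have e4 := e3.trans (mul_le_mul_of_nonneg_right (add_le_add e1 e2) (abs_nonneg _))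
              gcongr
          _ = K₀ s * |X x s - X x₀ s| := by simp only [hK₀]; ring
          _ ≤ K * |X x s - X x₀ s| := by gcongr) θ ⟨hθ, le_rfl⟩
    rw [gronwallBound_ε0, sub_zero] at h1
    exact h1
  rw [ContinuousAt, tendsto_iff_dist_tendsto_zero]
  refine squeeze_zero' (Eventually.of_forall fun _ => dist_nonneg) (g := fun x => |x - x₀| * exp (K * θ))
    ?_ ?_
  · filter_upwards [Icc_mem_nhds (show x₀ - 1 < x₀ by linarith) (show x₀ < x₀ + 1 by linarith)]
      with x hx
    exact hbound x hx
  · have : Continuous fun x => |x - x₀| * exp (K * θ) := by fun_prop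
    have := this.tendsto x₀
    simpa using this

/-- Dominated convergence: the slower profile starting at `x₀ - 1` majorizes the integrands. -/
theorem continuous_travel_profile (hp : 1 < p) (hq : p - 1 < q) {X : ℝ → ℝ → ℝ}
    (hX0 : ∀ x, X x 0 = x) (hX : ∀ x, IsProfile p q (X x)) :
    Continuous fun x => travel p q (X x) π := by
  have hq0 : 0 < q := by linarith
  have hb := betaQ_pos hp hq
  rw [continuous_iff_continuousAt]
  intro x₀
  refine intervalIntegral.continuousAt_of_dominated_interval
    (bound := fun t => betaQ p q * angWeight p t / angNum p q t (X (x₀ - 1) t)) ?_ ?_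
    (((hX _).continuous_inv_speed hp hq).intervalIntegrable _ _) ?_
  · exact Eventually.of_forall fun x =>
      ((hX x).continuous_inv_speed hp hq).aestronglyMeasurable
  · filter_upwards [lt_mem_nhds (show x₀ - 1 < x₀ by linarith)] with x hx
    refine Eventually.of_forall fun t _ => ?_
    rw [norm_eq_abs, abs_of_pos ((hX x).inv_speed_pos hp hq t)]
    have h1 := angNum_mono p q t
      ((hX (x₀ - 1)).le_of_le hq0 (hX x) (by rw [hX0, hX0]; exact hx.le) t)
    have h2 := (hX (x₀ - 1)).pos t
    have h3 := angWeight_pos hp t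
    gcongr
  · refine Eventually.of_forall fun t ht => ?_
    rw [uIoc_of_le pi_pos.le] at ht
    have h1 := continuousAt_profile hq0 hX0 hX x₀ t ht.1.le
    refine ContinuousAt.div continuousAt_const ?_ ((hX x₀).pos t).ne'
    unfold angNum
    exact continuousAt_const.add (h1.rexp.mul continuousAt_const)

theorem exists_travel_eq (hp : 1 < p) (hq : p - 1 < q) {X : ℝ → ℝ → ℝ}
    (hX0 : ∀ x, X x 0 = x) (hX : ∀ x, IsProfile p q (X x)) {t : ℝ} (ht : 0 < t)
    (h : ∃ x, t < travel p q (X x) π) : ∃ x, travel p q (X x) π = t := by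
  obtain ⟨x₁, hx₁⟩ := h
  obtain ⟨x₂, hx₂⟩ := exists_travel_lt hp hq ht
  exact mem_range_of_exists_le_of_exists_ge (continuous_travel_profile hp hq hX0 hX)
    ⟨x₂, (hx₂ _ (hX x₂) (hX0 x₂)).le⟩ ⟨x₁, hx₁.le⟩

end profile

/-! ### The threshold as a linear rotation time -/

section threshold

variable {p q : ℝ}

theorem mul_lambdaQ (hq : p - 1 < q) :
    p * lambdaQ p q = betaQ p q ^ 2 * (2 * (p - 1) + (p - 2) * q) := by
  have h := mul_betaQ hq
  unfold lambdaQ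
  linear_combination (2 * betaQ p q) * h

theorem lambdaQ_nonpos_iff (hp : 1 < p) (hq : p - 1 < q) :
    lambdaQ p q ≤ 0 ↔ p < 2 ∧ 2 * (p - 1) / (2 - p) ≤ q := by
  have hb := pow_pos (betaQ_pos hp hq) 2
  have h := mul_lambdaQ hq
  have h1 : lambdaQ p q ≤ 0 ↔ 2 * (p - 1) + (p - 2) * q ≤ 0 := by
    rw [← not_lt, ← mul_pos_iff_of_pos_left (by linarith : (0 : ℝ) < p), h,
      mul_pos_iff_of_pos_left hb, not_lt]
  rw [h1]
  constructor
  · intro h2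
    have h3 : p < 2 := by
      by_contra! h4
      have := mul_nonneg (by linarith : (0 : ℝ) ≤ p - 2) (by linarith : (0 : ℝ) ≤ q)
      linarith
    refine ⟨h3, ?_⟩
    rw [div_le_iff₀ (by linarith)]
    linarith
  · rintro ⟨h2, h3⟩
    rw [div_le_iff₀ (by linarith)] at h3
    linarith

theorem lambdaQ_neg_iff (hp : 1 < p) (hq : p - 1 < q) :
    lambdaQ p q < 0 ↔ p < 2 ∧ 2 * (p - 1) / (2 - p) < q := by
  have hb := pow_pos (betaQ_pos hp hq) 2
  have h := mul_lambdaQ hq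
  constructor
  · intro hl
    obtain ⟨h2, -⟩ := (lambdaQ_nonpos_iff hp hq).1 hl.le
    refine ⟨h2, ?_⟩
    rw [div_lt_iff₀ (by linarith)]
    by_contra! h3
    have := mul_nonneg hb.le (by linarith : 0 ≤ 2 * (p - 1) + (p - 2) * q)
    have := mul_neg_of_pos_of_neg (by linarith : 0 < p) hl
    linarith
  · rintro ⟨h2, h3⟩
    rw [div_lt_iff₀ (by linarith)] at h3
    by_contra! hl
    have := mul_neg_of_pos_of_neg hb (by linarith : 2 * (p - 1) + (p - 2) * q < 0)
    have := mul_nonneg (by linarith : 0 ≤ p) hl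
    linarith

/-- Thus `angLin` is `(p - 1) β²` times `cos² + m² sin²`, which makes the linear travel time
computable. -/
theorem mQ_sq (hp : 1 < p) (hq : p - 1 < q) (hl : 0 < lambdaQ p q) :
    0 < mQ p q ∧ lambdaQ p q = (p - 1) * betaQ p q ^ 2 * mQ p q ^ 2 := by
  have hb := pow_pos (betaQ_pos hp hq) 2
  have h := mul_lambdaQ hq
  have hp0 : 0 < p := by linarith
  have hp1 : 0 < p - 1 := by linarith
  have h1 : 0 < 2 * (p - 1) + (p - 2) * q := by
    by_contra! h2
    have := mul_nonpos_of_nonneg_of_nonpos hb.le h2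
    have := mul_pos hp0 hl
    linarith
  have h2 : 0 < (2 * (p - 1) + (p - 2) * q) / (p * (p - 1)) := by positivity
  refine ⟨sqrt_pos.2 h2, ?_⟩
  rw [mQ, sq_sqrt h2.le]
  field_simp
  linarith

theorem sub_two_eq (hp : 1 < p) (hq : p - 1 < q) (hl : 0 < lambdaQ p q) :
    p - 2 = betaQ p q * (p - 1) * (mQ p q ^ 2 - 1) := by
  have hb := betaQ_pos hp hq
  have h1 := (mQ_sq hp hq hl).2
  have h2 := betaQ_sq_sub_lambdaQ hq
  have : betaQ p q * (p - 2) = betaQ p q * (betaQ p q * (p - 1) * (mQ p q ^ 2 - 1)) := by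
    linear_combination -h2 + h1
  exact mul_left_cancel₀ hb.ne' this

/-- The relation `p - 2 = β (p - 1) (m² - 1)` cancels the factor `m - 1`, so the cases `p = 2` and
`p ≠ 2` have the same expression without singularity at `m = 1`. -/
theorem bigMQ_eq (hp : 1 < p) (hq : p - 1 < q) (hl : 0 < lambdaQ p q) :
    0 < 1 + betaQ p q - betaQ p q * mQ p q ∧
      bigMQ p q = betaQ p q * mQ p q / (1 + betaQ p q - betaQ p q * mQ p q) := by
  have hb := betaQ_pos hp hq
  obtain ⟨hm, -⟩ := mQ_sq hp hq hl
  have h2 := sub_two_eq hp hq hl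
  have hp1 : 0 < p - 1 := by linarith
  have h3 : (p - 1) * (mQ p q + 1) * (1 + betaQ p q - betaQ p q * mQ p q)
      = (p - 1) * mQ p q + 1 := by linear_combination h2
  have h4 : 0 < (p - 1) * mQ p q + 1 := by positivity
  have h5 : 0 < 1 + betaQ p q - betaQ p q * mQ p q := by
    rw [← h3] at h4
    exact pos_of_mul_pos_right h4 (by positivity)
  refine ⟨h5, ?_⟩
  unfold bigMQ
  split_ifs with h
  · have h6 : mQ p q = 1 := by
      have : betaQ p q * (p - 1) * (mQ p q ^ 2 - 1) = 0 := by rw [← h2, h]; ring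
      have h7 : mQ p q ^ 2 - 1 = 0 := by
        rcases mul_eq_zero.1 this with h8 | h8
        · exact absurd h8 (by positivity)
        · exact h8
      nlinarith
    rw [h6, betaQ, h]
    rw [show q + 1 - 2 = q - 1 by ring, mul_one, add_sub_cancel_right, div_one]
  · have h6 : mQ p q - 1 ≠ 0 := by
      intro h7
      apply h
      rw [sub_eq_zero.1 h7] at h2
      linarith
    rw [div_eq_div_iff (mul_ne_zero h4.ne' h6) h5.ne', ← h3, h2]
    ring

theorem bigMQ_pos (hp : 1 < p) (hq : p - 1 < q) (hl : 0 < lambdaQ p q) : 0 < bigMQ p q := by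
  obtain ⟨h1, h2⟩ := bigMQ_eq hp hq hl
  have hb := betaQ_pos hp hq
  have hm := (mQ_sq hp hq hl).1
  rw [h2]
  positivity

/-- An antiderivative of `m / (cos² + m² sin²)` on the whole line. -/
theorem hasDerivAt_add_arctan {m : ℝ} (hm : 0 < m) (θ : ℝ) :
    HasDerivAt (fun θ => θ + arctan ((m - 1) * (sin θ * cos θ) / (cos θ ^ 2 + m * sin θ ^ 2)))
      (m / (cos θ ^ 2 + m ^ 2 * sin θ ^ 2)) θ := by
  have h := sin_sq_add_cos_sq θ
  have hpos : ∀ a : ℝ, 0 < a → 0 < cos θ ^ 2 + a * sin θ ^ 2 := fun a ha => by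
    rcases eq_or_ne (sin θ) 0 with h0 | h0
    · rw [h0] at h ⊢; linarith
    · have : 0 < a * sin θ ^ 2 := by positivity
      linarith [sq_nonneg (cos θ)]
  have hd := hpos m hm
  have hd2 := hpos (m ^ 2) (by positivity)
  have h1 := (((hasDerivAt_sin θ).mul (hasDerivAt_cos θ)).const_mul (m - 1)).div
    (((hasDerivAt_cos θ).pow 2).add (((hasDerivAt_sin θ).pow 2).const_mul m)) hd.ne'
  refine ((hasDerivAt_id θ).add h1.arctan).congr_deriv ?_
  simp only [Pi.mul_apply, Pi.add_apply, Pi.pow_apply, Nat.cast_ofNat, Pi.div_apply]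
  -- The arctangent in the statement is `arctan (m tan θ) - θ` by the subtraction formula, written
  -- without the poles of the tangent.
  have hsum : 1 + ((m - 1) * (sin θ * cos θ) / (cos θ ^ 2 + m * sin θ ^ 2)) ^ 2
      = (cos θ ^ 2 + m ^ 2 * sin θ ^ 2) / (cos θ ^ 2 + m * sin θ ^ 2) ^ 2 := by
    rw [div_pow, eq_div_iff (by positivity), add_mul, div_mul_cancel₀ _ (by positivity)]
    linear_combination (cos θ ^ 2 + m ^ 2 * sin θ ^ 2) * h
  rw [hsum]
  field_simp
  simp only [Nat.add_one_sub_one, pow_one]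
  linear_combination ((m - 1) * (cos θ ^ 2 - m * sin θ ^ 2) + m) * h

theorem integral_linear_speed (hp : 1 < p) (hq : p - 1 < q) (hl : 0 < lambdaQ p q) :
    ∫ t in (0 : ℝ)..π / 2, betaQ p q * angWeight p t / angLin p q t = π / (2 * bigMQ p q) := by
  have hb := betaQ_pos hp hq
  obtain ⟨hm, hlm⟩ := mQ_sq hp hq hl
  obtain ⟨h5, hM⟩ := bigMQ_eq hp hq hl
  have hp1 : 0 < p - 1 := by linarith
  have h2 := sub_two_eq hp hq hl
  set b := betaQ p q
  set m := mQ p q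
  have hN : ∀ t, angLin p q t = (p - 1) * b ^ 2 * (cos t ^ 2 + m ^ 2 * sin t ^ 2) := fun t => by
    unfold angLin; rw [hlm]; ring
  have hpos : ∀ t, 0 < cos t ^ 2 + m ^ 2 * sin t ^ 2 := fun t => by
    have h := sin_sq_add_cos_sq t
    rcases eq_or_ne (sin t) 0 with h0 | h0
    · rw [h0] at h ⊢; linarith
    · have : 0 < m ^ 2 * sin t ^ 2 := by positivity
      linarith [sq_nonneg (cos t)]
  -- The integrand equals `-1 + ((1 + β) / β) / (cos² + m² sin²)`. At `π/2` the arctangent term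
  -- vanishes, which leaves `(π / 2) * ((1 + β) / (β m) - 1)`.
  have hder : ∀ t, HasDerivAt (fun θ => -θ + (1 + b) / (b * m) *
      (θ + arctan ((m - 1) * (sin θ * cos θ) / (cos θ ^ 2 + m * sin θ ^ 2))))
      (b * angWeight p t / angLin p q t) t := fun t => by
    refine ((hasDerivAt_id t).neg.add ((hasDerivAt_add_arctan hm t).const_mul _)).congr_deriv ?_
    have h := sin_sq_add_cos_sq t
    have := (hpos t).ne'
    rw [hN, angWeight, eq_div_iff (by positivity)]
    field_simp
    linear_combination sin t ^ 2 * h2 - (p - 1) * (1 + b) * h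
  rw [intervalIntegral.integral_eq_sub_of_hasDerivAt (fun t _ => hder t)
    (Continuous.intervalIntegrable ?_ _ _)]
  · simp only [sin_pi_div_two, cos_pi_div_two, sin_zero, cos_zero]
    rw [hM]
    simp
    field_simp
    ring
  · have : Continuous (angWeight p) := by unfold angWeight; fun_prop
    refine (continuous_const.mul this).div (continuous_angLin p q) fun t => ?_
    rw [hN]
    have := hpos t
    positivity

theorem kQ_pos (p q : ℝ) : 0 < kQ p q := by
  unfold kQ
  split_ifs
  · exact one_pos
  · obtain ⟨n, hn⟩ := exists_nat_gt (max (bigMQ p q) 0)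
    refine (Nat.sInf_mem (s := {k : ℕ | 0 < k ∧ bigMQ p q < (k : ℝ)}) ⟨n, ?_, ?_⟩).1
    · exact_mod_cast (le_max_right _ _).trans_lt hn
    · exact (le_max_left _ _).trans_lt hn

theorem kQ_of_lambdaQ_nonpos (hp : 1 < p) (hq : p - 1 < q) (hl : lambdaQ p q ≤ 0) :
    kQ p q = 1 := if_pos ((lambdaQ_nonpos_iff hp hq).1 hl)

theorem kQ_le_iff (hp : 1 < p) (hq : p - 1 < q) (hl : 0 < lambdaQ p q) {k : ℕ} (hk : 0 < k) :
    kQ p q ≤ k ↔ bigMQ p q < k := by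
  have h1 : ¬ (p < 2 ∧ 2 * (p - 1) / (2 - p) ≤ q) := fun h =>
    absurd ((lambdaQ_nonpos_iff hp hq).2 h) hl.not_ge
  rw [kQ, if_neg h1]
  constructor
  · intro h2
    obtain ⟨n, hn⟩ := exists_nat_gt (max (bigMQ p q) 0)
    have h3 := (Nat.sInf_mem (s := {k : ℕ | 0 < k ∧ bigMQ p q < (k : ℝ)}) ⟨n, by
      exact_mod_cast (le_max_right _ _).trans_lt hn, (le_max_left _ _).trans_lt hn⟩).2
    exact h3.trans_le (by exact_mod_cast h2)
  · exact fun h2 => Nat.sInf_le ⟨hk, h2⟩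

end threshold

/-! ### Positive solutions -/

section positive

variable {p q : ℝ} {f : ℝ → ℝ}

theorem IsSolution.deriv_flux {ω : ℝ → ℝ} (h : IsSolution p q 0 ω) (σ : ℝ) :
    deriv (flux p q ω) σ = -(lambdaQ p q * weight p q ω σ * ω σ + |ω σ| ^ (q - 1) * ω σ) := by
  have := h.equation σ
  linarith

/-- For `λ ≥ 0` the equation makes the flux of a positive solution strictly decreasing, but the flux
is periodic. -/
theorem positiveSolutions_eq_empty (hl : 0 ≤ lambdaQ p q) : positiveSolutions p q 0 = ∅ := by
  rw [eq_empty_iff_forall_notMem]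
  rintro f ⟨hf, hpos⟩
  have h1 : StrictAnti (flux p q f) := strictAnti_of_deriv_neg fun σ => by
    have h2 : 0 < |f σ| ^ (q - 1) * f σ :=
      mul_pos (rpow_pos_of_pos (abs_pos.2 (hpos σ).ne') _) (hpos σ)
    have h3 : 0 ≤ lambdaQ p q * weight p q f σ * f σ :=
      mul_nonneg (mul_nonneg hl (rpow_nonneg (by positivity) _)) (hpos σ).le
    rw [hf.deriv_flux]
    linarith
  have hd : deriv f (0 + 2 * π) = deriv f 0 := by
    rw [← deriv_comp_add_const, show (fun x => f (x + 2 * π)) = f from funext hf.periodic]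
  have h2 := h1 (show (0 : ℝ) < 0 + 2 * π by linarith [pi_pos])
  have h3 : flux p q f (0 + 2 * π) = flux p q f 0 := by
    unfold flux weight
    rw [hd, hf.periodic]
  exact h2.ne h3

/-- The constant solution, when the reaction term has the right sign. -/
theorem const_mem_positiveSolutions (hp : 1 < p) (hq : p - 1 < q) (hl : lambdaQ p q < 0) {c : ℝ}
    (hc : 0 < c) :
    (fun _ => c) ∈ positiveSolutions p q 0 ↔ c = (-cQ p q) ^ (1 / (q + 1 - p)) := by
  have hb := betaQ_pos hp hq
  have hk : 0 < q + 1 - p := by linarith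
  have hflux : flux p q (fun _ => c) = fun _ => 0 := by
    funext σ; simp [flux]
  have hw : ∀ σ, weight p q (fun _ => c) σ = betaQ p q ^ (p - 2) * c ^ (p - 2) := fun σ => by
    simp only [weight, deriv_const]
    rw [show betaQ p q ^ 2 * c ^ 2 + 0 ^ 2 = (betaQ p q * c) ^ (2 : ℝ) by rw [rpow_two]; ring,
      ← rpow_mul (by positivity), mul_rpow hb.le hc.le]
    congr 2 <;> ring
  have heq : lambdaQ p q * (betaQ p q ^ (p - 2) * c ^ (p - 2)) * c + |c| ^ (q - 1) * c
      = c ^ (p - 1) * (c ^ (q + 1 - p) + cQ p q) := by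
    have h1 : c ^ (p - 2) * c = c ^ (p - 1) := by
      rw [← rpow_add_one hc.ne']; congr 1; ring
    have h2 : c ^ (q - 1) * c = c ^ (p - 1) * c ^ (q + 1 - p) := by
      rw [← rpow_add_one hc.ne', ← rpow_add hc]; congr 1; ring
    rw [abs_of_pos hc, h2, ← h1, cQ]
    ring
  have hcneg : 0 < -cQ p q := by
    rw [cQ]
    have := mul_neg_of_pos_of_neg (rpow_pos_of_pos hb (p - 2)) hl
    linarith
  have hiff : c = (-cQ p q) ^ (1 / (q + 1 - p)) ↔ c ^ (q + 1 - p) + cQ p q = 0 := by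
    rw [one_div, eq_rpow_inv hc.le hcneg.le hk.ne']
    constructor <;> intro h <;> linarith
  rw [hiff]
  constructor
  · rintro ⟨h, -⟩
    have h1 := h.deriv_flux 0
    rw [hflux, hw, heq, deriv_const] at h1
    have h2 : c ^ (p - 1) * (c ^ (q + 1 - p) + cQ p q) = 0 := by linarith
    exact (mul_eq_zero.1 h2).resolve_left (rpow_pos_of_pos hc _).ne'
  · intro h
    refine ⟨⟨contDiff_const, fun _ => rfl, ?_, fun σ => ?_⟩, fun _ => hc⟩
    · rw [hflux]; exact differentiable_const _
    · rw [hflux, hw, deriv_const, zero_mul, zero_mul, sub_zero, zero_add, heq, h, mul_zero]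

/-- The flux as a function of the logarithmic derivative. -/
noncomputable def logFlux (p q y : ℝ) : ℝ := (betaQ p q ^ 2 + y ^ 2) ^ ((p - 2) / 2) * y

theorem contDiff_logFlux (hp : 1 < p) (hq : p - 1 < q) : ContDiff ℝ 1 (logFlux p q) := by
  have hb := betaQ_pos hp hq
  unfold logFlux
  refine ContDiff.mul (ContDiff.rpow_const_of_ne (by fun_prop) fun y => ?_) contDiff_id
  positivity

theorem logFlux_eq_zero (hp : 1 < p) (hq : p - 1 < q) {y : ℝ} (h : y * logFlux p q y = 0) :
    y = 0 := by
  have hb := betaQ_pos hp hq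
  by_contra h0
  have : 0 < (betaQ p q ^ 2 + y ^ 2) ^ ((p - 2) / 2) := by positivity
  rw [logFlux] at h
  rcases mul_eq_zero.1 h with h1 | h1
  · exact h0 h1
  · exact (mul_ne_zero this.ne' h0) h1

theorem IsSolution.differentiable_logDeriv (hp : 1 < p) (hq : p - 1 < q) (h : IsSolution p q 0 f)
    (hf : ∀ σ, 0 < f σ) : Differentiable ℝ fun σ => deriv f σ / f σ := fun σ => by
  have hb := betaQ_pos hp hq
  have h1 := hf σ
  exact ((h.hasDerivAt_deriv hp hq (by positivity)).differentiableAt).div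
    (h.contDiff.differentiable one_ne_zero σ) h1.ne'

/-- By homogeneity the flux divided by `f ^ (p - 1)` depends only on `f' / f`; the equation becomes
of Riccati type, with `f` itself entering only through `f ^ (q + 1 - p)`. -/
theorem IsSolution.hasDerivAt_logFlux (hp : 1 < p) (hq : p - 1 < q) (h : IsSolution p q 0 f)
    (hf : ∀ σ, 0 < f σ) (σ : ℝ) : HasDerivAt (fun σ => logFlux p q (deriv f σ / f σ))
      (-((betaQ p q ^ 2 + (deriv f σ / f σ) ^ 2) ^ ((p - 2) / 2)
        * (lambdaQ p q + (p - 1) * (deriv f σ / f σ) ^ 2)) - f σ ^ (q + 1 - p)) σ := by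
  have hb := betaQ_pos hp hq
  have hw : ∀ σ, weight p q f σ
      = f σ ^ (p - 2) * (betaQ p q ^ 2 + (deriv f σ / f σ) ^ 2) ^ ((p - 2) / 2) := fun σ => by
    have h1 := hf σ
    have h2 : f σ ^ (p - 2) = (f σ ^ 2) ^ ((p - 2) / 2) := by
      rw [← rpow_two, ← rpow_mul h1.le]; congr 1; ring
    rw [weight, h2, ← mul_rpow (by positivity) (by positivity)]
    congr 1
    field_simp
  have hpow : ∀ σ, f σ ^ (p - 2) = f σ ^ (p - 1) / f σ := fun σ => by
    rw [← rpow_sub_one (hf σ).ne']; congr 1; ring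
  have heq : (fun σ => logFlux p q (deriv f σ / f σ))
      = fun σ => flux p q f σ / f σ ^ (p - 1) := by
    funext σ
    have h1 := hf σ
    have h2 := rpow_pos_of_pos h1 (p - 1)
    rw [flux, hw, hpow, logFlux]
    field_simp
  rw [heq]
  have h1 := hf σ
  have h2 := rpow_pos_of_pos h1 (p - 1)
  have hfd := (h.contDiff.differentiable one_ne_zero σ).hasDerivAt
  have hd := (h.differentiable_flux σ).hasDerivAt.div
    (hfd.rpow_const (p := p - 1) (Or.inl h1.ne')) h2.ne'
  refine hd.congr_deriv ?_
  have hq1 : f σ ^ (q - 1) = f σ ^ (q + 1 - p) * f σ ^ (p - 1) / f σ := by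
    rw [← rpow_add h1, ← rpow_sub_one h1.ne']; congr 1; ring
  rw [h.deriv_flux, flux, hw, abs_of_pos h1, show p - 1 - 1 = p - 2 by ring, hq1, hpow]
  field_simp
  ring

/-- A positive solution takes equal values at two close critical points. -/
theorem IsSolution.eq_of_deriv_eq_zero (hp : 1 < p) (hq : p - 1 < q) (hl : lambdaQ p q < 0)
    (h : IsSolution p q 0 f) (hf : ∀ σ, 0 < f σ) {a b : ℝ} (hab : a ≤ b) (hπ : b - a ≤ π)
    (ha : deriv f a = 0) (hb : deriv f b = 0) : f a = f b := by
  have hbeta := betaQ_pos hp hq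
  have hk : 0 < q + 1 - p := by linarith
  set κ := q + 1 - p
  set y : ℝ → ℝ := fun σ => deriv f σ / f σ with hy
  set P : ℝ → ℝ := fun σ => logFlux p q (y σ) with hP
  set r : ℝ → ℝ := fun v => (betaQ p q ^ 2 + v ^ 2) ^ ((p - 2) / 2) with hr
  set A : ℝ → ℝ := fun v => r v * (lambdaQ p q + (p - 1) * v ^ 2) with hA
  have hfd : ∀ σ, HasDerivAt f (deriv f σ) σ := fun σ =>
    (h.contDiff.differentiable one_ne_zero σ).hasDerivAt
  have hyd : ∀ σ, HasDerivAt y (deriv y σ) σ := fun σ =>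
    (h.differentiable_logDeriv hp hq hf σ).hasDerivAt
  have hPd : ∀ σ, HasDerivAt P (-A (y σ) - f σ ^ κ) σ := fun σ => h.hasDerivAt_logFlux hp hq hf σ
  have hφ := contDiff_logFlux hp hq
  have hφd : ∀ v, HasDerivAt (logFlux p q) (deriv (logFlux p q) v) v := fun v =>
    (hφ.differentiable one_ne_zero v).hasDerivAt
  have hP2 : ∀ σ, deriv (logFlux p q) (y σ) * deriv y σ = -A (y σ) - f σ ^ κ := fun σ =>
    ((hφd (y σ)).comp σ (hyd σ)).unique (hPd σ)
  have hrc : Continuous r := by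
    refine Continuous.rpow_const (by fun_prop) fun v => Or.inl ?_
    positivity
  have hgc : Continuous fun v => deriv (logFlux p q) v * (A v + κ * (logFlux p q v * v)) := by
    have h1 := hφ.continuous_deriv le_rfl
    have h2 := hφ.continuous
    fun_prop
  set Ψ : ℝ → ℝ := fun u => ∫ v in (0 : ℝ)..u,
    deriv (logFlux p q) v * (A v + κ * (logFlux p q v * v)) with hΨ
  have hΨd : ∀ u, HasDerivAt Ψ (deriv (logFlux p q) u * (A u + κ * (logFlux p q u * u))) u :=
    fun u => (hgc.integral_hasStrictDerivAt 0 u).hasDerivAt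
  have hfk : ∀ σ, HasDerivAt (fun σ => f σ ^ κ) (κ * f σ ^ κ * y σ) σ := fun σ => by
    refine ((hfd σ).rpow_const (p := κ) (Or.inl (hf σ).ne')).congr_deriv ?_
    rw [rpow_sub_one (hf σ).ne', hy]
    ring
  have hνpos : 0 < -(lambdaQ p q * κ) := by
    have := mul_neg_of_neg_of_pos hl hk; linarith
  -- From `q β = p + (p - 1) β > p` it follows that `-λ κ = p (2 - q β) < p (2 - p) = 1 - (p - 1)² <
  -- 1`.
  have hν1 : -(lambdaQ p q * κ) < 1 := by
    have h1 := mul_betaQ hq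
    have h2 : p < q * betaQ p q := by
      have : q * betaQ p q = p + (p - 1) * betaQ p q := by linear_combination h1
      have := mul_pos (by linarith : 0 < p - 1) hbeta
      linarith
    have h3 : -(lambdaQ p q * κ) = p * (2 - q * betaQ p q) := by
      unfold lambdaQ
      linear_combination (2 - q * betaQ p q) * h1
    rw [h3]
    nlinarith [sq_pos_of_pos (by linarith : 0 < p - 1)]
  obtain ⟨ν, hν0, hνlt, hνsq⟩ : ∃ ν : ℝ, 0 < ν ∧ ν < 1 ∧ ν ^ 2 = -(lambdaQ p q * κ) :=
    ⟨√(-(lambdaQ p q * κ)), sqrt_pos.2 hνpos, (sqrt_lt' one_pos).2 (by linarith), sq_sqrt hνpos.le⟩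
  -- With the tangent centred at the midpoint, `|ν (σ - c)| < π / 2` on `[a, b]`, as `ν < 1` and `b
  -- - a ≤ π`.
  set c := (a + b) / 2 with hc
  have hcos : ∀ σ ∈ Icc a b, cos (ν * (σ - c)) ≠ 0 := fun σ hσ => by
    have hpi := pi_pos
    have h1 : |σ - c| ≤ π / 2 := by
      rw [abs_le]; constructor <;> linarith [hσ.1, hσ.2]
    have h2 : |ν * (σ - c)| < π / 2 := by
      rw [abs_mul, abs_of_pos hν0]
      nlinarith [abs_nonneg (σ - c)]
    exact (cos_pos_of_mem_Ioo ⟨(abs_lt.1 h2).1, (abs_lt.1 h2).2⟩).ne'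
  -- The first two terms are the energy: their derivative is `P'² + κ λ P² + κ (p - 1) (y P)²`. The
  -- tangent term completes the square, as in Picone's proof of the Dirichlet inequality, and
  -- absorbs `κ λ P² = -ν² P²`. As `G` vanishes where `y` does, it is nondecreasing with equal end
  -- values.
  set G : ℝ → ℝ := fun σ => -Ψ (y σ) - P σ * f σ ^ κ + ν * tan (ν * (σ - c)) * P σ ^ 2 with hG
  have hGd : ∀ σ ∈ Icc a b, HasDerivAt G
      ((-A (y σ) - f σ ^ κ + ν * tan (ν * (σ - c)) * P σ) ^ 2
        + κ * (p - 1) * (y σ * P σ) ^ 2) σ := fun σ hσ => by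
    have h1 : HasDerivAt (fun σ => tan (ν * (σ - c)))
        (1 / cos (ν * (σ - c)) ^ 2 * (ν * 1)) σ := by
      have h0 : HasDerivAt (fun σ => ν * (σ - c)) (ν * 1) σ :=
        ((hasDerivAt_id σ).sub_const c).const_mul ν
      exact (hasDerivAt_tan (hcos σ hσ)).comp σ h0
    refine (((((hΨd (y σ)).comp σ (hyd σ)).neg.sub ((hPd σ).mul (hfk σ))).add
      ((h1.const_mul ν).mul ((hPd σ).pow 2)))).congr_deriv ?_
    have h2 : 1 / cos (ν * (σ - c)) ^ 2 = 1 + tan (ν * (σ - c)) ^ 2 := by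
      rw [tan_eq_sin_div_cos]
      have := hcos σ hσ
      field_simp
      linarith [sin_sq_add_cos_sq (ν * (σ - c))]
    have h3 : A (y σ) * y σ = (lambdaQ p q + (p - 1) * y σ ^ 2) * P σ := by
      simp only [hA, hP, hr, logFlux]; ring
    have h4 := hP2 σ
    rw [h2]
    simp only [Nat.cast_ofNat, Nat.add_one_sub_one, pow_one, Pi.pow_apply]
    change -(deriv (logFlux p q) (y σ) * (A (y σ) + κ * (P σ * y σ)) * deriv y σ)
      - ((-A (y σ) - f σ ^ κ) * f σ ^ κ + P σ * (κ * f σ ^ κ * y σ)) + _ = _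
    linear_combination (-(A (y σ) + κ * (P σ * y σ))) * h4 + κ * P σ * h3 + P σ ^ 2 * hνsq
  have hya : y a = 0 := by simp only [hy, ha, zero_div]
  have hyb : y b = 0 := by simp only [hy, hb, zero_div]
  have hzero : ∀ σ, y σ = 0 → G σ = 0 := fun σ hσ => by
    simp [hG, hP, hΨ, hσ, logFlux]
  have hmono : MonotoneOn G (Icc a b) := by
    refine monotoneOn_of_hasDerivWithinAt_nonneg (convex_Icc a b)
      (fun σ hσ => (hGd σ hσ).continuousAt.continuousWithinAt)
      (fun σ hσ => (hGd σ (interior_subset hσ)).hasDerivWithinAt) fun σ _ => ?_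
    have : 0 ≤ κ * (p - 1) := mul_nonneg hk.le (by linarith)
    positivity
  have hG0 : ∀ σ ∈ Icc a b, G σ = 0 := fun σ hσ => le_antisymm
    (by rw [← hzero b hyb]; exact hmono hσ ⟨hab, le_rfl⟩ hσ.2)
    (by rw [← hzero a hya]; exact hmono ⟨le_rfl, hab⟩ hσ hσ.1)
  have hy0 : ∀ σ ∈ Ioo a b, deriv f σ = 0 := fun σ hσ => by
    have h1 : G =ᶠ[𝓝 σ] fun _ => 0 := by
      filter_upwards [Icc_mem_nhds hσ.1 hσ.2] with t ht using hG0 t ht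
    have h2 := (hGd σ (Ioo_subset_Icc_self hσ)).unique
      ((hasDerivAt_const σ (0 : ℝ)).congr_of_eventuallyEq h1)
    have h3 : 0 < κ * (p - 1) := mul_pos hk (by linarith)
    have h4 : κ * (p - 1) * (y σ * P σ) ^ 2 = 0 := by
      have := sq_nonneg (-A (y σ) - f σ ^ κ + ν * tan (ν * (σ - c)) * P σ)
      have := mul_nonneg h3.le (sq_nonneg (y σ * P σ))
      linarith
    have h5 : y σ * P σ = 0 := by
      have := (mul_eq_zero.1 h4).resolve_left h3.ne'
      exact pow_eq_zero_iff two_ne_zero |>.1 this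
    exact (div_eq_zero_iff.1 (logFlux_eq_zero hp hq h5)).resolve_right (hf σ).ne'
  rcases hab.eq_or_lt with rfl | hlt
  · rfl
  · obtain ⟨t, ht, hte⟩ := exists_deriv_eq_slope f hlt h.contDiff.continuous.continuousOn
      (h.contDiff.differentiable one_ne_zero).differentiableOn
    rw [hy0 t ht, eq_comm, div_eq_zero_iff] at hte
    rcases hte with h1 | h1 <;> linarith

/-- Modulo `2 π`, a maximum point and a minimum point have representatives at distance at most `π`.
Both are critical, so the extreme values agree. -/
theorem IsSolution.eq_const (hp : 1 < p) (hq : p - 1 < q) (hl : lambdaQ p q < 0)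
    (h : IsSolution p q 0 f) (hf : ∀ σ, 0 < f σ) : f = fun _ => f 0 := by
  have hpi := pi_pos
  have hfc := h.contDiff.continuous
  have hne : (Icc (0 : ℝ) (2 * π)).Nonempty := ⟨0, le_rfl, by linarith⟩
  obtain ⟨M, hM, hMmax⟩ := isCompact_Icc.exists_isMaxOn hne hfc.continuousOn
  obtain ⟨m, hm, hmmin⟩ := isCompact_Icc.exists_isMinOn hne hfc.continuousOn
  have hred : ∀ σ, ∃ t ∈ Icc (0 : ℝ) (2 * π), f σ = f t := fun σ => by
    obtain ⟨t, ht, hte⟩ := h.periodic.exists_mem_Ico₀ (by positivity) σ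
    exact ⟨t, Ico_subset_Icc_self ht, hte⟩
  have hmax : ∀ σ, f σ ≤ f M := fun σ => by
    obtain ⟨t, ht, hte⟩ := hred σ; rw [hte]; exact hMmax ht
  have hmin : ∀ σ, f m ≤ f σ := fun σ => by
    obtain ⟨t, ht, hte⟩ := hred σ; rw [hte]; exact hmmin ht
  have hcrit : ∀ s, (f s = f M ∨ f s = f m) → deriv f s = 0 := by
    rintro s (hs | hs)
    · exact IsLocalMax.deriv_eq_zero (Eventually.of_forall fun t => by rw [hs]; exact hmax t)
    · exact IsLocalMin.deriv_eq_zero (Eventually.of_forall fun t => by rw [hs]; exact hmin t)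
  have key := fun a b (hab : a ≤ b) (hπ : b - a ≤ π) =>
    h.eq_of_deriv_eq_zero hp hq hl hf hab hπ
  have hpM := h.periodic M
  have hpm := h.periodic m
  have heq : f m = f M := by
    rcases le_total m M with hle | hle
    · rcases le_total (M - m) π with h1 | h1
      · exact key m M hle h1 (hcrit _ (Or.inr rfl)) (hcrit _ (Or.inl rfl))
      -- When the distance exceeds `π`, moving the smaller of the two points by one period brings it
      -- within `π` on the other side.
      · rw [← hpm]
        exact (key M (m + 2 * π) (by linarith [hM.2, hm.1]) (by linarith) (hcrit _ (Or.inl rfl))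
          (hcrit _ (Or.inr hpm))).symm
    · rcases le_total (m - M) π with h1 | h1
      · exact (key M m hle h1 (hcrit _ (Or.inl rfl)) (hcrit _ (Or.inr rfl))).symm
      · rw [← hpM]
        exact key m (M + 2 * π) (by linarith [hm.2, hM.1]) (by linarith) (hcrit _ (Or.inr rfl))
          (hcrit _ (Or.inl hpM))
  funext σ
  have := hmax σ
  have := hmin σ
  have := hmax 0
  have := hmin 0
  linarith

theorem positiveSolutions_eq_singleton (hp : 1 < p) (hq : p - 1 < q) (hl : lambdaQ p q < 0) :
    positiveSolutions p q 0 = {fun _ => (-cQ p q) ^ (1 / (q + 1 - p))} := by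
  have hcneg : 0 < -cQ p q := by
    rw [cQ]
    have := mul_neg_of_pos_of_neg (rpow_pos_of_pos (betaQ_pos hp hq) (p - 2)) hl
    linarith
  refine Subset.antisymm ?_ ?_
  · rintro f ⟨hs, hf⟩
    have h1 := hs.eq_const hp hq hl hf
    have h2 : (fun _ => f 0) ∈ positiveSolutions p q 0 := by rw [← h1]; exact ⟨hs, hf⟩
    rw [mem_singleton_iff, h1, ← (const_mem_positiveSolutions hp hq hl (hf 0)).1 h2]
  · rw [singleton_subset_iff]
    exact (const_mem_positiveSolutions hp hq hl (rpow_pos_of_pos hcneg _)).2 rfl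

end positive

/-! ### Classification of the sign-changing solutions -/

section classification

variable {p q : ℝ}

theorem exists_pi_div_lt_travel_of_pos (hp : 1 < p) (hq : p - 1 < q)
    (hl : 0 < lambdaQ p q) {k : ℕ} (hk : kQ p q ≤ k) :
    ∃ x₀, ∀ X, IsProfile p q X → X 0 = x₀ → π / k < travel p q X π := by
  have hpi := pi_pos
  have hb := betaQ_pos hp hq
  have hk0 : 0 < k := (kQ_pos p q).trans_le hk
  have hM := bigMQ_pos hp hq hl
  have hMk := (kQ_le_iff hp hq hl hk0).1 hk
  have h1 : π / (2 * k) < π / (2 * bigMQ p q) := by gcongr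
  have hn : 0 < min ((p - 1) * betaQ p q ^ 2) (lambdaQ p q) :=
    lt_min (mul_pos (by linarith) (by positivity)) hl
  obtain ⟨x₀, hx₀⟩ := exists_lt_travel hp hq (by positivity) le_rfl hn (fun θ _ => by
    have h2 := sin_sq_add_cos_sq θ
    have h3 := mul_le_mul_of_nonneg_right (min_le_left ((p - 1) * betaQ p q ^ 2) (lambdaQ p q))
      (sq_nonneg (cos θ))
    have h4 := mul_le_mul_of_nonneg_right (min_le_right ((p - 1) * betaQ p q ^ 2) (lambdaQ p q))
      (sq_nonneg (sin θ))
    unfold angLin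
    calc _ = min ((p - 1) * betaQ p q ^ 2) (lambdaQ p q) * cos θ ^ 2
          + min ((p - 1) * betaQ p q ^ 2) (lambdaQ p q) * sin θ ^ 2 := by
          linear_combination -min ((p - 1) * betaQ p q ^ 2) (lambdaQ p q) * h2
      _ ≤ _ := add_le_add h3 h4) (sub_pos.2 h1)
  refine ⟨x₀, fun X hX hX0 => ?_⟩
  have h2 := hx₀ X hX hX0
  rw [integral_linear_speed hp hq hl] at h2
  rw [hX.travel_pi hp hq]
  have h3 : π / k = 2 * (π / (2 * k)) := by field_simp
  linarith

theorem exists_pi_div_lt_travel (hp : 1 < p) (hq : p - 1 < q) {k : ℕ} (hk : kQ p q ≤ k) :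
    ∃ x₀, ∀ X, IsProfile p q X → X 0 = x₀ → π / k < travel p q X π := by
  have hpi := pi_pos
  rcases lt_or_ge 0 (lambdaQ p q) with hl | hl
  · exact exists_pi_div_lt_travel_of_pos hp hq hl hk
  have hk1 : (1 : ℝ) ≤ k := by exact_mod_cast (kQ_pos p q).trans_le hk
  -- As `π / k ≤ π`, a travel time above `π` suffices; the extra `1` pays for the error allowed in
  -- `exists_lt_travel`.
  obtain ⟨θ₁, n, h0, h1, hn, hnl, hint⟩ := exists_lt_integral hp hq hl (π + 1)
  obtain ⟨x₀, hx₀⟩ := exists_lt_travel hp hq h0 h1 hn hnl one_pos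
  refine ⟨x₀, fun X hX hX0 => ?_⟩
  have h2 := hx₀ X hX hX0
  have h3 := (hX.strictMono_travel hp hq).monotone (show θ₁ ≤ π by linarith)
  have h4 : π / k ≤ π := div_le_self hpi.le hk1
  linarith

/-- For `λ > 0` the quarter travel time `π / (2 k)` lies strictly below `π / (2 M_q)`, hence `M_q <
k`. For `λ ≤ 0` every positive `k` is admissible. -/
theorem kQ_le_of_travel_eq (hp : 1 < p) (hq : p - 1 < q) {X : ℝ → ℝ} (hX : IsProfile p q X)
    {k : ℕ} (hk : 0 < k) (hT : travel p q X π * k = π) : kQ p q ≤ k := by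
  rcases lt_or_ge 0 (lambdaQ p q) with hl | hl
  · rw [kQ_le_iff hp hq hl hk]
    have hpi := pi_pos
    have hM := bigMQ_pos hp hq hl
    have hk0 : (0 : ℝ) < k := by exact_mod_cast hk
    have h1 := hX.travel_lt hp hq hl
    rw [integral_linear_speed hp hq hl, lt_div_iff₀ (by positivity)] at h1
    rw [hX.travel_pi hp hq] at hT
    have h2 : 0 < travel p q X (π / 2) := by
      have := hX.travel_pi_pos hp hq
      rw [hX.travel_pi hp hq] at this
      linarith
    nlinarith
  · rw [kQ_of_lambdaQ_nonpos hp hq hl]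
    exact hk

theorem exists_signChangingSolutions_eq (hp : 1 < p) (hq : p - 1 < q) :
    ∃ ω : ℕ → ℝ → ℝ, (∀ k : ℕ, kQ p q ≤ k → HasLeastPeriod (ω k) (2 * π / (k : ℝ))) ∧
      signChangingSolutions p q 0 = ⋃ k ∈ Ici (kQ p q), {f | ∃ ψ, f = fun σ => ω k (σ + ψ)} := by
  choose X hX0 hX using exists_isProfile hp hq
  have hkpos : ∀ k : ℕ, kQ p q ≤ k → (0 : ℝ) < k := fun k hk => by
    exact_mod_cast (kQ_pos p q).trans_le hk
  have hx : ∀ k : ℕ, ∃ x, kQ p q ≤ k → travel p q (X x) π = π / k := fun k => by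
    by_cases hk : kQ p q ≤ k
    · obtain ⟨x₀, hx₀⟩ := exists_pi_div_lt_travel hp hq hk
      obtain ⟨x, hx⟩ := exists_travel_eq hp hq hX0 hX (div_pos pi_pos (hkpos k hk))
        ⟨x₀, hx₀ _ (hX x₀) (hX0 x₀)⟩
      exact ⟨x, fun _ => hx⟩
    · exact ⟨0, fun h => absurd h hk⟩
  choose x hx using hx
  refine ⟨fun k => wave p q (X (x k)), fun k hk => ?_, ?_⟩
  · rw [mul_div_assoc, ← hx k hk]
    exact (hX _).hasLeastPeriod_wave hp hq
  · ext f
    simp only [mem_iUnion, mem_Ici, mem_ofPred_eq, exists_prop]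
    constructor
    · intro hf
      obtain ⟨Y, hY, ⟨ψ, hψ⟩, k, hk, hT⟩ := exists_eq_wave hp hq hf
      have hkq := kQ_le_of_travel_eq hp hq hY hk hT
      refine ⟨k, hkq, ψ, ?_⟩
      have hTX : travel p q (X (x k)) π = travel p q Y π := by
        rw [hx k hkq, div_eq_iff (hkpos k hkq).ne', hT]
      -- The half period is strictly monotone in the initial value, so equal half periods force
      -- equal initial values and hence equal profiles.
      have h0 : X (x k) 0 = Y 0 := by
        rcases lt_trichotomy (X (x k) 0) (Y 0) with h | h | h
        · exact absurd hTX ((hX _).travel_lt_travel hp hq hY h).ne'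
        · exact h
        · exact absurd hTX (hY.travel_lt_travel hp hq (hX _) h).ne
      rw [show X (x k) = Y from funext fun b => (hX _).eq_of_eq (by linarith) hY h0 b]
      exact hψ
    · rintro ⟨k, hk, ψ, rfl⟩
      refine (hX _).wave_mem hp hq (k := k) ?_ ψ
      rw [hx k hk, div_mul_cancel₀ _ (hkpos k hk).ne']

end classification

end SeparableSolutions

theorem corollary4p7 (p q : ℝ) (hp : 1 < p) (hq : p - 1 < q) :
    (∃ ω : ℕ → ℝ → ℝ,
      (∀ k : ℕ, SeparableSolutions.kQ p q ≤ k →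
        SeparableSolutions.HasLeastPeriod (ω k) (2 * Real.pi / (k : ℝ))) ∧
      SeparableSolutions.signChangingSolutions p q 0 =
        ⋃ k ∈ Set.Ici (SeparableSolutions.kQ p q),
          {f : ℝ → ℝ | ∃ ψ : ℝ, f = fun σ => ω k (σ + ψ)}) ∧
    ((2 ≤ p ∨ (p < 2 ∧ q ≤ 2 * (p - 1) / (2 - p))) →
      SeparableSolutions.positiveSolutions p q 0 = ∅) ∧
    ((p < 2 ∧ 2 * (p - 1) / (2 - p) < q) →
      SeparableSolutions.positiveSolutions p q 0 =
        {fun _ => (-SeparableSolutions.cQ p q) ^ (1 / (q + 1 - p))}) := by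
  refine ⟨SeparableSolutions.exists_signChangingSolutions_eq hp hq, fun h => ?_, fun h =>
    SeparableSolutions.positiveSolutions_eq_singleton hp hq
      ((SeparableSolutions.lambdaQ_neg_iff hp hq).2 h)⟩
  refine SeparableSolutions.positiveSolutions_eq_empty (not_lt.1 fun hl => ?_)
  obtain ⟨h1, h2⟩ := (SeparableSolutions.lambdaQ_neg_iff hp hq).1 hl
  rcases h with h | h
  · linarith
  · linarith [h.2]
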